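/- **Setting.** Let $\mathcal{L}$ be Lebesgue measure on $\mathbb{R}$ and $\mathcal{M}_+(\mathbb{R})$ the finite positive Radon measures on $\mathbb{R}$ with the weak topology (tested with bounded continuous functions). For $\nu\in\mathcal{M}_+(\mathbb{R})$ write $\nu=\nu_{ac}+\nu_{pp}+\nu_{sc}$ for its absolutely continuous, pure point and singular continuous parts with respect to $\mathcal{L}$. Let $\mathcal{D}$ be the set of pairs $(u,\mu)$ with $u\in C_b(\mathbb{R})$, weak derivative $u_x\in L^2(\mathbb{R})$, $\mu\in\mathcal{M}_+(\mathbb{R})$ and $d\mu_{ac}=u_x^2\,dx$. A *global-in-time conservative solution* with initial datum $(\bar u,\bar\mu)\in\mathcal{D}$ is a pair $(u(t),\mu(t))_{t\in\mathbb{R}}$ such that (a) $u\in C(\mathbb{R};C_b(\mathbb{R}))\cap C^{1/2}_{loc}(\mathbb{R}\times\mathbb{R})$, $u_t\in L^2_{loc}(\mathbb{R}\times\mathbb{R})$, $u_x(\cdot,t)\in L^2(\mathbb{R})$ for all $t$, and $\mu\in C(\mathbb{R};\mathcal{M}_+(\mathbb{R}))$; (b) $(u(\cdot,0),\mu(0))=(\bar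 u,\bar\mu)$, and $d\mu(t)=u_x^2(x,t)\,dx$ for a.e. $t$; (c) $\int_{\mathbb{R}}\int_{\mathbb{R}}\big[u\phi_t-\phi\,(uu_x-\tfrac12F)\big]\,dx\,dt=0$ for all $\phi\in C_c^\infty(\mathbb{R}\times\mathbb{R})$, where $F(x,t)=\mu(t)((-\infty,x])$; (d) $\int_{\mathbb{R}}\int_{\mathbb{R}}(\phi_t+u\phi_x)\,d\mu(t)\,dt=0$ for all $\phi\in C_c^\infty(\mathbb{R}\times\mathbb{R})$; (e) $d\mu_{ac}(t)=u_x^2(x,t)\,dx$ for all $t$. For $(\bar u,\bar\mu)\in\mathcal{D}$ put $\bar x(\alpha)=\sup\{x:\ x+\bar\mu((-\infty,x))\le\alpha\}$, $f(\alpha)=1-\bar x'(\alpha)$, $y(\alpha,t)=\bar x(\alpha)+\bar u(\bar x(\alpha))t+\frac{t^2}{4}(\alpha-\bar x(\alpha))$ and $X_t(x)=x+\bar u(x)t+\frac{t^2}{4}\bar\mu((-\infty,x))$. For $t\in\mathbb{R}$ let $A_t^{L,pp}$ (respectively $A_t^{L,sc}$) be the set of $\alpha$ with $y_\alpha(\alpha,t)=0$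 for which the level set of $y(\cdot,t)$ through $\alpha$ has more than one point (respectively is $\{\alpha\}$), and let $B_t^L=\{\alpha:\ y_\alpha(\alpha,t)>0\}$. For $t\ne0$ let $A_t^E=\{x:\ \bar u_x(x)=-2/t\}$, where $\bar u_x$ is any fixed representative of the weak derivative, and let $I_t$ be the union of all open intervals of positive length that are contained in $A_t^E$ up to a Lebesgue null set and on which the singular part of $\bar\mu$ vanishes. **Theorem.** For every $(\bar u,\bar\mu)\in\mathcal{D}$ there is a unique global-in-time conservative solution $(u,\mu)$ with initial datum $(\bar u,\bar\mu)$. It is given by $u(y(\alpha,t),t)=\bar u(\bar x(\alpha))+\frac t2(\alpha-\bar x(\alpha))$ and $\mu(t)=y(\cdot,t)\#(f\,d\alpha)$ for all $\alpha,t\in\mathbb{R}$, and it has the following properties. (i) $\mu\in C(\mathbb{R};\mathcal{M}_+(\mathbb{R}))$ and $\mu(t)(\mathbb{R})=\bar\mu(\mathbb{R})$ for all $t\in\mathbb{R}$. (ii) For all $t\in\mathbb{R}$: $\mu_{pp}(t)=y(\cdot,t)\#(f|_{A_t^{L,pp}}d\alpha)$, $\mu_{sc}(t)=y(\cdot,t)\#(f|_{A_t^{L,sc}}d\alpha)$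 and $\mu_{ac}(t)=y(\cdot,t)\#(f|_{B_t^L}d\alpha)$. For all $t\ne0$: - $A_t^{L,pp}\cup A_t^{L,sc}=\{\alpha:\ \bar x'(\alpha)>0,\ \bar u_x(\bar x(\alpha))=-2/t\}$ up to a null set; - if $\mathcal{L}(A_t^E)\ne0$, then $\mu_{pp}(t)+\mu_{sc}(t)\ne0$; - $\mu_{pp}(t)+\mu_{sc}(t)$ is concentrated on $X_t(A_t^E)$, that is, $(\mu_{pp}(t)+\mu_{sc}(t))(\mathbb{R}\setminus X_t(A_t^E))=0$; in particular its topological support is contained in $\overline{X_t(A_t^E)}$; - $\mu_{pp}(t)=X_t\#(\bar\mu_{ac}|_{A_t^E\cap I_t})$ and $\mu_{sc}(t)=X_t\#(\bar\mu_{ac}|_{A_t^E\setminus I_t})$. (iii) The sets $T_p=\{t:\ \mu_{pp}(t)\ne0\}$ and $T_s=\{t:\ \mu_{sc}(t)\ne0\}$ are countable. (iv) For every $t\in\mathbb{R}$ the function $u(\cdot,t)$ is globally absolutely continuous on $\mathbb{R}$, and $d\mu_{ac}(t)=u_x^2(x,t)\,dx$. Moreover $u\in C(\mathbb{R};C_b(\mathbb{R}))\cap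 C^{1/2}_{loc}(\mathbb{R}\times\mathbb{R})$, $u_x\in L^\infty(\mathbb{R};L^2(\mathbb{R}))$ and $u_t\in L^2_{loc}(\mathbb{R}\times\mathbb{R})$. (v) If $\bar u(-\infty)=\lim_{x\to-\infty}\bar u(x)$ exists, then $\lim_{x\to-\infty}u(x,t)=\bar u(-\infty)$ for all $t$. If $\bar u(+\infty)=\lim_{x\to+\infty}\bar u(x)$ exists, then $\lim_{x\to+\infty}u(x,t)=\bar u(+\infty)+\frac12\bar\mu(\mathbb{R})\,t$ for all $t$. -/

import Mathlib

open MeasureTheory Filter Topology Set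
open scoped ContDiff BoundedContinuousFunction ENNReal NNReal

namespace HunterSaxton

noncomputable section

/-! ### Weak derivatives -/

/-- `g` is a weak derivative on `ℝ` of the (locally integrable) function `v`. -/
structure IsWeakDeriv (v g : ℝ → ℝ) : Prop where
  locInt_fun : LocallyIntegrable v volume
  locInt_deriv : LocallyIntegrable g volume
  byParts : ∀ φ : ℝ → ℝ, ContDiff ℝ ∞ φ → HasCompactSupport φ →
    ∫ x, v x * deriv φ x = -∫ x, g x * φ x

/-- Test functions `φ ∈ C_c^∞(ℝ × ℝ)`; the variables are `(x, t)`. -/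
def IsTestFun (φ : ℝ × ℝ → ℝ) : Prop := ContDiff ℝ ∞ φ ∧ HasCompactSupport φ

/-- The partial derivative `φ_x (x, t)`. -/
def dX (φ : ℝ × ℝ → ℝ) (x t : ℝ) : ℝ := deriv (fun z => φ (z, t)) x

/-- The partial derivative `φ_t (x, t)`. -/
def dT (φ : ℝ × ℝ → ℝ) (x t : ℝ) : ℝ := deriv (fun s => φ (x, s)) t

/-- `w` is the weak time derivative on `ℝ × ℝ` of `(x, t) ↦ u t x`, and `w ∈ L²_loc(ℝ × ℝ)`. -/
def IsL2locTimeDeriv (u : ℝ → ℝ →ᵇ ℝ) (w : ℝ × ℝ → ℝ) : Prop :=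
  (∀ K : Set (ℝ × ℝ), IsCompact K → MemLp w 2 (volume.restrict K)) ∧
  ∀ φ : ℝ × ℝ → ℝ, IsTestFun φ →
    ∫ p : ℝ × ℝ, u p.2 p.1 * dT φ p.1 p.2 = -∫ p : ℝ × ℝ, w p * φ p

/-- The function `(x, t) ↦ u t x` is in `C^{1/2}_loc(ℝ × ℝ)`. -/
def LocHolderHalf (u : ℝ → ℝ →ᵇ ℝ) : Prop :=
  ∀ R : ℝ, ∃ C : ℝ≥0,
    HolderOnWith C (1 / 2) (fun p : ℝ × ℝ => u p.2 p.1) (Metric.closedBall 0 R)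

/-- Absolute continuity of a function on the whole of `ℝ` (one `δ` for all of `ℝ`). -/
def GloballyAC (v : ℝ → ℝ) : Prop :=
  ∀ ε > 0, ∃ δ > 0, ∀ (n : ℕ) (a b : Fin n → ℝ), (∀ i, a i ≤ b i) →
    (Pairwise fun i j => Disjoint (Ioo (a i) (b i)) (Ioo (a j) (b j))) →
    ∑ i, (b i - a i) < δ → ∑ i, |v (b i) - v (a i)| < ε

/-! ### Decomposition of a measure on the line with respect to Lebesgue measure -/

/-- The absolutely continuous part. -/
def acPart (ν : Measure ℝ) : Measure ℝ := volume.withDensity (ν.rnDeriv volume)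

/-- The set of atoms. -/
def atoms (ν : Measure ℝ) : Set ℝ := {x | ν {x} ≠ 0}

/-- The pure point part. -/
def ppPart (ν : Measure ℝ) : Measure ℝ := ν.restrict (atoms ν)

/-- The singular continuous part. -/
def scPart (ν : Measure ℝ) : Measure ℝ := (ν.singularPart volume).restrict (atoms ν)ᶜ

/-- The measure `g² dx`. -/
def sqMeasure (g : ℝ → ℝ) : Measure ℝ := volume.withDensity fun x => ENNReal.ofReal (g x ^ 2)

/-! ### Data and conservative solutions -/

/-- The set `𝒟`: `u` is bounded and continuous, `u_x ∈ L²(ℝ)`, `μ` is a finite positive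
(automatically Radon) measure, and `dμ_ac = u_x² dx`. -/
def InD (u : ℝ →ᵇ ℝ) (μ : FiniteMeasure ℝ) : Prop :=
  ∃ g : ℝ → ℝ, IsWeakDeriv u g ∧ MemLp g 2 volume ∧ acPart μ = sqMeasure g

/-- Conservative solutions `(u, μ)`, with a choice `ux t` of a representative of `u_x(·, t)` for
every `t`. The double integrals are iterated ones, so they do not depend on that choice. -/
structure IsConservativeSolutionWith (u₀ : ℝ →ᵇ ℝ) (μ₀ : FiniteMeasure ℝ)
    (u : ℝ → ℝ →ᵇ ℝ) (μ : ℝ → FiniteMeasure ℝ) (ux : ℝ → ℝ → ℝ) : Prop where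
  /-- `u ∈ C(ℝ; C_b(ℝ))`, for the supremum norm on `C_b(ℝ)`. -/
  continuous_u : Continuous u
  holder : LocHolderHalf u
  time_deriv : ∃ w, IsL2locTimeDeriv u w
  space_deriv : ∀ t, IsWeakDeriv (u t) (ux t)
  space_deriv_L2 : ∀ t, MemLp (ux t) 2 volume
  /-- `μ ∈ C(ℝ; 𝓜₊(ℝ))`, for the weak topology (tested with `C_b(ℝ)`). -/
  continuous_μ : Continuous μ
  initial_u : u 0 = u₀
  initial_μ : μ 0 = μ₀
  ac_ae : ∀ᵐ t : ℝ, (μ t : Measure ℝ) = sqMeasure (ux t)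
  /-- `u_t + u u_x = F / 2` weakly, with `F(x, t) = μ(t)((-∞, x])`. -/
  momentum : ∀ φ : ℝ × ℝ → ℝ, IsTestFun φ →
    ∫ t, ∫ x, (u t x * dT φ x t
      - φ (x, t) * (u t x * ux t x - (1 / 2) * (μ t : Measure ℝ).real (Iic x))) = 0
  /-- `μ_t + (u μ)_x = 0` weakly. -/
  energy : ∀ φ : ℝ × ℝ → ℝ, IsTestFun φ →
    ∫ t, ∫ x, (dT φ x t + u t x * dX φ x t) ∂(μ t : Measure ℝ) = 0
  ac_part : ∀ t, acPart (μ t) = sqMeasure (ux t)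

/-- `(u, μ)` is a global-in-time conservative solution with initial datum `(u₀, μ₀)`. -/
def IsConservativeSolution (u₀ : ℝ →ᵇ ℝ) (μ₀ : FiniteMeasure ℝ)
    (u : ℝ → ℝ →ᵇ ℝ) (μ : ℝ → FiniteMeasure ℝ) : Prop :=
  ∃ ux, IsConservativeSolutionWith u₀ μ₀ u μ ux

/-! ### The set of singularity formation, in Eulerian coordinates -/

/-- `A_t^E = {x : u₀' (x) = -2 / t}`, for a representative `g` of `u₀'`. -/
def singSet (g : ℝ → ℝ) (t : ℝ) : Set ℝ := {x | g x = -2 / t}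

/-- The map `x ↦ x + u₀(x) t + (t² / 4) μ₀((-∞, x))`. -/
def flowMap (u₀ : ℝ →ᵇ ℝ) (μ₀ : FiniteMeasure ℝ) (t x : ℝ) : ℝ :=
  x + u₀ x * t + t ^ 2 / 4 * (μ₀ : Measure ℝ).real (Iio x)

/-- The union of all open intervals of positive length that lie in `A` up to a Lebesgue null set
and carry no singular part of `μ₀`. -/
def intervalPart (μ₀ : FiniteMeasure ℝ) (A : Set ℝ) : Set ℝ :=
  {x | ∃ a b : ℝ, x ∈ Ioo a b ∧ volume (Ioo a b \ A) = 0 ∧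
    (μ₀ : Measure ℝ).singularPart volume (Ioo a b) = 0}

/-! ### Characteristics -/

/-- `x̄(α)`, the generalized inverse of `x ↦ x + μ₀((-∞, x])`. -/
def xbar (μ₀ : FiniteMeasure ℝ) (α : ℝ) : ℝ :=
  sSup {x | x + (μ₀ : Measure ℝ).real (Iio x) ≤ α}

/-- The measure `f dα`, with `f = 1 - x̄'`. -/
def lagEnergy (μ₀ : FiniteMeasure ℝ) : Measure ℝ :=
  volume.withDensity fun α => ENNReal.ofReal (1 - deriv (xbar μ₀) α)

/-- The characteristics `y(α, t)`. -/
def charY (u₀ : ℝ →ᵇ ℝ) (μ₀ : FiniteMeasure ℝ) (t α : ℝ) : ℝ :=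
  xbar μ₀ α + u₀ (xbar μ₀ α) * t + t ^ 2 / 4 * (α - xbar μ₀ α)

/-- `A_t^{L,pp}`: `y_α(α, t) = 0` and the level set of `y(·, t)` through `α` is not a point. -/
def lagPP (u₀ : ℝ →ᵇ ℝ) (μ₀ : FiniteMeasure ℝ) (t : ℝ) : Set ℝ :=
  {α | HasDerivAt (charY u₀ μ₀ t) 0 α ∧ ∃ β, β ≠ α ∧ charY u₀ μ₀ t β = charY u₀ μ₀ t α}

/-- `A_t^{L,sc}`: `y_α(α, t) = 0` and the level set of `y(·, t)` through `α` is a point. -/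
def lagSC (u₀ : ℝ →ᵇ ℝ) (μ₀ : FiniteMeasure ℝ) (t : ℝ) : Set ℝ :=
  {α | HasDerivAt (charY u₀ μ₀ t) 0 α ∧ ∀ β, charY u₀ μ₀ t β = charY u₀ μ₀ t α → β = α}

/-- `B_t^L`: `y_α(α, t) > 0`. -/
def lagAC (u₀ : ℝ →ᵇ ℝ) (μ₀ : FiniteMeasure ℝ) (t : ℝ) : Set ℝ :=
  {α | ∃ d > 0, HasDerivAt (charY u₀ μ₀ t) d α}

end

end HunterSaxton

open HunterSaxton

/-! Existence rests on Lagrangian coordinates in which the equation is free fall. The label α = x +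
μ₀((-∞, x)) opens each atom of μ₀ into an interval, so position y, velocity V and cumulative energy
Z are Lipschitz functions of α. The motion is y_t = V, V_t = Z/2, Z_t = 0. A `LagChart` records that
y and Z are monotone, that (ΔV)² ≤ Δy ΔZ for all increments, and that V_α² = y_α Z_α almost
everywhere. The flow preserves these properties because Δy ΔZ - (ΔV)² does not depend on time
(`LagChart.evolve`). Hence what must be known about a fixed time follows from statements about a
single chart. In a chart, V is constant on level sets of y, so it defines a velocity u of the
position, and the energy is the image under y of Z_α dα. Where y_α > 0 the chain rule gives Z_α =
u_x² y_α, which produces the absolutely continuous part u_x² dx. The set y_α = 0 has a null image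
and carries the singular part; its atoms come from the level sets with more than one point. From the
datum, y_α = x̄' (1 + (t/2) u₀'(x̄))² where x̄' > 0, and y_α = t²/4 where x̄' = 0. So for t ≠ 0
concentration happens exactly on u₀' = -2/t. These sets are disjoint for different t, and only
countably many can be non-null. The two weak equations hold because in labels their integrands are
total time derivatives along characteristics. Uniqueness follows the quantiles of the energy of an
arbitrary conservative solution. Testing the energy equation with steps that move at constant speed
shows that each quantile is an integral curve of the velocity
(`IsConservativeSolutionWith.hasDerivAt_quantile`). Averaging the momentum equation over short
intervals that move with an integral curve shows that the acceleration along it is F/2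
(`IsConservativeSolutionWith.velocity_curve`). For almost every time the energy has no atoms, so F =
β on the β-quantile, which therefore falls freely with acceleration β/2. All quantiles are then
explicit and determine the energy. The velocity is known at the quantiles and, by the Cauchy-Schwarz
bound `EnergyBound`, everywhere (`eq_of_eq_quantile`). -/

namespace HunterSaxton

/-! ### Weak derivatives on the line -/

theorem exists_support_subset_Ioc {φ : ℝ → ℝ} (h : HasCompactSupport φ) :
    ∃ R > 0, ∀ x, φ x ≠ 0 → x ∈ Ioo (-R) R := by
  obtain ⟨R, hR, h2⟩ := h.isCompact.isBounded.subset_closedBall_lt 0 0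
  refine ⟨R + 1, by linarith, fun x hx => ?_⟩
  have := h2 (subset_tsupport _ hx)
  rw [Metric.mem_closedBall, Real.dist_eq, sub_zero, abs_le] at this
  exact ⟨by linarith, by linarith⟩

theorem integral_eq_intervalIntegral_of_forall_ne {f : ℝ → ℝ} {R : ℝ}
    (h : ∀ x, f x ≠ 0 → x ∈ Ioo (-R) R) : ∫ x, f x = ∫ x in (-R)..R, f x :=
  (intervalIntegral.integral_eq_integral_of_support_subset
    fun x hx => Ioo_subset_Ioc_self (h x hx)).symm

theorem isWeakDeriv_deriv_of_absolutelyContinuous {v : ℝ → ℝ}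
    (hv : ∀ a b, AbsolutelyContinuousOnInterval v a b) : IsWeakDeriv v (deriv v) := by
  have hc : Continuous v := by
    rw [continuous_iff_continuousAt]
    intro x
    have := (hv (x - 1) (x + 1)).continuousOn
    rw [uIcc_of_le (by linarith)] at this
    exact this.continuousAt (Icc_mem_nhds (by linarith) (by linarith))
  refine ⟨hc.locallyIntegrable, ?_, ?_⟩
  · rw [locallyIntegrable_iff]
    intro K hK
    obtain ⟨R, hR, h2⟩ := hK.isBounded.subset_closedBall_lt 0 0
    have h3 := (hv (-R) R).intervalIntegrable_deriv
    rw [intervalIntegrable_iff_integrableOn_Icc_of_le (by linarith)] at h3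
    refine h3.mono_set (h2.trans ?_)
    rw [Real.closedBall_eq_Icc]; simp
  · intro φ hφ hs
    obtain ⟨R, hR, h⟩ := exists_support_subset_Ioc hs
    have h' : ∀ x, deriv φ x ≠ 0 → x ∈ Ioo (-R) R := by
      intro x hx
      have hd : HasCompactSupport (deriv φ) := hs.deriv
      by_contra hcon
      have : x ∈ tsupport φ := support_deriv_subset hx
      have h4 : tsupport φ ⊆ Icc (-R) R :=
        closure_minimal (fun y hy => Ioo_subset_Icc_self (h y hy)) isClosed_Icc
      have h5 := h4 this
      -- The closed support may reach ±R. There φ vanishes on one side, so a one-sided derivative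
      -- already forces `deriv φ x = 0`.
      have : x = -R ∨ x = R := by
        by_contra! h6
        exact hcon ⟨lt_of_le_of_ne h5.1 (Ne.symm h6.1), lt_of_le_of_ne h5.2 h6.2⟩
      have hφ0 : φ x = 0 := by
        by_contra h7; exact hcon (h x h7)
      have h1 : HasDerivAt φ (deriv φ x) x :=
        (hφ.differentiable (by simp) x).hasDerivAt
      apply hx
      rcases this with h6 | h6
      · have : HasDerivWithinAt φ 0 (Iic x) x := by
          refine (hasDerivWithinAt_const x (Iic x) (0:ℝ)).congr (fun y hy => ?_) hφ0
          by_contra h7; have := (h y h7).1; simp only [mem_Iic] at hy; linarith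
        exact (uniqueDiffWithinAt_Iic x).eq_deriv _ h1.hasDerivWithinAt this
      · have : HasDerivWithinAt φ 0 (Ici x) x := by
          refine (hasDerivWithinAt_const x (Ici x) (0:ℝ)).congr (fun y hy => ?_) hφ0
          by_contra h7; have := (h y h7).2; simp only [mem_Ici] at hy; linarith
        exact (uniqueDiffWithinAt_Ici x).eq_deriv _ h1.hasDerivWithinAt this
    rw [integral_eq_intervalIntegral_of_forall_ne (R := R) (fun x hx => h' x (right_ne_zero_of_mul hx)),
      integral_eq_intervalIntegral_of_forall_ne (R := R) (fun x hx => h x (right_ne_zero_of_mul hx)),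
      (hv (-R) R).integral_mul_deriv_eq_deriv_mul
        (hφ.of_le (by simp) : ContDiff ℝ 1 φ).contDiffOn.absolutelyContinuousOnInterval]
    have e1 : φ R = 0 := by by_contra h7; exact lt_irrefl _ (h R h7).2
    have e2 : φ (-R) = 0 := by by_contra h7; exact lt_irrefl _ (h _ h7).1
    rw [e1, e2]; ring

/-- The du Bois-Reymond lemma. Subtracting (∫ φ) φ₀ from a test function φ leaves mean zero, hence
the derivative of a test function; so w - ∫ w φ₀ annihilates every φ. -/
theorem ae_eq_const_of_integral_mul_deriv_eq_zero {w : ℝ → ℝ} (hw : LocallyIntegrable w volume)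
    (h : ∀ φ : ℝ → ℝ, ContDiff ℝ ∞ φ → HasCompactSupport φ → ∫ x, w x * deriv φ x = 0) :
    ∃ c, ∀ᵐ x, w x = c := by
  let b : ContDiffBump (0 : ℝ) := ⟨1, 2, by norm_num, by norm_num⟩
  set φ₀ := b.normed volume with hφ₀
  have c₀ : ContDiff ℝ ∞ φ₀ := b.contDiff_normed
  have s₀ : HasCompactSupport φ₀ := b.hasCompactSupport_normed
  refine ⟨∫ x, w x * φ₀ x, ?_⟩
  set c := ∫ x, w x * φ₀ x
  have key : ∀ φ : ℝ → ℝ, ContDiff ℝ ∞ φ → HasCompactSupport φ →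
      ∫ x, φ x • (w x - c) = 0 := by
    intro φ hφ hs
    set I := ∫ x, φ x
    let k : ℝ → ℝ := fun x => φ x - I * φ₀ x
    have hk : ContDiff ℝ ∞ k := hφ.sub (contDiff_const.mul c₀)
    have hks : HasCompactSupport k := hs.sub (s₀.mul_left)
    have hki : ∫ x, k x = 0 := by
      simp only [k]
      rw [integral_sub (hφ.continuous.integrable_of_hasCompactSupport hs)
        ((c₀.continuous.integrable_of_hasCompactSupport s₀).const_mul _), integral_const_mul,
        hφ₀, b.integral_normed]
      simp [I]
    obtain ⟨R, hR, hkR⟩ := exists_support_subset_Ioc hks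
    let χ : ℝ → ℝ := fun x => ∫ y in (-R)..x, k y
    have hχd : ∀ x, HasDerivAt χ (k x) x := fun x =>
      (hk.continuous.integral_hasStrictDerivAt (-R) x).hasDerivAt
    have hχ' : deriv χ = k := funext fun x => (hχd x).deriv
    have hχ : ContDiff ℝ ∞ χ := by
      rw [contDiff_infty_iff_deriv, hχ']
      exact ⟨fun x => (hχd x).differentiableAt, hk⟩
    have hχs : HasCompactSupport χ := by
      refine HasCompactSupport.of_support_subset_isCompact (isCompact_Icc (a := -R) (b := R)) ?_
      intro x hx
      by_contra hcon
      apply hx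
      simp only [mem_Icc, not_and_or, not_le] at hcon
      rcases hcon with h1 | h1
      · refine intervalIntegral.integral_zero_ae (ae_of_all _ fun y hy => ?_)
        rw [uIoc_of_ge h1.le] at hy
        by_contra h7; exact absurd (hkR y h7).1 (not_lt.2 hy.2)
      · have : χ x = ∫ y, k y :=
          intervalIntegral.integral_eq_integral_of_support_subset fun y hy =>
            ⟨(hkR y hy).1, ((hkR y hy).2.trans h1).le⟩
        rw [this, hki]
    have h1 := h χ hχ hχs
    rw [hχ'] at h1
    have i1 : Integrable (fun x => w x * φ x) := by
      simpa using! hw.integrable_smul_right_of_hasCompactSupport hφ.continuous hs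
    have i2 : Integrable (fun x => w x * φ₀ x) := by
      simpa using! hw.integrable_smul_right_of_hasCompactSupport c₀.continuous s₀
    have e1 : (fun x => w x * k x) = fun x => w x * φ x - I * (w x * φ₀ x) := by
      funext x; simp only [k]; ring
    rw [e1, integral_sub i1 (i2.const_mul _), integral_const_mul] at h1
    have e2 : (fun x => φ x • (w x - c)) = fun x => w x * φ x - c * φ x := by
      funext x; simp only [smul_eq_mul]; ring
    rw [e2, integral_sub i1 ((hφ.continuous.integrable_of_hasCompactSupport hs).const_mul _),
      integral_const_mul]
    linarith
  have := ae_eq_zero_of_integral_contDiff_smul_eq_zero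
    (hw.sub (continuous_const (y := c)).locallyIntegrable) key
  filter_upwards [this] with x hx
  simp only [Pi.sub_apply] at hx
  linarith

theorem _root_.MeasureTheory.LocallyIntegrable.intervalIntegrable' {g : ℝ → ℝ}
    (hg : LocallyIntegrable g volume) (a b : ℝ) : IntervalIntegrable g volume a b := by
  rw [intervalIntegrable_iff]
  exact (hg.integrableOn_isCompact isCompact_uIcc).mono_set uIoc_subset_uIcc

theorem absolutelyContinuous_primitive {g : ℝ → ℝ} (hg : LocallyIntegrable g volume) (a b : ℝ) :
    AbsolutelyContinuousOnInterval (fun x => ∫ y in (0:ℝ)..x, g y) a b := by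
  set m := min 0 (min a b)
  set M := max 0 (max a b)
  have h : AbsolutelyContinuousOnInterval (fun x => ∫ y in (0:ℝ)..x, g y) m M :=
    (hg.intervalIntegrable' m M).absolutelyContinuousOnInterval_intervalIntegral (by
      rw [mem_uIcc]; left; exact ⟨min_le_left _ _, le_max_left _ _⟩)
  refine h.mono (uIcc_subset_uIcc ?_ ?_) <;> rw [mem_uIcc] <;> left
  · exact ⟨(min_le_right _ _).trans (min_le_left _ _), (le_max_left _ _).trans (le_max_right _ _)⟩
  · exact ⟨(min_le_right _ _).trans (min_le_right _ _), (le_max_right _ _).trans (le_max_right _ _)⟩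

theorem ae_of_forall_ae_Icc {p : ℝ → Prop}
    (h : ∀ R : ℕ, ∀ᵐ x, x ∈ uIcc (-(R:ℝ)) R → p x) : ∀ᵐ x, p x := by
  rw [← ae_all_iff] at h
  filter_upwards [h] with x hx
  obtain ⟨n, hn⟩ := exists_nat_ge |x|
  refine hx n ?_
  rw [uIcc_of_le (by linarith [abs_nonneg x])]
  exact abs_le.1 hn

theorem ae_hasDerivAt_primitive {g : ℝ → ℝ} (hg : LocallyIntegrable g volume) :
    ∀ᵐ x, HasDerivAt (fun x => ∫ y in (0:ℝ)..x, g y) (g x) x := by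
  refine ae_of_forall_ae_Icc fun R => ?_
  filter_upwards [(hg.intervalIntegrable' (-(R:ℝ)) R).ae_hasDerivAt_integral] with x hx hx'
  refine hx hx' 0 ?_
  rw [uIcc_of_le (by linarith [(Nat.cast_nonneg R : (0:ℝ) ≤ R)])]
  exact ⟨by linarith [(Nat.cast_nonneg R : (0:ℝ) ≤ R)], Nat.cast_nonneg R⟩

theorem ae_differentiableAt_of_absolutelyContinuous {v : ℝ → ℝ}
    (hv : ∀ a b, AbsolutelyContinuousOnInterval v a b) : ∀ᵐ x, DifferentiableAt ℝ v x :=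
  ae_of_forall_ae_Icc fun _ => (hv _ _).ae_differentiableAt

theorem IsWeakDeriv.ae_eq {v g h : ℝ → ℝ} (hg : IsWeakDeriv v g) (hh : IsWeakDeriv v h) :
    g =ᵐ[volume] h := by
  have := ae_eq_zero_of_integral_contDiff_smul_eq_zero (hg.locInt_deriv.sub hh.locInt_deriv)
    (fun φ hφ hs => by
      have i1 : Integrable (fun x => g x * φ x) := by
        simpa using! hg.locInt_deriv.integrable_smul_right_of_hasCompactSupport hφ.continuous hs
      have i2 : Integrable (fun x => h x * φ x) := by
        simpa using! hh.locInt_deriv.integrable_smul_right_of_hasCompactSupport hφ.continuous hs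
      have e : (fun x => φ x • (g - h) x) = fun x => g x * φ x - h x * φ x := by
        funext x; simp only [Pi.sub_apply, smul_eq_mul]; ring
      rw [e, integral_sub i1 i2]
      linarith [hg.byParts φ hφ hs, hh.byParts φ hφ hs])
  filter_upwards [this] with x hx
  simp only [Pi.sub_apply] at hx
  linarith

theorem IsWeakDeriv.congr_deriv {v g h : ℝ → ℝ} (hg : IsWeakDeriv v g) (e : g =ᵐ[volume] h) :
    IsWeakDeriv v h :=
  ⟨hg.locInt_fun, hg.locInt_deriv.congr e, fun φ hφ hs => by
    rw [hg.byParts φ hφ hs]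
    congr 1
    refine integral_congr_ae ?_
    filter_upwards [e] with x hx
    rw [hx]⟩

/-- The primitive of g also has weak derivative g, so it differs from v by a constant almost
everywhere, and by continuity everywhere. -/
theorem IsWeakDeriv.sub_eq_integral {v g : ℝ → ℝ} (hg : IsWeakDeriv v g) (hv : Continuous v)
    (a b : ℝ) : v b - v a = ∫ x in a..b, g x := by
  set G : ℝ → ℝ := fun x => ∫ y in (0:ℝ)..x, g y with hG
  have hGw : IsWeakDeriv G (deriv G) :=
    isWeakDeriv_deriv_of_absolutelyContinuous (absolutelyContinuous_primitive hg.locInt_deriv)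
  have hGw' : IsWeakDeriv G g := hGw.congr_deriv <| by
    filter_upwards [ae_hasDerivAt_primitive hg.locInt_deriv] with x hx using hx.deriv
  have hGc : Continuous G := by
    exact intervalIntegral.continuous_primitive (fun a b => hg.locInt_deriv.intervalIntegrable' a b) 0
  obtain ⟨c, hc⟩ := ae_eq_const_of_integral_mul_deriv_eq_zero
    (hg.locInt_fun.sub hGw.locInt_fun) (fun φ hφ hs => by
      have hd : Continuous (deriv φ) := hφ.continuous_deriv (by simp)
      have i1 : Integrable (fun x => v x * deriv φ x) := by
        simpa using! hg.locInt_fun.integrable_smul_right_of_hasCompactSupport hd hs.deriv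
      have i2 : Integrable (fun x => G x * deriv φ x) := by
        simpa using! hGw.locInt_fun.integrable_smul_right_of_hasCompactSupport hd hs.deriv
      have e : (fun x => (v - G) x * deriv φ x)
          = fun x => v x * deriv φ x - G x * deriv φ x := by
        funext x; simp only [Pi.sub_apply]; ring
      rw [e, integral_sub i1 i2, hg.byParts φ hφ hs, hGw'.byParts φ hφ hs, sub_self])
  have := (hv.sub hGc).ae_eq_iff_eq volume (continuous_const (y := c)) |>.1 hc
  have ha := congrFun this a
  have hb := congrFun this b
  simp only [Pi.sub_apply] at ha hb
  have : (∫ x in a..b, g x) = G b - G a :=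
    (intervalIntegral.integral_interval_sub_left (hg.locInt_deriv.intervalIntegrable' _ _)
      (hg.locInt_deriv.intervalIntegrable' _ _)).symm
  rw [this]; simp only [hG] at *; linarith

end HunterSaxton

namespace HunterSaxton

/-! ### Functions whose increments are controlled by an energy measure -/

/-- The increments of `v` satisfy the Cauchy-Schwarz bound with respect to the energy `m`. -/
def EnergyBound (v : ℝ → ℝ) (m : Measure ℝ) : Prop :=
  ∀ a b, a ≤ b → (v b - v a) ^ 2 ≤ (b - a) * m.real (Ioo a b)

/-- This is nonnegativity of the variance of g: expand ∫ (g - c)² with c the mean of g on the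
interval. -/
theorem sq_intervalIntegral_le {g : ℝ → ℝ} {a b : ℝ} (hab : a ≤ b)
    (h1 : IntegrableOn g (Ioo a b)) (h2 : IntegrableOn (fun x => g x ^ 2) (Ioo a b)) :
    (∫ x in Ioo a b, g x) ^ 2 ≤ (b - a) * ∫ x in Ioo a b, g x ^ 2 := by
  rcases hab.eq_or_lt with rfl | hlt
  · simp
  set I := ∫ x in Ioo a b, g x
  set c := I / (b - a) with hc
  have hpos : 0 < b - a := sub_pos.2 hlt
  have h3 : 0 ≤ ∫ x in Ioo a b, (g x - c) ^ 2 := integral_nonneg fun x => sq_nonneg _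
  have e : (fun x => (g x - c) ^ 2) = fun x => g x ^ 2 - 2 * c * g x + c ^ 2 := by
    funext x; ring
  rw [e, integral_add (by exact h2.sub (h1.const_mul _)) (by simp),
    integral_sub (by exact h2) (by exact h1.const_mul _), integral_const_mul] at h3
  simp only [integral_const, MeasurableSet.univ, measureReal_restrict_apply, univ_inter,
    Real.volume_real_Ioo_of_le hab, smul_eq_mul] at h3
  have hcI : c * (b - a) = I := by rw [hc]; field_simp
  have : 0 ≤ (∫ x in Ioo a b, g x ^ 2) - c * I := by
    have : (b - a) * c ^ 2 = c * I := by rw [← hcI]; ring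
    rw [this] at h3
    change 0 ≤ _ - 2 * c * I + c * I at h3
    linarith
  have h4 : 0 ≤ (b - a) * ((∫ x in Ioo a b, g x ^ 2) - c * I) := mul_nonneg hpos.le this
  have : (b - a) * (c * I) = I ^ 2 := by rw [← mul_assoc, mul_comm (b - a), hcI]; ring
  linarith

theorem acPart_le (m : Measure ℝ) : acPart m ≤ m := Measure.withDensity_rnDeriv_le _ _

theorem memLp_two_of_acPart_eq {m : Measure ℝ} [IsFiniteMeasure m] {g : ℝ → ℝ}
    (hg : AEStronglyMeasurable g volume) (h : acPart m = sqMeasure g) : MemLp g 2 volume := by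
  rw [memLp_two_iff_integrable_sq hg]
  refine ⟨hg.pow 2, ?_⟩
  rw [hasFiniteIntegral_iff_ofReal (ae_of_all _ fun x => sq_nonneg _)]
  have : sqMeasure g univ ≤ m univ := h ▸ acPart_le m univ
  rw [sqMeasure, withDensity_apply _ MeasurableSet.univ, Measure.restrict_univ] at this
  exact this.trans_lt (measure_lt_top m univ)

theorem setIntegral_sq_eq {g : ℝ → ℝ} (hg : MemLp g 2 volume) {s : Set ℝ} (hs : MeasurableSet s) :
    ∫ x in s, g x ^ 2 = (sqMeasure g).real s := by
  rw [measureReal_def, sqMeasure, withDensity_apply _ hs,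
    integral_eq_lintegral_of_nonneg_ae (ae_of_all _ fun x => sq_nonneg _)
      (hg.aestronglyMeasurable.pow 2).restrict]

/-- Cauchy-Schwarz for the density g²; a singular part of m only enlarges the right-hand side.
Keeping the interval open leaves out atoms at its ends, which the comparison in labels requires. -/
theorem energyBound_of_acPart_eq {m : Measure ℝ} [IsFiniteMeasure m] {v g : ℝ → ℝ}
    (hg : IsWeakDeriv v g) (hv : Continuous v) (h : acPart m = sqMeasure g) : EnergyBound v m := by
  intro a b hab
  have hL := memLp_two_of_acPart_eq hg.locInt_deriv.aestronglyMeasurable h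
  have i2 := hL.integrable_sq
  rw [hg.sub_eq_integral hv, intervalIntegral.integral_of_le hab, integral_Ioc_eq_integral_Ioo]
  refine (sq_intervalIntegral_le hab ?_ i2.integrableOn).trans ?_
  · exact (hg.locInt_deriv.integrableOn_isCompact isCompact_Icc).mono_set Ioo_subset_Icc_self
  · refine mul_le_mul_of_nonneg_left ?_ (sub_nonneg.2 hab)
    rw [setIntegral_sq_eq hL measurableSet_Ioo, ← h]
    exact ENNReal.toReal_mono (measure_ne_top _ _) (acPart_le m _)

namespace EnergyBound

variable {v : ℝ → ℝ} {m : Measure ℝ} [IsFiniteMeasure m]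

theorem sq_le (h : EnergyBound v m) (a b : ℝ) : (v b - v a) ^ 2 ≤ |b - a| * m.real univ := by
  rcases le_total a b with hab | hab
  · rw [abs_of_nonneg (sub_nonneg.2 hab)]
    exact (h a b hab).trans (mul_le_mul_of_nonneg_left (measureReal_mono (subset_univ _))
      (sub_nonneg.2 hab))
  · rw [abs_of_nonpos (sub_nonpos.2 hab), neg_sub, ← neg_sub (v a), neg_sq]
    exact (h b a hab).trans (mul_le_mul_of_nonneg_left (measureReal_mono (subset_univ _))
      (sub_nonneg.2 hab))

theorem globallyAC (h : EnergyBound v m) : GloballyAC v := by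
  intro ε hε
  set M := m.real univ
  have hM : 0 ≤ M := measureReal_nonneg
  -- Cauchy-Schwarz over the disjoint intervals gives (∑ |Δv|)² ≤ M ∑ (b - a); the summand 1 allows
  -- M = 0.
  refine ⟨ε ^ 2 / (M + 1), by positivity, fun n a b hab hd hs => ?_⟩
  have h1 : (∑ i, |v (b i) - v (a i)|) ^ 2 ≤
      (∑ i, (b i - a i)) * ∑ i, m.real (Ioo (a i) (b i)) :=
    Finset.sum_sq_le_sum_mul_sum_of_sq_le_mul _ (fun i _ => sub_nonneg.2 (hab i))
      (fun i _ => measureReal_nonneg) (fun i _ => by rw [sq_abs]; exact h _ _ (hab i))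
  have h2 : ∑ i, m.real (Ioo (a i) (b i)) ≤ M := by
    rw [← measureReal_iUnion_fintype hd fun i => measurableSet_Ioo]
    exact measureReal_mono (subset_univ _)
  have h0 : 0 ≤ ∑ i, (b i - a i) := Finset.sum_nonneg fun i _ => sub_nonneg.2 (hab i)
  have h3 : (∑ i, (b i - a i)) * ∑ i, m.real (Ioo (a i) (b i)) < ε ^ 2 := by
    calc _ ≤ (∑ i, (b i - a i)) * (M + 1) := mul_le_mul_of_nonneg_left (by linarith) h0
      _ < ε ^ 2 / (M + 1) * (M + 1) := by gcongr
      _ = ε ^ 2 := by field_simp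
  exact lt_of_pow_lt_pow_left₀ 2 hε.le (h1.trans_lt h3)

theorem holder (h : EnergyBound v m) (a b : ℝ) :
    |v b - v a| ≤ Real.sqrt (m.real univ) * Real.sqrt |b - a| := by
  rw [← Real.sqrt_mul measureReal_nonneg, mul_comm]
  exact Real.abs_le_sqrt (h.sq_le a b)

end EnergyBound

theorem GloballyAC.absolutelyContinuousOnInterval {v : ℝ → ℝ} (h : GloballyAC v) (a b : ℝ) :
    AbsolutelyContinuousOnInterval v a b := by
  rw [absolutelyContinuousOnInterval_iff]
  intro ε hε
  obtain ⟨δ, hδ, H⟩ := h ε hε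
  refine ⟨δ, hδ, fun E hE hs => ?_⟩
  have := H E.1 (fun i => min (E.2 i).1 (E.2 i).2) (fun i => max (E.2 i).1 (E.2 i).2)
    (fun i => min_le_max) (fun i j hij => ?_) ?_
  · rw [← Fin.sum_univ_eq_sum_range (fun i => dist (v (E.2 i).1) (v (E.2 i).2))]
    refine lt_of_eq_of_lt (Finset.sum_congr rfl fun i _ => ?_) this
    rw [Real.dist_eq]
    rcases le_total (E.2 i).1 (E.2 i).2 with h1 | h1
    · rw [min_eq_left h1, max_eq_right h1, abs_sub_comm]
    · rw [min_eq_right h1, max_eq_left h1]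
  · have h2 := hE.2 (Finset.mem_coe.2 (Finset.mem_range.2 i.2))
      (Finset.mem_coe.2 (Finset.mem_range.2 j.2)) (fun h => hij (Fin.ext h))
    exact h2.mono Ioo_subset_Ioc_self Ioo_subset_Ioc_self
  · rw [← Fin.sum_univ_eq_sum_range (fun i => dist (E.2 i).1 (E.2 i).2)] at hs
    refine lt_of_eq_of_lt (Finset.sum_congr rfl fun i _ => ?_) hs
    rw [Real.dist_eq, max_sub_min_eq_abs, abs_sub_comm]

theorem GloballyAC.isWeakDeriv {v : ℝ → ℝ} (h : GloballyAC v) : IsWeakDeriv v (deriv v) :=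
  isWeakDeriv_deriv_of_absolutelyContinuous h.absolutelyContinuousOnInterval

/-- A Lipschitz function is a primitive of its derivative. -/
theorem _root_.LipschitzWith.intervalIntegral_deriv {K : ℝ≥0} {f : ℝ → ℝ} (h : LipschitzWith K f)
    (a b : ℝ) : ∫ x in a..b, deriv f x = f b - f a :=
  (h.lipschitzOnWith).absolutelyContinuousOnInterval.integral_deriv_eq_sub

theorem _root_.LipschitzWith.eq_of_ae_hasDerivAt_zero {K : ℝ≥0} {f : ℝ → ℝ} (h : LipschitzWith K f)
    {a b : ℝ} (h0 : ∀ᵐ x, x ∈ Ioo a b → HasDerivAt f 0 x) {c d : ℝ} (hc : c ∈ Icc a b)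
    (hd : d ∈ Icc a b) : f c = f d := by
  have hab : a ≤ b := hc.1.trans hc.2
  obtain ⟨C, hC⟩ := (h.lipschitzOnWith (s := uIcc a b)).absolutelyContinuousOnInterval
    |>.const_of_ae_hasDerivAt_zero (by
      have h1 : ∀ᵐ x : ℝ, x ≠ a := by simp [ae_iff]
      have h2 : ∀ᵐ x : ℝ, x ≠ b := by simp [ae_iff]
      filter_upwards [h0, h1, h2] with x hx h1 h2 hm
      rw [uIcc_of_le hab] at hm
      exact hx ⟨lt_of_le_of_ne hm.1 (Ne.symm h1), lt_of_le_of_ne hm.2 h2⟩)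
  rw [uIcc_of_le hab] at hC
  rw [hC c hc, hC d hd]

end HunterSaxton

namespace HunterSaxton

/-! ### Monotone Lipschitz changes of variables -/

/-- The points where `y` has a positive derivative. -/
def posSet (y : ℝ → ℝ) : Set ℝ := {α | ∃ d > 0, HasDerivAt y d α}

/-- The points where `y` has derivative zero. -/
def zeroSet (y : ℝ → ℝ) : Set ℝ := {α | HasDerivAt y 0 α}

/-- The values that `y` takes more than once. -/
def multSet (y : ℝ → ℝ) : Set ℝ := {x | ∃ α β, α < β ∧ y α = x ∧ y β = x}

/-- The measure with density `Z'`. -/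
noncomputable def derivMeasure (Z : ℝ → ℝ) : Measure ℝ :=
  volume.withDensity fun α => ENNReal.ofReal (deriv Z α)

theorem posSet_eq (y : ℝ → ℝ) : posSet y = {α | DifferentiableAt ℝ y α} ∩ {α | 0 < deriv y α} := by
  ext α
  constructor
  · rintro ⟨d, hd, h⟩
    exact ⟨h.differentiableAt, by rw [mem_ofPred_eq, h.deriv]; exact hd⟩
  · rintro ⟨h1, h2⟩
    exact ⟨_, h2, h1.hasDerivAt⟩

theorem zeroSet_eq (y : ℝ → ℝ) :
    zeroSet y = {α | DifferentiableAt ℝ y α} ∩ {α | deriv y α = 0} := by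
  ext α
  constructor
  · intro h
    exact ⟨h.differentiableAt, h.deriv⟩
  · rintro ⟨h1, h2⟩
    have := DifferentiableAt.hasDerivAt h1
    rw [h2] at this
    exact this

theorem measurableSet_posSet (y : ℝ → ℝ) : MeasurableSet (posSet y) := by
  rw [posSet_eq]
  exact (measurableSet_of_differentiableAt ℝ y).inter
    (measurableSet_lt measurable_const (measurable_deriv y))

theorem measurableSet_zeroSet (y : ℝ → ℝ) : MeasurableSet (zeroSet y) := by
  rw [zeroSet_eq]
  exact (measurableSet_of_differentiableAt ℝ y).inter
    (measurableSet_eq_fun (measurable_deriv y) measurable_const)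

theorem deriv_nonneg_of_monotone {y : ℝ → ℝ} (h : Monotone y) (α : ℝ) : 0 ≤ deriv y α :=
  h.deriv_nonneg

theorem disjoint_posSet_zeroSet (y : ℝ → ℝ) : Disjoint (posSet y) (zeroSet y) := by
  rw [Set.disjoint_left]
  rintro α ⟨d, hd, h⟩ h'
  exact hd.ne' (h.unique h')

theorem ae_mem_posSet_or_zeroSet {y : ℝ → ℝ} {K : ℝ≥0} (hy : LipschitzWith K y) (hm : Monotone y) :
    ∀ᵐ α, α ∈ posSet y ∨ α ∈ zeroSet y := by
  filter_upwards [hy.ae_differentiableAt] with α hα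
  rw [posSet_eq, zeroSet_eq]
  rcases (deriv_nonneg_of_monotone hm α).eq_or_lt with h | h
  · exact Or.inr ⟨hα, h.symm⟩
  · exact Or.inl ⟨hα, h⟩

theorem compl_posSet_ae_eq {y : ℝ → ℝ} {K : ℝ≥0} (hy : LipschitzWith K y) (hm : Monotone y) :
    ((posSet y)ᶜ : Set ℝ) =ᵐ[volume] zeroSet y := by
  filter_upwards [ae_mem_posSet_or_zeroSet hy hm] with α hα
  have := disjoint_posSet_zeroSet y
  rw [Set.disjoint_left] at this
  apply propext
  change α ∉ posSet y ↔ α ∈ zeroSet y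
  constructor
  · intro h; exact hα.resolve_left h
  · intro h h'; exact this h' h

theorem volume_image_eq_zero_of_lipschitz {y : ℝ → ℝ} {K : ℝ≥0} (hy : LipschitzWith K y) {s : Set ℝ}
    (hs : volume s = 0) : volume (y '' s) = 0 := by
  rw [← hausdorffMeasure_real] at hs ⊢
  have := hy.hausdorffMeasure_image_le (d := 1) zero_le_one s
  rw [hs, mul_zero] at this
  exact le_antisymm this bot_le

theorem volume_image_zeroSet {y : ℝ → ℝ} (hm : Monotone y) : volume (y '' zeroSet y) = 0 := by
  rw [← lintegral_deriv_eq_volume_image_of_monotoneOn (f' := fun _ => 0) (measurableSet_zeroSet y)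
    (fun x hx => HasDerivAt.hasDerivWithinAt hx) (hm.monotoneOn _)]
  simp

/-- A Sard property: the area formula handles the points of zero derivative, and Lipschitz maps send
the null set of non-differentiability to a null set. -/
theorem volume_image_compl_posSet {y : ℝ → ℝ} {K : ℝ≥0} (hy : LipschitzWith K y)
    (hm : Monotone y) : volume (y '' (posSet y)ᶜ) = 0 := by
  have h : y '' (posSet y)ᶜ ⊆ y '' (zeroSet y) ∪ y '' (posSet y ∪ zeroSet y)ᶜ := by
    rw [← image_union]
    refine image_mono fun α hα => ?_
    by_cases h : α ∈ zeroSet y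
    · exact Or.inl h
    · exact Or.inr (by simp only [mem_compl_iff, mem_union, not_or]; exact ⟨hα, h⟩)
  refine measure_mono_null h (measure_union_null (volume_image_zeroSet hm)
    (volume_image_eq_zero_of_lipschitz hy ?_))
  exact ae_mem_posSet_or_zeroSet hy hm

theorem ae_mem_image_posSet {y : ℝ → ℝ} {K : ℝ≥0} (hy : LipschitzWith K y)
    (hm : Monotone y) (hs : Function.Surjective y) : ∀ᵐ x, x ∈ y '' posSet y := by
  refine measure_mono_null ?_ (volume_image_compl_posSet hy hm)
  intro x hx
  obtain ⟨α, rfl⟩ := hs x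
  exact ⟨α, fun h => hx ⟨α, h, rfl⟩, rfl⟩

/-- Change of variables `x = y α`. -/
theorem lintegral_comp_mul_deriv {y : ℝ → ℝ} {K : ℝ≥0} (hy : LipschitzWith K y)
    (hm : Monotone y) (hs : Function.Surjective y) (u : ℝ → ℝ≥0∞) :
    ∫⁻ α, ENNReal.ofReal (deriv y α) * u (y α) = ∫⁻ x, u x := by
  have h1 := lintegral_image_eq_lintegral_deriv_mul_of_monotoneOn (measurableSet_posSet y)
    (f := y) (f' := deriv y) (fun x hx => by
      obtain ⟨d, hd, h⟩ := hx
      rw [h.deriv]; exact h.hasDerivWithinAt) (hm.monotoneOn _) u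
  have h2 : (y '' posSet y : Set ℝ) =ᵐ[volume] univ := by
    rw [eventuallyEq_univ]; exact ae_mem_image_posSet hy hm hs
  rw [setLIntegral_congr h2, setLIntegral_univ] at h1
  rw [h1, ← lintegral_add_compl _ (measurableSet_posSet y)]
  have : ∫⁻ α in (posSet y)ᶜ, ENNReal.ofReal (deriv y α) * u (y α) = 0 := by
    rw [setLIntegral_congr (compl_posSet_ae_eq hy hm),
      setLIntegral_congr_fun (measurableSet_zeroSet y) (g := fun _ => 0)]
    · simp
    · intro α hα
      have : deriv y α = 0 := HasDerivAt.deriv hα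
      simp [this]
  rw [this, add_zero]

theorem map_derivMeasure_self {y : ℝ → ℝ} {K : ℝ≥0} (hy : LipschitzWith K y)
    (hm : Monotone y) (hs : Function.Surjective y) : (derivMeasure y).map y = volume := by
  ext S hS
  rw [Measure.map_apply hy.continuous.measurable hS, derivMeasure,
    withDensity_apply _ (hy.continuous.measurable hS), ← lintegral_indicator
      (hy.continuous.measurable hS)]
  have h := lintegral_comp_mul_deriv hy hm hs (S.indicator 1)
  rw [lintegral_indicator_one hS] at h
  rw [← h]
  congr 1
  funext α
  by_cases h : y α ∈ S
  · rw [indicator_of_mem (show α ∈ y ⁻¹' S from h), indicator_of_mem h]; simp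
  · rw [indicator_of_notMem (show α ∉ y ⁻¹' S from h), indicator_of_notMem h]; simp

theorem integral_comp_mul_deriv' {y : ℝ → ℝ} {K : ℝ≥0} (hy : LipschitzWith K y)
    (hm : Monotone y) (hs : Function.Surjective y) {g : ℝ → ℝ} (hg : AEStronglyMeasurable g volume) :
    ∫ x, g x = ∫ α, deriv y α * g (y α) := by
  have h := map_derivMeasure_self hy hm hs
  conv_lhs => rw [← h]
  rw [integral_map hy.continuous.aemeasurable (by rw [h]; exact hg), derivMeasure,
    integral_withDensity_eq_integral_toReal_smul (by fun_prop) (by simp)]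
  congr 1; funext α
  rw [ENNReal.toReal_ofReal (deriv_nonneg_of_monotone hm α), smul_eq_mul]

/-- The preimage of a null set can be large, but only where y' vanishes, since y carries y' dα to
Lebesgue measure. -/
theorem null_preimage_inter_posSet {y : ℝ → ℝ} {K : ℝ≥0} (hy : LipschitzWith K y)
    (hm : Monotone y) (hs : Function.Surjective y) {p : ℝ → Prop} (h : ∀ᵐ x, p x) :
    ∀ᵐ α, α ∈ posSet y → p (y α) := by
  have h0 := map_derivMeasure_self hy hm hs
  rw [← h0] at h
  have h1 := ae_of_ae_map hy.continuous.aemeasurable h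
  rw [derivMeasure, ae_withDensity_iff (by fun_prop)] at h1
  filter_upwards [h1] with α hα ⟨d, hd, hα2⟩
  apply hα
  rw [hα2.deriv]
  simpa using hd

/-- A monotone function that repeats a value is constant in between, so a one-sided derivative at α
would be zero. -/
theorem eq_of_mem_posSet {y : ℝ → ℝ} (hm : Monotone y) {α β : ℝ} (hα : α ∈ posSet y)
    (h : y β = y α) : β = α := by
  obtain ⟨d, hd, h1⟩ := hα
  by_contra hne
  have key : ∀ s : Set ℝ, UniqueDiffWithinAt ℝ s α → (∀ x ∈ s, y x = y α) → False := by
    intro s hu hs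
    have h2 : HasDerivWithinAt y 0 s α :=
      (hasDerivWithinAt_const α s (y α)).congr hs rfl
    exact hd.ne' (hu.eq_deriv _ h1.hasDerivWithinAt h2)
  rcases lt_or_gt_of_ne hne with hlt | hlt
  · refine key (Icc β α) ((uniqueDiffOn_Icc hlt) α ⟨hlt.le, le_rfl⟩) fun x hx => ?_
    exact le_antisymm (hm hx.2) (h ▸ hm hx.1)
  · refine key (Icc α β) ((uniqueDiffOn_Icc hlt) α ⟨le_rfl, hlt.le⟩) fun x hx => ?_
    exact le_antisymm (h ▸ hm hx.2) (hm hx.1)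

theorem countable_multSet {y : ℝ → ℝ} (hm : Monotone y) : (multSet y).Countable :=
  (hm.countable_setOfPred_two_preimages).mono (by
    rintro x ⟨a, b, h⟩; exact ⟨a, b, h⟩)

/-- The preimage of an open interval is an open interval. -/
theorem exists_preimage_Ioo {y : ℝ → ℝ} (hc : Continuous y) (hm : Monotone y)
    (hs : Function.Surjective y) {a b : ℝ} (hab : a < b) :
    ∃ α β, α < β ∧ y α = a ∧ y β = b ∧ y ⁻¹' Ioo a b = Ioo α β := by
  obtain ⟨p, hp⟩ := hs a
  obtain ⟨q, hq⟩ := hs b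
  have hA : (y ⁻¹' {a}).Nonempty := ⟨p, hp⟩
  have hB : (y ⁻¹' {b}).Nonempty := ⟨q, hq⟩
  have hAb : BddAbove (y ⁻¹' {a}) := ⟨q, fun x hx => by
    by_contra hcon
    have h1 := hm (not_le.1 hcon).le
    rw [hq, show y x = a from hx] at h1; linarith⟩
  have hBb : BddBelow (y ⁻¹' {b}) := ⟨p, fun x hx => by
    by_contra hcon
    have h1 := hm (not_le.1 hcon).le
    rw [hp, show y x = b from hx] at h1; linarith⟩
  -- The endpoints are the last point of the level a and the first point of the level b, so that
  -- both level sets stay outside the open interval.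
  have h1 : y (sSup (y ⁻¹' {a})) = a :=
    (isClosed_singleton.preimage hc).csSup_mem hA hAb
  have h2 : y (sInf (y ⁻¹' {b})) = b :=
    (isClosed_singleton.preimage hc).csInf_mem hB hBb
  refine ⟨_, _, ?_, h1, h2, ?_⟩
  · by_contra hcon
    have := hm (not_lt.1 hcon)
    rw [h1, h2] at this; linarith
  · ext x
    constructor
    · rintro ⟨hx1, hx2⟩
      constructor
      · by_contra hcon
        have := hm (not_lt.1 hcon)
        rw [h1] at this; linarith
      · by_contra hcon
        have := hm (not_lt.1 hcon)
        rw [h2] at this; linarith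
    · rintro ⟨hx1, hx2⟩
      constructor
      · refine lt_of_le_of_ne (h1 ▸ hm hx1.le) fun h => ?_
        exact absurd (le_csSup hAb (show x ∈ y ⁻¹' {a} from h.symm)) (not_le.2 hx1)
      · refine lt_of_le_of_ne (h2 ▸ hm hx2.le) fun h => ?_
        exact absurd (csInf_le hBb (show x ∈ y ⁻¹' {b} from h)) (not_le.2 hx2)

theorem derivMeasure_Ioc {Z : ℝ → ℝ} {K : ℝ≥0} (hZ : LipschitzWith K Z) (hm : Monotone Z)
    {a b : ℝ} (hab : a ≤ b) : derivMeasure Z (Ioc a b) = ENNReal.ofReal (Z b - Z a) := by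
  have hi : IntervalIntegrable (deriv Z) volume a b :=
    (hZ.lipschitzOnWith (s := uIcc a b)).absolutelyContinuousOnInterval.intervalIntegrable_deriv
  rw [derivMeasure, withDensity_apply _ measurableSet_Ioc, ← hZ.intervalIntegral_deriv,
    intervalIntegral.integral_of_le hab, ofReal_integral_eq_lintegral_ofReal]
  · rwa [intervalIntegrable_iff_integrableOn_Ioc_of_le hab] at hi
  · exact ae_of_all _ fun α => deriv_nonneg_of_monotone hm α

theorem derivMeasure_eq {Z : ℝ → ℝ} {K : ℝ≥0} (hZ : LipschitzWith K Z) (hm : Monotone Z) :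
    ∃ f : StieltjesFunction ℝ, (∀ x, f x = Z x) ∧ derivMeasure Z = f.measure := by
  let f : StieltjesFunction ℝ := ⟨Z, hm, fun x => hZ.continuous.continuousWithinAt⟩
  refine ⟨f, fun _ => rfl, ?_⟩
  have : IsLocallyFiniteMeasure (derivMeasure Z) := by
    refine ⟨fun x => ⟨Ioc (x - 1) (x + 1), Ioc_mem_nhds (by linarith) (by linarith), ?_⟩⟩
    rw [derivMeasure_Ioc hZ hm (by linarith)]
    exact ENNReal.ofReal_lt_top
  refine Measure.ext_of_Ioc _ _ fun a b hab => ?_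
  rw [derivMeasure_Ioc hZ hm hab.le, f.measure_Ioc]

theorem derivMeasure_Iic {Z : ℝ → ℝ} {K : ℝ≥0} (hZ : LipschitzWith K Z) (hm : Monotone Z)
    (hb : Tendsto Z atBot (𝓝 0)) (a : ℝ) : derivMeasure Z (Iic a) = ENNReal.ofReal (Z a) := by
  obtain ⟨f, hf, h⟩ := derivMeasure_eq hZ hm
  rw [h, f.measure_Iic (l := 0), hf, sub_zero]
  have : (f : ℝ → ℝ) = Z := funext hf
  rwa [this]

theorem derivMeasure_univ {Z : ℝ → ℝ} {K : ℝ≥0} (hZ : LipschitzWith K Z) (hm : Monotone Z)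
    (hb : Tendsto Z atBot (𝓝 0)) {M : ℝ} (ht : Tendsto Z atTop (𝓝 M)) :
    derivMeasure Z univ = ENNReal.ofReal M := by
  obtain ⟨f, hf, h⟩ := derivMeasure_eq hZ hm
  have : (f : ℝ → ℝ) = Z := funext hf
  rw [h, f.measure_univ (l := 0) (u := M) (by rwa [this]) (by rwa [this]), sub_zero]

theorem derivMeasure_absolutelyContinuous (Z : ℝ → ℝ) : derivMeasure Z ≪ volume :=
  withDensity_absolutelyContinuous _ _

instance nullSingletonClass_derivMeasure (Z : ℝ → ℝ) : NullSingletonClass (derivMeasure Z) :=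
  ⟨fun x => derivMeasure_absolutelyContinuous Z (measure_singleton x)⟩

theorem derivMeasure_Ioo {Z : ℝ → ℝ} {K : ℝ≥0} (hZ : LipschitzWith K Z) (hm : Monotone Z)
    {a b : ℝ} (hab : a ≤ b) : derivMeasure Z (Ioo a b) = ENNReal.ofReal (Z b - Z a) := by
  rw [← derivMeasure_Ioc hZ hm hab]
  exact measure_congr Ioo_ae_eq_Ioc

end HunterSaxton

namespace HunterSaxton

/-- Whatever m is, its image lives on y((posSet y)ᶜ), a Lebesgue null set; a measurable hull
replaces this possibly non-measurable image. -/
theorem map_compl_posSet_mutuallySingular {y : ℝ → ℝ} {K : ℝ≥0} (hy : LipschitzWith K y)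
    (hm : Monotone y) (m : Measure ℝ) : (m.restrict (posSet y)ᶜ).map y ⟂ₘ volume := by
  have hmy : Measurable y := hy.continuous.measurable
  refine Measure.MutuallySingular.mk (s := (toMeasurable volume (y '' (posSet y)ᶜ))ᶜ)
    (t := toMeasurable volume (y '' (posSet y)ᶜ)) ?_ ?_ (by simp)
  · rw [Measure.map_apply hmy (measurableSet_toMeasurable _ _).compl,
      Measure.restrict_apply (hmy (measurableSet_toMeasurable _ _).compl)]
    convert measure_empty (μ := m)
    ext α
    simp only [mem_inter_iff, mem_preimage, mem_compl_iff, mem_empty_iff_false, iff_false, not_and]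
    intro h1 h2
    exact h1 (subset_toMeasurable _ _ ⟨α, h2, rfl⟩)
  · rw [measure_toMeasurable]
    exact volume_image_compl_posSet hy hm

/-! ### Lagrangian charts -/

/-- Lagrangian coordinates: position `y`, velocity `V`, cumulative energy `Z` of total mass `M`. -/
structure LagChart (y V Z : ℝ → ℝ) (M : ℝ) : Prop where
  mono_y : Monotone y
  mono_Z : Monotone Z
  lip_y : ∃ K, LipschitzWith K y
  lip_Z : LipschitzWith 1 Z
  surj_y : Function.Surjective y
  sq_le : ∀ a b, (V b - V a) ^ 2 ≤ (y b - y a) * (Z b - Z a)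
  Z_bot : Tendsto Z atBot (𝓝 0)
  Z_top : Tendsto Z atTop (𝓝 M)
  ae_eq : ∀ᵐ α, deriv V α ^ 2 = deriv y α * deriv Z α

/-- The velocity as a function of the position. -/
noncomputable def eulVel (y V : ℝ → ℝ) (x : ℝ) : ℝ := V (Function.invFun y x)

/-- The energy as a measure in space. -/
noncomputable def eulEnergy (y Z : ℝ → ℝ) : Measure ℝ := (derivMeasure Z).map y

namespace LagChart

variable {y V Z : ℝ → ℝ} {M : ℝ} (h : LagChart y V Z M)
include h

theorem continuous_y : Continuous y := by
  obtain ⟨K, hK⟩ := h.lip_y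
  exact hK.continuous

theorem measurable_y : Measurable y := h.continuous_y.measurable

theorem Z_nonneg (α : ℝ) : 0 ≤ Z α := h.mono_Z.le_of_tendsto h.Z_bot α

theorem Z_le (α : ℝ) : Z α ≤ M := h.mono_Z.ge_of_tendsto h.Z_top α

theorem lip_V : ∃ K, LipschitzWith K V := by
  obtain ⟨K, hK⟩ := h.lip_y
  refine ⟨NNReal.sqrt K, LipschitzWith.of_dist_le_mul fun a b => ?_⟩
  rw [Real.dist_eq, Real.dist_eq, Real.coe_sqrt]
  have h1 := hK.dist_le_mul a b
  have h2 := h.lip_Z.dist_le_mul a b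
  rw [Real.dist_eq, Real.dist_eq] at h1 h2
  have h3 := h.sq_le b a
  have h4 : (V a - V b) ^ 2 ≤ K * |a - b| ^ 2 := by
    calc _ ≤ (y a - y b) * (Z a - Z b) := h3
      _ ≤ |y a - y b| * |Z a - Z b| := by rw [← abs_mul]; exact le_abs_self _
      _ ≤ (K * |a - b|) * ((1:ℝ≥0) * |a - b|) := by gcongr
      _ = _ := by push_cast; ring
  have h5 := Real.abs_le_sqrt h4
  rwa [Real.sqrt_mul K.coe_nonneg, Real.sqrt_sq (abs_nonneg _)] at h5

/-- `Function.invFun` picks an arbitrary point of the level set. The choice is harmless: Δy = 0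
forces ΔV = 0 by `sq_le`. -/
theorem eulVel_apply (α : ℝ) : eulVel y V (y α) = V α := by
  have h1 : y (Function.invFun y (y α)) = y α := Function.invFun_eq ⟨α, rfl⟩
  have h2 := h.sq_le α (Function.invFun y (y α))
  rw [h1, sub_self, zero_mul] at h2
  have := pow_eq_zero_iff (two_ne_zero) |>.1 (le_antisymm h2 (sq_nonneg _))
  exact sub_eq_zero.1 this

theorem isFiniteMeasure_derivMeasure : IsFiniteMeasure (derivMeasure Z) :=
  ⟨by rw [derivMeasure_univ h.lip_Z h.mono_Z h.Z_bot h.Z_top]; exact ENNReal.ofReal_lt_top⟩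

theorem isFiniteMeasure_eulEnergy : IsFiniteMeasure (eulEnergy y Z) := by
  have := h.isFiniteMeasure_derivMeasure
  exact Measure.isFiniteMeasure_map _ _

theorem eulEnergy_univ : eulEnergy y Z univ = ENNReal.ofReal M := by
  rw [eulEnergy, Measure.map_apply h.measurable_y MeasurableSet.univ, preimage_univ,
    derivMeasure_univ h.lip_Z h.mono_Z h.Z_bot h.Z_top]

theorem energyBound : EnergyBound (eulVel y V) (eulEnergy y Z) := by
  intro a b hab
  rcases hab.eq_or_lt with rfl | hlt
  · simp
  obtain ⟨α, β, hαβ, rfl, rfl, hp⟩ := exists_preimage_Ioo h.continuous_y h.mono_y h.surj_y hlt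
  rw [h.eulVel_apply, h.eulVel_apply, measureReal_def, eulEnergy,
    Measure.map_apply h.measurable_y measurableSet_Ioo, hp,
    derivMeasure_Ioo h.lip_Z h.mono_Z hαβ.le,
    ENNReal.toReal_ofReal (sub_nonneg.2 (h.mono_Z hαβ.le))]
  exact h.sq_le α β

/-- Where y has positive derivative its level set is a single point, so no energy is gained by
closing the half-line and F(y(α)) = Z(α). -/
theorem eulEnergy_Iic {α : ℝ} (hα : α ∈ posSet y) :
    eulEnergy y Z (Iic (y α)) = ENNReal.ofReal (Z α) := by
  rw [eulEnergy, Measure.map_apply h.measurable_y measurableSet_Iic,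
    ← derivMeasure_Iic h.lip_Z h.mono_Z h.Z_bot]
  congr 1
  ext β
  simp only [mem_preimage, mem_Iic]
  constructor
  · intro hb
    by_contra hcon
    have := eq_of_mem_posSet h.mono_y hα (le_antisymm hb (h.mono_y (not_le.1 hcon).le))
    linarith
  · exact fun hb => h.mono_y hb

/-- The arbitrary inverse of y is continuous at y α because y lies strictly below and above y α on
the two sides of α. It is therefore differentiable there with derivative 1/d, and the chain rule
applies. -/
theorem hasDerivAt_eulVel {α d e : ℝ} (hd : 0 < d) (hy : HasDerivAt y d α) (hV : HasDerivAt V e α) :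
    HasDerivAt (eulVel y V) (e / d) (y α) := by
  have hmem : α ∈ posSet y := ⟨d, hd, hy⟩
  set r := Function.invFun y
  have hr : ∀ x, y (r x) = x := fun x => Function.invFun_eq (h.surj_y x)
  have hrα : r (y α) = α := eq_of_mem_posSet h.mono_y hmem (hr _)
  have hcont : ContinuousAt r (y α) := by
    rw [Metric.continuousAt_iff]
    intro ε hε
    have h1 : y (α - ε / 2) < y α := lt_of_le_of_ne (h.mono_y (by linarith)) fun h1 => by
      have := eq_of_mem_posSet h.mono_y hmem h1; linarith
    have h2 : y α < y (α + ε / 2) := lt_of_le_of_ne (h.mono_y (by linarith)) fun h1 => by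
      have := eq_of_mem_posSet h.mono_y hmem h1.symm; linarith
    refine ⟨min (y α - y (α - ε / 2)) (y (α + ε / 2) - y α), 
      lt_min (by linarith) (by linarith), fun x hx => ?_⟩
    rw [Real.dist_eq, abs_lt] at hx
    have hx1 := hx.1
    have hx2 := hx.2.trans_le (min_le_right _ _)
    have hx3 : -(y α - y (α - ε / 2)) < x - y α :=
      lt_of_le_of_lt (neg_le_neg (min_le_left _ _)) hx1
    rw [hrα, Real.dist_eq, abs_lt]
    constructor
    · by_contra hcon
      have := h.mono_y (show r x ≤ α - ε / 2 by linarith)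
      rw [hr] at this; linarith
    · by_contra hcon
      have := h.mono_y (show α + ε / 2 ≤ r x by linarith)
      rw [hr] at this; linarith
  have h3 : HasDerivAt r d⁻¹ (y α) := by
    refine HasDerivAt.of_local_left_inverse hcont (by rwa [hrα]) hd.ne' (Eventually.of_forall hr)
  have h4 : HasDerivAt (V ∘ r) (e * d⁻¹) (y α) := by
    refine HasDerivAt.comp (y α) ?_ h3
    rwa [hrα]
  rw [div_eq_mul_inv]
  exact h4

theorem ae_differentiableAt_V : ∀ᵐ α, DifferentiableAt ℝ V α := by
  obtain ⟨K, hK⟩ := h.lip_V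
  exact hK.ae_differentiableAt

/-- Where y' = 0, the relation `ae_eq` gives V' = 0, so both sides vanish whatever value `deriv
(eulVel y V)` takes there. -/
theorem ae_deriv_V_eq : ∀ᵐ α, deriv V α = deriv (eulVel y V) (y α) * deriv y α := by
  obtain ⟨K, hK⟩ := h.lip_y
  filter_upwards [h.ae_differentiableAt_V, h.ae_eq, ae_mem_posSet_or_zeroSet hK h.mono_y]
    with α h1 h2 h3
  rcases h3 with ⟨d, hd, h3⟩ | h3
  · rw [(h.hasDerivAt_eulVel hd h3 h1.hasDerivAt).deriv, h3.deriv]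
    field_simp
  · have h4 : deriv y α = 0 := HasDerivAt.deriv h3
    rw [h4, zero_mul] at h2
    rw [h4, mul_zero]
    exact pow_eq_zero_iff two_ne_zero |>.1 h2

/-- On `posSet y`, the relations V' = u_x y' and (V')² = y' Z' give Z' = u_x² y' after division by
y', and the change of variables x = y α finishes. -/
theorem map_restrict_posSet :
    ((derivMeasure Z).restrict (posSet y)).map y = sqMeasure (deriv (eulVel y V)) := by
  obtain ⟨K, hK⟩ := h.lip_y
  ext S hS
  have hyS := h.measurable_y hS
  rw [Measure.map_apply h.measurable_y hS, Measure.restrict_apply hyS, sqMeasure,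
    withDensity_apply _ hS, ← lintegral_indicator hS,
    ← lintegral_comp_mul_deriv hK h.mono_y h.surj_y, derivMeasure,
    withDensity_apply _ (hyS.inter (measurableSet_posSet y)),
    ← lintegral_indicator (hyS.inter (measurableSet_posSet y))]
  refine lintegral_congr_ae ?_
  filter_upwards [h.ae_deriv_V_eq, h.ae_eq, ae_mem_posSet_or_zeroSet hK h.mono_y] with α h1 h2 h3
  by_cases hα : y α ∈ S
  swap
  · rw [indicator_of_notMem (by simp [hα]), indicator_of_notMem hα, mul_zero]
  rcases h3 with h3 | h3
  · rw [indicator_of_mem (show α ∈ y ⁻¹' S ∩ posSet y from ⟨hα, h3⟩), indicator_of_mem hα,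
      ← ENNReal.ofReal_mul (deriv_nonneg_of_monotone h.mono_y _)]
    congr 1
    obtain ⟨d, hd, h3⟩ := h3
    rw [h3.deriv] at *
    rw [h1] at h2
    have : d * (d * deriv (eulVel y V) (y α) ^ 2) = d * deriv Z α := by rw [← h2]; ring
    exact (mul_left_cancel₀ hd.ne' this).symm
  · have h4 : α ∉ posSet y := fun h5 => (disjoint_posSet_zeroSet y).le_bot ⟨h5, h3⟩
    have h5 : deriv y α = 0 := HasDerivAt.deriv h3
    rw [indicator_of_notMem (fun h6 => h4 h6.2), h5]
    simp

theorem eulEnergy_eq_add : eulEnergy y Z = ((derivMeasure Z).restrict (posSet y)ᶜ).map y +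
    sqMeasure (deriv (eulVel y V)) := by
  rw [← h.map_restrict_posSet, ← Measure.map_add _ _ h.measurable_y, add_comm,
    Measure.restrict_add_restrict_compl (measurableSet_posSet y), eulEnergy]

theorem mutuallySingular_map_compl :
    ((derivMeasure Z).restrict (posSet y)ᶜ).map y ⟂ₘ volume := by
  obtain ⟨K, hK⟩ := h.lip_y
  exact map_compl_posSet_mutuallySingular hK h.mono_y _

omit h in
theorem measurable_sq : Measurable fun x => ENNReal.ofReal (deriv (eulVel y V) x ^ 2) :=
  ((measurable_deriv _).pow_const 2).ennreal_ofReal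

theorem singularPart_eulEnergy : (eulEnergy y Z).singularPart volume =
    ((derivMeasure Z).restrict (posSet y)ᶜ).map y :=
  (Measure.eq_singularPart measurable_sq h.mutuallySingular_map_compl h.eulEnergy_eq_add).symm

theorem acPart_eulEnergy : acPart (eulEnergy y Z) = sqMeasure (deriv (eulVel y V)) :=
  (Measure.eq_withDensity_rnDeriv measurable_sq h.mutuallySingular_map_compl
    h.eulEnergy_eq_add).symm

omit h in
theorem preimage_multSet_eq (y : ℝ → ℝ) : y ⁻¹' multSet y = {α | ∃ β, β ≠ α ∧ y β = y α} := by
  ext α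
  constructor
  · rintro ⟨p, q, hpq, h1, h2⟩
    by_cases hp : p = α
    · exact ⟨q, by rintro rfl; exact hpq.ne hp, h2⟩
    · exact ⟨p, hp, h1⟩
  · rintro ⟨β, hβ, h1⟩
    rcases lt_or_gt_of_ne hβ with hlt | hlt
    · exact ⟨β, α, hlt, h1, rfl⟩
    · exact ⟨α, β, hlt, rfl, h1⟩

theorem eulEnergy_singleton {x : ℝ} (hx : x ∉ multSet y) : eulEnergy y Z {x} = 0 := by
  rw [eulEnergy, Measure.map_apply h.measurable_y (measurableSet_singleton x)]
  refine Set.Subsingleton.measure_zero ?_ _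
  intro α hα β hβ
  by_contra hne
  rcases lt_or_gt_of_ne hne with hlt | hlt
  · exact hx ⟨_, _, hlt, hα, hβ⟩
  · exact hx ⟨_, _, hlt, hβ, hα⟩

/-- Every atom is a multiple value. Conversely the multiple values are countable, so those that
carry no mass are negligible together. A multiple value need not be an atom, since Z may be constant
on its level set. -/
theorem atoms_ae_eq : (atoms (eulEnergy y Z) : Set ℝ) =ᵐ[eulEnergy y Z] multSet y := by
  have hsub : atoms (eulEnergy y Z) ⊆ multSet y := by
    intro x hx
    by_contra hcon
    exact hx (h.eulEnergy_singleton hcon)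
  have hnull : eulEnergy y Z (multSet y \ atoms (eulEnergy y Z)) = 0 := by
    have hc : (multSet y \ atoms (eulEnergy y Z)).Countable :=
      (countable_multSet h.mono_y).mono sdiff_subset
    rw [← biUnion_of_singleton (multSet y \ atoms (eulEnergy y Z)), measure_biUnion_null_iff hc]
    intro x hx
    by_contra hcon
    exact hx.2 hcon
  refine (ae_le_set.2 ?_).antisymm (ae_le_set.2 hnull)
  rw [sdiff_eq_empty.2 hsub, measure_empty]

theorem ppPart_eulEnergy : ppPart (eulEnergy y Z) =
    ((derivMeasure Z).restrict (zeroSet y ∩ y ⁻¹' multSet y)).map y := by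
  obtain ⟨K, hK⟩ := h.lip_y
  have hC : MeasurableSet (multSet y) := (countable_multSet h.mono_y).measurableSet
  rw [ppPart, Measure.restrict_congr_set h.atoms_ae_eq, eulEnergy,
    Measure.restrict_map h.measurable_y hC]
  congr 1
  refine Measure.restrict_congr_set ?_
  refine (derivMeasure_absolutelyContinuous Z).ae_eq ?_
  filter_upwards [ae_mem_posSet_or_zeroSet hK h.mono_y] with α hα
  apply propext
  change y α ∈ multSet y ↔ α ∈ zeroSet y ∧ y α ∈ multSet y
  -- A multiple value cannot be taken at a point of positive derivative, so intersecting with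
  -- `zeroSet y` loses nothing.
  refine ⟨fun hm => ⟨hα.resolve_left fun hp => ?_, hm⟩, fun hm => hm.2⟩
  have : α ∈ y ⁻¹' multSet y := hm
  rw [preimage_multSet_eq] at this
  obtain ⟨β, hβ, h1⟩ := this
  exact hβ (eq_of_mem_posSet h.mono_y hp h1)

theorem scPart_eulEnergy : scPart (eulEnergy y Z) =
    ((derivMeasure Z).restrict (zeroSet y \ y ⁻¹' multSet y)).map y := by
  obtain ⟨K, hK⟩ := h.lip_y
  have hC : MeasurableSet (multSet y)ᶜ := (countable_multSet h.mono_y).measurableSet.compl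
  have e1 : ((eulEnergy y Z).singularPart volume).restrict (atoms (eulEnergy y Z))ᶜ =
      ((eulEnergy y Z).singularPart volume).restrict (multSet y)ᶜ :=
    Measure.restrict_congr_set
      ((Measure.absolutelyContinuous_of_le (Measure.singularPart_le _ _)).ae_eq
        h.atoms_ae_eq.compl)
  rw [scPart, e1, h.singularPart_eulEnergy, Measure.restrict_map h.measurable_y hC,
    Measure.restrict_restrict (h.measurable_y hC)]
  congr 1
  refine Measure.restrict_congr_set ?_
  refine (derivMeasure_absolutelyContinuous Z).ae_eq ?_
  filter_upwards [compl_posSet_ae_eq hK h.mono_y] with α hα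
  apply propext
  have hα' : α ∈ (posSet y)ᶜ ↔ α ∈ zeroSet y := iff_of_eq hα
  change (y α ∈ (multSet y)ᶜ ∧ α ∈ (posSet y)ᶜ) ↔ (α ∈ zeroSet y ∧ y α ∉ multSet y)
  rw [hα', and_comm]
  rfl

theorem ppPart_add_scPart : ppPart (eulEnergy y Z) + scPart (eulEnergy y Z) =
    ((derivMeasure Z).restrict (zeroSet y)).map y := by
  have hC : MeasurableSet (y ⁻¹' multSet y) :=
    h.measurable_y (countable_multSet h.mono_y).measurableSet
  rw [h.ppPart_eulEnergy, h.scPart_eulEnergy, ← Measure.map_add _ _ h.measurable_y,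
    Measure.restrict_inter_add_sdiff _ hC]

theorem continuous_eulVel : Continuous (eulVel y V) := by
  have hf := h.isFiniteMeasure_eulEnergy
  refine continuous_iff_continuousAt.2 fun x => ?_
  rw [ContinuousAt, tendsto_iff_dist_tendsto_zero]
  refine squeeze_zero (fun _ => dist_nonneg) (fun z => h.energyBound.holder x z) ?_
  have : Continuous fun z : ℝ => √((eulEnergy y Z).real univ) * √|z - x| := by fun_prop
  have h2 := this.tendsto x
  simpa using h2

theorem globallyAC_eulVel : GloballyAC (eulVel y V) := by
  have hf := h.isFiniteMeasure_eulEnergy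
  exact h.energyBound.globallyAC

end LagChart

end HunterSaxton

namespace HunterSaxton

/-! ### The initial chart -/

theorem tendsto_real_Iic_atBot (m : Measure ℝ) [IsFiniteMeasure m] :
    Tendsto (fun x => m.real (Iic x)) atBot (𝓝 0) := by
  have h := tendsto_measure_iInter_atBot (μ := m) (s := fun x : ℝ => Iic x)
    (fun x => measurableSet_Iic.nullMeasurableSet) (fun a b hab => Iic_subset_Iic.2 hab)
    ⟨0, measure_ne_top _ _⟩
  have e : ⋂ x : ℝ, Iic x = ∅ := by
    ext z
    simp only [mem_iInter, mem_Iic, mem_empty_iff_false, iff_false, not_forall, not_le]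
    exact ⟨z - 1, by linarith⟩
  rw [e, measure_empty] at h
  have := (ENNReal.tendsto_toReal ENNReal.zero_ne_top).comp h
  simpa using! this

theorem tendsto_real_Iic_atTop (m : Measure ℝ) [IsFiniteMeasure m] :
    Tendsto (fun x => m.real (Iic x)) atTop (𝓝 (m.real univ)) :=
  (ENNReal.tendsto_toReal (measure_ne_top m univ)).comp (tendsto_measure_Iic_atTop m)

theorem real_Iio_le_Iic (m : Measure ℝ) [IsFiniteMeasure m] (x : ℝ) :
    m.real (Iio x) ≤ m.real (Iic x) := measureReal_mono Iio_subset_Iic_self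

theorem real_Iic_le_Iio (m : Measure ℝ) [IsFiniteMeasure m] {x z : ℝ} (h : x < z) :
    m.real (Iic x) ≤ m.real (Iio z) := measureReal_mono (Iic_subset_Iio.2 h)

theorem real_Iio_eq_add (m : Measure ℝ) [IsFiniteMeasure m] {x z : ℝ} (h : x < z) :
    m.real (Iio z) = m.real (Iic x) + m.real (Ioo x z) := by
  rw [← measureReal_union (by
    rw [Set.disjoint_left]; intro w hw hw'; exact absurd hw'.1 (not_lt.2 hw)) measurableSet_Ioo,
    Iic_union_Ioo_eq_Iio h]

variable (μ : FiniteMeasure ℝ)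

theorem bddAbove_xbar (α : ℝ) : BddAbove {x | x + (μ : Measure ℝ).real (Iio x) ≤ α} :=
  ⟨α, fun x hx => by
    have h : 0 ≤ (μ : Measure ℝ).real (Iio x) := measureReal_nonneg
    simp only [mem_ofPred_eq] at hx
    linarith⟩

theorem nonempty_xbar (α : ℝ) : {x | x + (μ : Measure ℝ).real (Iio x) ≤ α}.Nonempty := by
  refine ⟨α - (μ : Measure ℝ).real univ, ?_⟩
  have : (μ : Measure ℝ).real (Iio (α - (μ : Measure ℝ).real univ)) ≤ (μ : Measure ℝ).real univ :=
    measureReal_mono (subset_univ _)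
  simp only [mem_ofPred_eq]
  linarith

theorem tendsto_sub_one_div (x : ℝ) :
    Tendsto (fun n : ℕ => x - 1 / ((n : ℝ) + 1)) atTop (𝓝 x) := by
  simpa using! tendsto_const_nhds.sub (tendsto_one_div_add_atTop_nhds_zero_nat (𝕜 := ℝ))
    (a := x) (f := fun _ : ℕ => x)

theorem tendsto_add_one_div (x : ℝ) :
    Tendsto (fun n : ℕ => x + 1 / ((n : ℝ) + 1)) atTop (𝓝 x) := by
  simpa using! tendsto_const_nhds.add (tendsto_one_div_add_atTop_nhds_zero_nat (𝕜 := ℝ))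
    (a := x) (f := fun _ : ℕ => x)

theorem tendsto_real_Iic_Iio (m : Measure ℝ) [IsFiniteMeasure m] (x : ℝ) :
    Tendsto (fun n : ℕ => m.real (Iic (x - 1 / ((n : ℝ) + 1)))) atTop (𝓝 (m.real (Iio x))) := by
  refine (ENNReal.tendsto_toReal (measure_ne_top m _)).comp ?_
  rw [← iUnion_Iic_eq_Iio_of_lt_of_tendsto (fun n : ℕ => ?_) (tendsto_sub_one_div x)]
  · refine tendsto_measure_iUnion_atTop fun a b hab => Iic_subset_Iic.2 ?_
    have : 1 / ((b : ℝ) + 1) ≤ 1 / ((a : ℝ) + 1) := Nat.one_div_le_one_div hab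
    linarith
  · have : 0 < 1 / ((n : ℝ) + 1) := Nat.one_div_pos_of_nat
    linarith

theorem tendsto_real_Iio_Iic (m : Measure ℝ) [IsFiniteMeasure m] (x : ℝ) :
    Tendsto (fun n : ℕ => m.real (Iio (x + 1 / ((n : ℝ) + 1)))) atTop (𝓝 (m.real (Iic x))) := by
  refine (ENNReal.tendsto_toReal (measure_ne_top m _)).comp ?_
  have e : Iic x = ⋂ n : ℕ, Iio (x + 1 / ((n : ℝ) + 1)) := by
    ext z
    simp only [mem_Iic, mem_iInter, mem_Iio]
    constructor
    · intro h n
      have : 0 < 1 / ((n : ℝ) + 1) := Nat.one_div_pos_of_nat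
      linarith
    · intro h
      exact ge_of_tendsto' (tendsto_add_one_div x) fun n => (h n).le
  rw [e]
  refine tendsto_measure_iInter_atTop (fun n => measurableSet_Iio.nullMeasurableSet)
    (fun a b hab => Iio_subset_Iio ?_) ⟨0, measure_ne_top _ _⟩
  have : 1 / ((b : ℝ) + 1) ≤ 1 / ((a : ℝ) + 1) := Nat.one_div_le_one_div hab
  linarith

/-- With `le_xbar_add_Iic` this brackets α between x + μ((-∞, x)) and x + μ((-∞, x]) at x = x̄(α),
which determines x̄. An atom at x thus occupies an interval of labels. The proof uses left
continuity of x ↦ μ((-∞, x)). -/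
theorem xbar_add_Iio_le (α : ℝ) :
    xbar μ α + (μ : Measure ℝ).real (Iio (xbar μ α)) ≤ α := by
  refine le_of_tendsto' ((tendsto_sub_one_div _).add
    (tendsto_real_Iic_Iio (μ : Measure ℝ) (xbar μ α))) fun n => ?_
  have : 0 < 1 / ((n : ℝ) + 1) := Nat.one_div_pos_of_nat
  obtain ⟨z, hz, hz2⟩ := exists_lt_of_lt_csSup (nonempty_xbar μ α)
    (show xbar μ α - 1 / ((n : ℝ) + 1) < sSup _ from by
      change xbar μ α - 1 / ((n : ℝ) + 1) < xbar μ α; linarith)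
  have h1 := real_Iic_le_Iio (μ : Measure ℝ) hz2
  simp only [mem_ofPred_eq] at hz
  linarith

theorem le_xbar_add_Iic (α : ℝ) :
    α ≤ xbar μ α + (μ : Measure ℝ).real (Iic (xbar μ α)) := by
  refine ge_of_tendsto' ((tendsto_add_one_div _).add
    (tendsto_real_Iio_Iic (μ : Measure ℝ) (xbar μ α))) fun n => ?_
  by_contra! hcon
  have : 0 < 1 / ((n : ℝ) + 1) := Nat.one_div_pos_of_nat
  have h1 := le_csSup (bddAbove_xbar μ α)
    (show xbar μ α + 1 / ((n : ℝ) + 1) ∈ {x | x + (μ : Measure ℝ).real (Iio x) ≤ α} from hcon.le)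
  change _ ≤ xbar μ α at h1
  linarith

theorem monotone_xbar : Monotone (xbar μ) := by
  intro α β hαβ
  by_contra! hcon
  have h1 := xbar_add_Iio_le μ α
  have h2 := le_xbar_add_Iic μ β
  have h3 := real_Iic_le_Iio (μ : Measure ℝ) hcon
  linarith

theorem xbar_eq {x α : ℝ} (h1 : x + (μ : Measure ℝ).real (Iio x) ≤ α)
    (h2 : α ≤ x + (μ : Measure ℝ).real (Iic x)) : xbar μ α = x := by
  have h3 := xbar_add_Iio_le μ α
  have h4 := le_xbar_add_Iic μ α
  rcases lt_trichotomy (xbar μ α) x with hlt | heq | hlt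
  · have := real_Iic_le_Iio (μ : Measure ℝ) hlt
    linarith
  · exact heq
  · have := real_Iic_le_Iio (μ : Measure ℝ) hlt
    linarith

theorem surjective_xbar : Function.Surjective (xbar μ) := fun x =>
  ⟨x + (μ : Measure ℝ).real (Iio x), xbar_eq μ le_rfl
    (by have := real_Iio_le_Iic (μ : Measure ℝ) x; linarith)⟩

/-- The part `α - x̄(α)` of the label that measures energy. -/
noncomputable def zbar (α : ℝ) : ℝ := α - xbar μ α

/-- Only the open interval can be compared: atoms at its two ends may be covered in part by the
labels between α and β. -/
theorem zbar_sub_ge {α β : ℝ} (h : α ≤ β) :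
    (μ : Measure ℝ).real (Ioo (xbar μ α) (xbar μ β)) ≤ zbar μ β - zbar μ α := by
  unfold zbar
  rcases (monotone_xbar μ h).eq_or_lt with heq | hlt
  · rw [heq]; simp; linarith
  · have h1 := real_Iio_eq_add (μ : Measure ℝ) hlt
    have h2 := xbar_add_Iio_le μ β
    have h3 := le_xbar_add_Iic μ α
    linarith

theorem monotone_zbar : Monotone (zbar μ) := fun α β h => by
  have h1 := zbar_sub_ge μ h
  have h2 : 0 ≤ (μ : Measure ℝ).real (Ioo (xbar μ α) (xbar μ β)) := measureReal_nonneg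
  linarith

theorem lipschitzWith_xbar : LipschitzWith 1 (xbar μ) := by
  refine LipschitzWith.of_le_add fun α β => ?_
  rw [Real.dist_eq]
  rcases le_total α β with h | h
  · have := monotone_xbar μ h
    have := abs_nonneg (α - β)
    linarith
  · have h1 := monotone_zbar μ h
    unfold zbar at h1
    have := le_abs_self (α - β)
    linarith

theorem lipschitzWith_zbar : LipschitzWith 1 (zbar μ) := by
  refine LipschitzWith.of_le_add fun α β => ?_
  rw [Real.dist_eq]
  rcases le_total α β with h | h
  · have := monotone_zbar μ h
    have := abs_nonneg (α - β)
    linarith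
  · have h1 := monotone_xbar μ h
    unfold zbar
    have := le_abs_self (α - β)
    linarith

theorem zbar_le_Iic (α : ℝ) : zbar μ α ≤ (μ : Measure ℝ).real (Iic (xbar μ α)) := by
  have := le_xbar_add_Iic μ α
  unfold zbar; linarith

theorem Iio_le_zbar (α : ℝ) : (μ : Measure ℝ).real (Iio (xbar μ α)) ≤ zbar μ α := by
  have := xbar_add_Iio_le μ α
  unfold zbar; linarith

theorem tendsto_xbar_atBot : Tendsto (xbar μ) atBot atBot :=
  (monotone_xbar μ).tendsto_atBot_atBot fun b => (surjective_xbar μ b).imp fun _ h => h.le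

theorem tendsto_xbar_atTop : Tendsto (xbar μ) atTop atTop :=
  (monotone_xbar μ).tendsto_atTop_atTop fun b => (surjective_xbar μ b).imp fun _ h => h.ge

theorem tendsto_zbar_atBot : Tendsto (zbar μ) atBot (𝓝 0) :=
  squeeze_zero (fun α => measureReal_nonneg.trans (Iio_le_zbar μ α)) (zbar_le_Iic μ)
    ((tendsto_real_Iic_atBot _).comp (tendsto_xbar_atBot μ))

theorem tendsto_zbar_atTop : Tendsto (zbar μ) atTop (𝓝 ((μ : Measure ℝ).real univ)) := by
  refine tendsto_of_tendsto_of_tendsto_of_le_of_le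
    (((tendsto_real_Iic_atTop (μ : Measure ℝ)).comp
      (tendsto_atTop_add_const_right _ (-1) tendsto_id)).comp (tendsto_xbar_atTop μ))
    tendsto_const_nhds (fun α => ?_) (fun α => ?_)
  · refine (measureReal_mono ?_).trans (Iio_le_zbar μ α)
    intro z hz
    simp only [id, mem_Iic, mem_Iio] at hz ⊢
    linarith
  · exact (zbar_le_Iic μ α).trans (measureReal_mono (subset_univ _))

/-- The last label sent to x is x + μ((-∞, x]), and there Z equals μ((-∞, x]); so the two
distribution functions coincide. -/
theorem map_xbar : (derivMeasure (zbar μ)).map (xbar μ) = (μ : Measure ℝ) := by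
  have hm : Measurable (xbar μ) := (lipschitzWith_xbar μ).continuous.measurable
  have hfin : IsFiniteMeasure (derivMeasure (zbar μ)) :=
    ⟨by rw [derivMeasure_univ (lipschitzWith_zbar μ) (monotone_zbar μ) (tendsto_zbar_atBot μ)
      (tendsto_zbar_atTop μ)]; exact ENNReal.ofReal_lt_top⟩
  have hfin' : IsFiniteMeasure ((derivMeasure (zbar μ)).map (xbar μ)) :=
    Measure.isFiniteMeasure_map _ _
  refine Measure.ext_of_Iic _ _ fun x => ?_
  rw [Measure.map_apply hm measurableSet_Iic]
  set a := x + (μ : Measure ℝ).real (Iic x) with ha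
  have hxa : xbar μ a = x :=
    xbar_eq μ (by have := real_Iio_le_Iic (μ : Measure ℝ) x; linarith) le_rfl
  have e : xbar μ ⁻¹' Iic x = Iic a := by
    ext α
    simp only [mem_preimage, mem_Iic]
    constructor
    · intro h
      have h1 := le_xbar_add_Iic μ α
      have h2 : (μ : Measure ℝ).real (Iic (xbar μ α)) ≤ (μ : Measure ℝ).real (Iic x) :=
        measureReal_mono (Iic_subset_Iic.2 h)
      linarith
    · intro h
      exact hxa ▸ monotone_xbar μ h
  rw [e, derivMeasure_Iic (lipschitzWith_zbar μ) (monotone_zbar μ) (tendsto_zbar_atBot μ)]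
  have : zbar μ a = (μ : Measure ℝ).real (Iic x) := by
    rw [zbar, hxa, ha]; ring
  rw [this, ofReal_measureReal]

theorem hasDerivAt_zbar_iff {α d : ℝ} : HasDerivAt (zbar μ) d α ↔ HasDerivAt (xbar μ) (1 - d) α := by
  constructor
  · intro h
    have := (hasDerivAt_id α).sub h
    refine this.congr_of_eventuallyEq (Eventually.of_forall fun β => ?_)
    simp [zbar]
  · intro h
    have := (hasDerivAt_id α).sub h
    rw [sub_sub_cancel] at this
    exact this

theorem ae_deriv_zbar : ∀ᵐ α, deriv (zbar μ) α = 1 - deriv (xbar μ) α := by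
  filter_upwards [(lipschitzWith_xbar μ).ae_differentiableAt] with α hα
  refine ((hasDerivAt_zbar_iff μ).2 ?_).deriv
  rw [sub_sub_cancel]
  exact hα.hasDerivAt

theorem lagEnergy_eq : lagEnergy μ = derivMeasure (zbar μ) := by
  refine withDensity_congr_ae ?_
  filter_upwards [ae_deriv_zbar μ] with α hα
  rw [hα]

/-- Increments bounded by a product give derivatives bounded by the product. -/
theorem sq_deriv_le {y V Z : ℝ → ℝ} (hsq : ∀ a b, (V b - V a) ^ 2 ≤ (y b - y a) * (Z b - Z a))
    {α d e f : ℝ} (hV : HasDerivAt V e α) (hy : HasDerivAt y d α) (hZ : HasDerivAt Z f α) :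
    e ^ 2 ≤ d * f := by
  rw [hasDerivAt_iff_tendsto_slope] at hV hy hZ
  refine le_of_tendsto_of_tendsto (hV.pow 2) (hy.mul hZ) ?_
  filter_upwards [self_mem_nhdsWithin] with β hβ
  have hne : β - α ≠ 0 := sub_ne_zero.2 hβ
  rw [slope_def_field, slope_def_field, slope_def_field, div_pow, div_mul_div_comm, ← sq]
  exact div_le_div_of_nonneg_right (hsq α β) (sq_nonneg _)

/-! ### The initial datum as a Lagrangian chart -/

section datum

variable {u₀ : ℝ →ᵇ ℝ} {μ}

theorem InD.energyBound (h₀ : InD u₀ μ) : EnergyBound u₀ (μ : Measure ℝ) := by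
  obtain ⟨g, hg, -, h⟩ := h₀
  exact energyBound_of_acPart_eq hg u₀.continuous h

theorem InD.isWeakDeriv (h₀ : InD u₀ μ) : IsWeakDeriv u₀ (deriv u₀) :=
  h₀.energyBound.globallyAC.isWeakDeriv

theorem sqMeasure_congr {g h : ℝ → ℝ} (e : g =ᵐ[volume] h) : sqMeasure g = sqMeasure h :=
  withDensity_congr_ae (by filter_upwards [e] with x hx; rw [hx])

theorem InD.acPart_eq (h₀ : InD u₀ μ) : acPart (μ : Measure ℝ) = sqMeasure (deriv u₀) := by
  have h1 := h₀.isWeakDeriv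
  obtain ⟨g, hg, -, h⟩ := h₀
  rw [h]
  exact sqMeasure_congr (hg.ae_eq h1)

theorem InD.sq_le (h₀ : InD u₀ μ) (α β : ℝ) :
    (u₀ (xbar μ β) - u₀ (xbar μ α)) ^ 2 ≤
      (xbar μ β - xbar μ α) * (zbar μ β - zbar μ α) := by
  wlog h : α ≤ β generalizing α β
  · have := this β α (le_of_not_ge h)
    nlinarith [this]
  · refine (h₀.energyBound _ _ (monotone_xbar μ h)).trans ?_
    exact mul_le_mul_of_nonneg_left (zbar_sub_ge μ h) (sub_nonneg.2 (monotone_xbar μ h))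

/-- The labels outside `posSet (xbar μ)` are sent to a null set, while the image of the energy on
`posSet (xbar μ)` does not charge null sets. Uniqueness of the Lebesgue decomposition identifies the
two pieces. -/
theorem acPart_eq_map_posSet :
    acPart (μ : Measure ℝ) =
      ((derivMeasure (zbar μ)).restrict (posSet (xbar μ))).map (xbar μ) := by
  have hL := lipschitzWith_xbar μ
  have hm := monotone_xbar μ
  have hmeas : Measurable (xbar μ) := hL.continuous.measurable
  set ρ := ((derivMeasure (zbar μ)).restrict (posSet (xbar μ))).map (xbar μ) with hρ
  have hsum : (μ : Measure ℝ) =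
      ((derivMeasure (zbar μ)).restrict (posSet (xbar μ))ᶜ).map (xbar μ) + ρ := by
    rw [hρ, ← Measure.map_add _ _ hmeas, add_comm,
      Measure.restrict_add_restrict_compl (measurableSet_posSet _), map_xbar]
  have hle : ρ ≤ (μ : Measure ℝ) := by
    rw [hsum]; exact Measure.le_add_left le_rfl
  have hfin : IsFiniteMeasure ρ := isFiniteMeasure_of_le _ hle
  have hac : ρ ≪ volume := by
    refine Measure.AbsolutelyContinuous.mk fun s hs h0 => ?_
    rw [hρ, Measure.map_apply hmeas hs, Measure.restrict_apply (hmeas hs)]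
    refine derivMeasure_absolutelyContinuous _ ?_
    have := null_preimage_inter_posSet hL hm (surjective_xbar μ) (p := fun x => x ∉ s)
      (measure_eq_zero_iff_ae_notMem.1 h0)
    refine measure_mono_null ?_ this
    rintro α ⟨h1, h2⟩ h3
    exact h3 h2 h1
  have e : volume.withDensity (ρ.rnDeriv volume) = ρ := Measure.withDensity_rnDeriv_eq _ _ hac
  rw [acPart, ← Measure.eq_withDensity_rnDeriv (Measure.measurable_rnDeriv ρ volume)
    (map_compl_posSet_mutuallySingular hL hm (derivMeasure (zbar μ))) (by rw [e]; exact hsum), e]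

/-- On `posSet (xbar μ)` the map x̄ is injective, so a measurable T inside it is recovered from its
image. The datum condition μ_ac = u₀'² dx, evaluated on x̄(T), then says that two densities have the
same integral over every such T. -/
theorem InD.ae_deriv_zbar_eq (h₀ : InD u₀ μ) : ∀ᵐ α, α ∈ posSet (xbar μ) →
    deriv (zbar μ) α = deriv (xbar μ) α * deriv u₀ (xbar μ α) ^ 2 := by
  have hL := lipschitzWith_xbar μ
  have hm := monotone_xbar μ
  have hmeas : Measurable (xbar μ) := hL.continuous.measurable
  have hB := measurableSet_posSet (xbar μ)
  have hinj : InjOn (xbar μ) (posSet (xbar μ)) := fun α _ β hβ h => eq_of_mem_posSet hm hβ h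
  have h1 : ∀ᵐ α ∂(volume.restrict (posSet (xbar μ))), ENNReal.ofReal (deriv (zbar μ) α) =
      ENNReal.ofReal (deriv (xbar μ) α * deriv u₀ (xbar μ α) ^ 2) := by
    refine ae_eq_of_forall_setLIntegral_eq_of_sigmaFinite (by fun_prop)
      (((measurable_deriv _).mul (((measurable_deriv _).comp hmeas).pow_const 2)).ennreal_ofReal)
      fun T hT _ => ?_
    rw [Measure.restrict_restrict hT]
    set T' := T ∩ posSet (xbar μ) with hT'
    have hT'm : MeasurableSet T' := hT.inter hB
    set S := xbar μ '' T' with hS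
    have hSm : MeasurableSet S :=
      hT'm.image_of_measurable_injOn hmeas (hinj.mono inter_subset_right)
    have e : xbar μ ⁻¹' S ∩ posSet (xbar μ) = T' := by
      ext α
      constructor
      · rintro ⟨⟨β, hβ, hβα⟩, hα⟩
        have : β = α := hinj hβ.2 hα hβα
        exact this ▸ hβ
      · exact fun hα => ⟨⟨α, hα, rfl⟩, hα.2⟩
    have h2 : acPart (μ : Measure ℝ) S = ∫⁻ α in T', ENNReal.ofReal (deriv (zbar μ) α) := by
      rw [acPart_eq_map_posSet, Measure.map_apply hmeas hSm, Measure.restrict_apply (hmeas hSm),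
        e, derivMeasure, withDensity_apply _ hT'm]
    rw [← h2, h₀.acPart_eq, sqMeasure, withDensity_apply _ hSm,
      lintegral_image_eq_lintegral_deriv_mul_of_monotoneOn hT'm (f' := deriv (xbar μ))
      (fun x hx => by
        obtain ⟨d, hd, h⟩ := hx.2
        rw [h.deriv]; exact h.hasDerivWithinAt) (hm.monotoneOn _)]
    refine setLIntegral_congr_fun hT'm fun α _ => ?_
    rw [ENNReal.ofReal_mul (deriv_nonneg_of_monotone hm α)]
  rw [ae_restrict_iff' hB] at h1
  filter_upwards [h1] with α h2 h3
  have := h2 h3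
  rwa [ENNReal.ofReal_eq_ofReal_iff (deriv_nonneg_of_monotone (monotone_zbar μ) α)
    (mul_nonneg (deriv_nonneg_of_monotone hm α) (sq_nonneg _))] at this

theorem InD.ae_hasDerivAt_comp (h₀ : InD u₀ μ) : ∀ᵐ α, α ∈ posSet (xbar μ) →
    HasDerivAt (fun α => u₀ (xbar μ α)) (deriv u₀ (xbar μ α) * deriv (xbar μ) α) α := by
  have hL := lipschitzWith_xbar μ
  filter_upwards [null_preimage_inter_posSet hL (monotone_xbar μ) (surjective_xbar μ)
    (ae_differentiableAt_of_absolutelyContinuous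
      h₀.energyBound.globallyAC.absolutelyContinuousOnInterval)] with α h1 h2
  have h3 := (h1 h2).hasDerivAt
  obtain ⟨d, hd, h4⟩ := h2
  rw [h4.deriv]
  exact HasDerivAt.comp α h3 h4

theorem InD.lagChart (h₀ : InD u₀ μ) :
    LagChart (xbar μ) (fun α => u₀ (xbar μ α)) (zbar μ) ((μ : Measure ℝ).real univ) := by
  have hL := lipschitzWith_xbar μ
  refine ⟨monotone_xbar μ, monotone_zbar μ, ⟨1, hL⟩, lipschitzWith_zbar μ, surjective_xbar μ,
    h₀.sq_le, tendsto_zbar_atBot μ, tendsto_zbar_atTop μ, ?_⟩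
  filter_upwards [h₀.ae_deriv_zbar_eq, h₀.ae_hasDerivAt_comp,
    ae_mem_posSet_or_zeroSet hL (monotone_xbar μ),
    (lipschitzWith_zbar μ).ae_differentiableAt] with α h1 h2 h3 h4
  rcases h3 with h3 | h3
  · rw [(h2 h3).deriv, h1 h3]; ring
  · have h5 : deriv (xbar μ) α = 0 := HasDerivAt.deriv h3
    rw [h5, zero_mul]
    -- Where x̄' = 0, the increment inequality passes to derivatives and forces V' = 0. If V is not
    -- differentiable, `deriv` takes its default value 0 and the identity still holds.
    by_cases hd : DifferentiableAt ℝ (fun α => u₀ (xbar μ α)) α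
    · have := sq_deriv_le h₀.sq_le hd.hasDerivAt h3 h4.hasDerivAt
      rw [zero_mul] at this
      exact le_antisymm this (sq_nonneg _)
    · rw [deriv_zero_of_not_differentiableAt hd]; ring

end datum

end HunterSaxton

namespace HunterSaxton

/-! ### Evolution of a chart along free-fall characteristics -/

theorem LagChart.tendsto_y_atBot {y V Z : ℝ → ℝ} {M : ℝ} (h : LagChart y V Z M) :
    Tendsto y atBot atBot :=
  h.mono_y.tendsto_atBot_atBot fun b => (h.surj_y b).imp fun _ h => h.le

theorem LagChart.tendsto_y_atTop {y V Z : ℝ → ℝ} {M : ℝ} (h : LagChart y V Z M) :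
    Tendsto y atTop atTop :=
  h.mono_y.tendsto_atTop_atTop fun b => (h.surj_y b).imp fun _ h => h.ge

theorem lipschitzWith_const_mul {f : ℝ → ℝ} {K : ℝ≥0} (hf : LipschitzWith K f) (c : ℝ) :
    LipschitzWith (‖c‖₊ * K) fun x => c * f x := by
  refine LipschitzWith.of_dist_le_mul fun x z => ?_
  rw [Real.dist_eq, ← mul_sub, abs_mul, NNReal.coe_mul, coe_nnnorm, Real.norm_eq_abs, mul_assoc]
  exact mul_le_mul_of_nonneg_left (hf.dist_le_mul x z) (abs_nonneg c)

/-- The heart of the existence proof: the cross terms in (Δy + t ΔV + t²/4 ΔZ) ΔZ - (ΔV + t/2 ΔZ)²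
cancel and leave Δy ΔZ - (ΔV)². The same cancellation preserves the differential identity. The bound
on V keeps the new position within bounded distance of y, hence surjective. -/
theorem LagChart.evolve {y V Z : ℝ → ℝ} {M : ℝ} (h : LagChart y V Z M) {C : ℝ}
    (hC : ∀ α, |V α| ≤ C) (t : ℝ) :
    LagChart (fun α => y α + V α * t + t ^ 2 / 4 * Z α) (fun α => V α + t / 2 * Z α) Z M := by
  obtain ⟨K, hK⟩ := h.lip_y
  obtain ⟨K', hK'⟩ := h.lip_V
  have hlip : ∃ L, LipschitzWith L (fun α => y α + V α * t + t ^ 2 / 4 * Z α) := by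
    simp only [mul_comm (V _) t]
    exact ⟨_, (hK.add (lipschitzWith_const_mul hK' t)).add
      (lipschitzWith_const_mul h.lip_Z (t ^ 2 / 4))⟩
  obtain ⟨L, hL⟩ := hlip
  have hlow : ∀ α, y α + -(C * |t|) ≤ y α + V α * t + t ^ 2 / 4 * Z α := fun α => by
    have h1 : |V α * t| ≤ C * |t| := by
      rw [abs_mul]; exact mul_le_mul_of_nonneg_right (hC α) (abs_nonneg t)
    have h2 := neg_le_of_abs_le h1
    have h3 : 0 ≤ t ^ 2 / 4 * Z α := mul_nonneg (by positivity) (h.Z_nonneg α)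
    linarith
  have hup : ∀ α, y α + V α * t + t ^ 2 / 4 * Z α ≤ y α + (C * |t| + t ^ 2 / 4 * M) := fun α => by
    have h1 : |V α * t| ≤ C * |t| := by
      rw [abs_mul]; exact mul_le_mul_of_nonneg_right (hC α) (abs_nonneg t)
    have h2 := le_of_abs_le h1
    have h3 : t ^ 2 / 4 * Z α ≤ t ^ 2 / 4 * M :=
      mul_le_mul_of_nonneg_left (h.Z_le α) (by positivity)
    linarith
  refine ⟨?_, h.mono_Z, ⟨L, hL⟩, h.lip_Z, ?_, ?_, h.Z_bot, h.Z_top, ?_⟩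
  · intro a b hab
    have hy := sub_nonneg.2 (h.mono_y hab)
    have hZ := sub_nonneg.2 (h.mono_Z hab)
    have h1 := h.sq_le a b
    -- Arithmetic-geometric mean: |t ΔV| ≤ 2 √(Δy · t²/4 ΔZ) ≤ Δy + t²/4 ΔZ. This is why
    -- characteristics never cross.
    have h2 : |t * (V b - V a)| ≤ (y b - y a) + t ^ 2 / 4 * (Z b - Z a) := by
      refine abs_le_of_sq_le_sq ?_ (by positivity)
      have h3 : t ^ 2 * (V b - V a) ^ 2 ≤ t ^ 2 * ((y b - y a) * (Z b - Z a)) :=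
        mul_le_mul_of_nonneg_left h1 (sq_nonneg t)
      nlinarith [sq_nonneg ((y b - y a) - t ^ 2 / 4 * (Z b - Z a))]
    have h3 := neg_le_of_abs_le h2
    change y a + V a * t + t ^ 2 / 4 * Z a ≤ y b + V b * t + t ^ 2 / 4 * Z b
    nlinarith
  · refine hL.continuous.surjective ?_ ?_
    · exact tendsto_atTop_mono hlow (tendsto_atTop_add_const_right _ _ h.tendsto_y_atTop)
    · exact tendsto_atBot_mono hup (tendsto_atBot_add_const_right _ _ h.tendsto_y_atBot)
  · intro a b
    have h1 := h.sq_le a b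
    nlinarith
  · filter_upwards [h.ae_eq, hK.ae_differentiableAt, hK'.ae_differentiableAt,
      h.lip_Z.ae_differentiableAt] with α h1 h2 h3 h4
    have d1 : HasDerivAt (fun α => y α + V α * t + t ^ 2 / 4 * Z α)
        (deriv y α + deriv V α * t + t ^ 2 / 4 * deriv Z α) α :=
      (h2.hasDerivAt.add (h3.hasDerivAt.mul_const t)).add (h4.hasDerivAt.const_mul _)
    have d2 : HasDerivAt (fun α => V α + t / 2 * Z α) (deriv V α + t / 2 * deriv Z α) α :=
      h3.hasDerivAt.add (h4.hasDerivAt.const_mul _)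
    rw [d1.deriv, d2.deriv]
    linear_combination h1

/-! ### The explicit solution -/

variable {u₀ : ℝ →ᵇ ℝ} {μ₀ : FiniteMeasure ℝ}

/-- The velocity along the characteristics. -/
noncomputable def lagVel (u₀ : ℝ →ᵇ ℝ) (μ₀ : FiniteMeasure ℝ) (t α : ℝ) : ℝ :=
  u₀ (xbar μ₀ α) + t / 2 * zbar μ₀ α

theorem charY_eq (t α : ℝ) : charY u₀ μ₀ t α =
    xbar μ₀ α + u₀ (xbar μ₀ α) * t + t ^ 2 / 4 * zbar μ₀ α := rfl

theorem InD.chart (h₀ : InD u₀ μ₀) (t : ℝ) :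
    LagChart (charY u₀ μ₀ t) (lagVel u₀ μ₀ t) (zbar μ₀) ((μ₀ : Measure ℝ).real univ) :=
  h₀.lagChart.evolve (fun α => u₀.norm_coe_le_norm (xbar μ₀ α)) t

theorem abs_zbar_le (α : ℝ) : |zbar μ₀ α| ≤ (μ₀ : Measure ℝ).real univ := by
  rw [abs_of_nonneg ((monotone_zbar μ₀).le_of_tendsto (tendsto_zbar_atBot μ₀) α)]
  exact (monotone_zbar μ₀).ge_of_tendsto (tendsto_zbar_atTop μ₀) α

theorem abs_lagVel_le (t α : ℝ) :
    |lagVel u₀ μ₀ t α| ≤ ‖u₀‖ + |t| / 2 * (μ₀ : Measure ℝ).real univ := by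
  refine (abs_add_le _ _).trans (add_le_add (u₀.norm_coe_le_norm _) ?_)
  rw [abs_mul, abs_div, abs_two]
  exact mul_le_mul_of_nonneg_left (abs_zbar_le α) (by positivity)

/-- The velocity field of the explicit solution. -/
noncomputable def InD.vel (h₀ : InD u₀ μ₀) (t : ℝ) : ℝ →ᵇ ℝ :=
  BoundedContinuousFunction.ofNormedAddCommGroup (eulVel (charY u₀ μ₀ t) (lagVel u₀ μ₀ t))
    (h₀.chart t).continuous_eulVel _ fun _ => abs_lagVel_le t _

/-- The energy of the explicit solution. -/
noncomputable def InD.energy (h₀ : InD u₀ μ₀) (t : ℝ) : FiniteMeasure ℝ :=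
  ⟨eulEnergy (charY u₀ μ₀ t) (zbar μ₀), (h₀.chart t).isFiniteMeasure_eulEnergy⟩

theorem InD.coe_vel (h₀ : InD u₀ μ₀) (t : ℝ) :
    ⇑(h₀.vel t) = eulVel (charY u₀ μ₀ t) (lagVel u₀ μ₀ t) := rfl

theorem InD.coe_energy (h₀ : InD u₀ μ₀) (t : ℝ) :
    (h₀.energy t : Measure ℝ) = eulEnergy (charY u₀ μ₀ t) (zbar μ₀) := rfl

theorem InD.vel_charY (h₀ : InD u₀ μ₀) (t α : ℝ) :
    h₀.vel t (charY u₀ μ₀ t α) = lagVel u₀ μ₀ t α := (h₀.chart t).eulVel_apply α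

theorem charY_zero : charY u₀ μ₀ 0 = xbar μ₀ := by
  funext α; simp [charY]

theorem InD.vel_zero (h₀ : InD u₀ μ₀) : h₀.vel 0 = u₀ := by
  ext x
  obtain ⟨α, rfl⟩ := (h₀.chart 0).surj_y x
  rw [h₀.vel_charY, charY_zero, lagVel]
  simp

theorem InD.energy_zero (h₀ : InD u₀ μ₀) : h₀.energy 0 = μ₀ := by
  apply Subtype.ext
  change (h₀.energy 0 : Measure ℝ) = μ₀
  rw [h₀.coe_energy, charY_zero]
  exact map_xbar μ₀

theorem InD.energy_eq_map (h₀ : InD u₀ μ₀) (t : ℝ) :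
    (h₀.energy t : Measure ℝ) = (lagEnergy μ₀).map (charY u₀ μ₀ t) := by
  rw [lagEnergy_eq]; rfl

theorem InD.energy_univ (h₀ : InD u₀ μ₀) (t : ℝ) :
    (h₀.energy t : Measure ℝ) univ = (μ₀ : Measure ℝ) univ := by
  rw [h₀.coe_energy, (h₀.chart t).eulEnergy_univ, ofReal_measureReal]

theorem InD.energy_real_univ (h₀ : InD u₀ μ₀) (t : ℝ) :
    (h₀.energy t : Measure ℝ).real univ = (μ₀ : Measure ℝ).real univ := by
  rw [measureReal_def, h₀.energy_univ, measureReal_def]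

theorem InD.energyBound_vel (h₀ : InD u₀ μ₀) (t : ℝ) :
    EnergyBound (h₀.vel t) (h₀.energy t : Measure ℝ) := (h₀.chart t).energyBound

theorem abs_charY_sub_le (t s α : ℝ) : |charY u₀ μ₀ t α - charY u₀ μ₀ s α| ≤
    |t - s| * (‖u₀‖ + |t + s| / 4 * (μ₀ : Measure ℝ).real univ) := by
  have e : charY u₀ μ₀ t α - charY u₀ μ₀ s α =
      (t - s) * (u₀ (xbar μ₀ α) + (t + s) / 4 * zbar μ₀ α) := by
    rw [charY_eq, charY_eq]; ring
  rw [e, abs_mul]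
  refine mul_le_mul_of_nonneg_left ?_ (abs_nonneg _)
  refine (abs_add_le _ _).trans (add_le_add (u₀.norm_coe_le_norm _) ?_)
  rw [abs_mul, abs_div, abs_of_pos (show (0:ℝ) < 4 by norm_num)]
  exact mul_le_mul_of_nonneg_left (abs_zbar_le α) (by positivity)

/-- Both velocities are compared at the same label α. There V changes by O(|t - s|), while the
position moves by O(|t - s|), which costs a square root through the spatial Hölder bound. -/
theorem InD.abs_vel_sub_le (h₀ : InD u₀ μ₀) (t s x : ℝ) : |h₀.vel t x - h₀.vel s x| ≤
    |t - s| / 2 * (μ₀ : Measure ℝ).real univ + √((μ₀ : Measure ℝ).real univ) *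
      √(|t - s| * (‖u₀‖ + |t + s| / 4 * (μ₀ : Measure ℝ).real univ)) := by
  obtain ⟨α, rfl⟩ := (h₀.chart t).surj_y x
  have h1 := (h₀.energyBound_vel s).holder (charY u₀ μ₀ t α) (charY u₀ μ₀ s α)
  rw [h₀.energy_real_univ, h₀.vel_charY, abs_sub_comm (charY u₀ μ₀ s α)] at h1
  have h2 := Real.sqrt_le_sqrt (abs_charY_sub_le (u₀ := u₀) (μ₀ := μ₀) t s α)
  have h3 : |lagVel u₀ μ₀ t α - lagVel u₀ μ₀ s α| ≤
      |t - s| / 2 * (μ₀ : Measure ℝ).real univ := by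
    have e : lagVel u₀ μ₀ t α - lagVel u₀ μ₀ s α = (t - s) / 2 * zbar μ₀ α := by
      unfold lagVel; ring
    rw [e, abs_mul, abs_div, abs_two]
    exact mul_le_mul_of_nonneg_left (abs_zbar_le α) (by positivity)
  rw [h₀.vel_charY]
  calc _ ≤ |lagVel u₀ μ₀ t α - lagVel u₀ μ₀ s α| +
        |lagVel u₀ μ₀ s α - h₀.vel s (charY u₀ μ₀ t α)| := abs_sub_le _ _ _
    _ ≤ _ := add_le_add h3 (h1.trans (mul_le_mul_of_nonneg_left h2 (Real.sqrt_nonneg _)))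

theorem InD.continuous_vel (h₀ : InD u₀ μ₀) : Continuous h₀.vel := by
  refine continuous_iff_continuousAt.2 fun s => ?_
  rw [ContinuousAt, tendsto_iff_dist_tendsto_zero]
  have hc : Continuous fun t : ℝ => |t - s| / 2 * (μ₀ : Measure ℝ).real univ +
      √((μ₀ : Measure ℝ).real univ) *
      √(|t - s| * (‖u₀‖ + |t + s| / 4 * (μ₀ : Measure ℝ).real univ)) := by fun_prop
  have hc0 := hc.tendsto s
  rw [sub_self, abs_zero, zero_mul, Real.sqrt_zero, mul_zero, zero_div, zero_mul, add_zero] at hc0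
  refine squeeze_zero (fun _ => dist_nonneg) (fun t => ?_) hc0
  refine (BoundedContinuousFunction.dist_le (by positivity)).2 fun x => ?_
  rw [Real.dist_eq]
  exact h₀.abs_vel_sub_le t s x

theorem InD.locHolderHalf (h₀ : InD u₀ μ₀) : LocHolderHalf h₀.vel := by
  intro R
  set M := (μ₀ : Measure ℝ).real univ with hM
  have hM0 : 0 ≤ M := measureReal_nonneg
  set L := ‖u₀‖ + |R| / 2 * M with hL
  have hL0 : 0 ≤ L := by positivity
  -- The three terms are the Hölder constant in space, the change of V at a fixed label, and the
  -- displacement of the label. L bounds the mean speed because |t + s| ≤ 2R.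
  set C := √M + (√(2 * |R|) / 2 * M + √M * √L) with hC
  have hC0 : 0 ≤ C := by positivity
  refine ⟨NNReal.mk C hC0, fun p hp q hq => ?_⟩
  have key : dist (h₀.vel p.2 p.1) (h₀.vel q.2 q.1) ≤ C * √(dist p q) := by
    have hp2 : |p.2| ≤ R := by
      have := (Metric.mem_closedBall.1 hp)
      rw [dist_zero_right] at this
      exact (norm_snd_le p).trans this
    have hq2 : |q.2| ≤ R := by
      have := (Metric.mem_closedBall.1 hq)
      rw [dist_zero_right] at this
      exact (norm_snd_le q).trans this
    have hR := abs_of_nonneg ((abs_nonneg _).trans hp2)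
    have h1 : |p.1 - q.1| ≤ dist p q := le_max_left (dist p.1 q.1) (dist p.2 q.2)
    have h2 : |p.2 - q.2| ≤ dist p q := le_max_right (dist p.1 q.1) (dist p.2 q.2)
    have h3 := (h₀.energyBound_vel q.2).holder q.1 p.1
    rw [h₀.energy_real_univ] at h3
    have h4 := h₀.abs_vel_sub_le p.2 q.2 p.1
    have s1 := Real.sqrt_le_sqrt h1
    have s2 := Real.sqrt_le_sqrt h2
    have h5 : |p.2 - q.2| ≤ √(2 * |R|) * √(dist p q) := by
      have e : |p.2 - q.2| = √|p.2 - q.2| * √|p.2 - q.2| :=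
        (Real.mul_self_sqrt (abs_nonneg _)).symm
      have : |p.2 - q.2| ≤ 2 * |R| := by
        rw [hR]; exact (abs_sub _ _).trans (by linarith)
      rw [e]
      exact mul_le_mul (Real.sqrt_le_sqrt this) s2 (Real.sqrt_nonneg _) (Real.sqrt_nonneg _)
    have h6 : √(|p.2 - q.2| * (‖u₀‖ + |p.2 + q.2| / 4 * M)) ≤ √L * √(dist p q) := by
      rw [← Real.sqrt_mul hL0, mul_comm L]
      refine Real.sqrt_le_sqrt (mul_le_mul h2 ?_ (by positivity) dist_nonneg)
      have : |p.2 + q.2| ≤ 2 * |R| := by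
        rw [hR]; exact (abs_add_le _ _).trans (by linarith)
      have := mul_le_mul_of_nonneg_right this hM0
      rw [hL]
      linarith
    rw [Real.dist_eq]
    calc _ ≤ |h₀.vel p.2 p.1 - h₀.vel q.2 p.1| + |h₀.vel q.2 p.1 - h₀.vel q.2 q.1| :=
          abs_sub_le _ _ _
      _ ≤ (√(2 * |R|) * √(dist p q) / 2 * M + √M * (√L * √(dist p q))) + √M * √(dist p q) := by
          refine add_le_add (h4.trans (add_le_add ?_ ?_)) (h3.trans ?_)
          · gcongr
          · gcongr
          · gcongr
      _ = C * √(dist p q) := by rw [hC]; ring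
  rw [edist_dist, edist_dist, ENNReal.ofReal_rpow_of_nonneg dist_nonneg (by positivity)]
  have e : ((NNReal.mk C hC0 : ℝ≥0) : ℝ≥0∞) = ENNReal.ofReal C := by
    rw [ENNReal.ofReal, Real.toNNReal_of_nonneg hC0]
  rw [e, ← ENNReal.ofReal_mul hC0]
  refine ENNReal.ofReal_le_ofReal (key.trans (le_of_eq ?_))
  rw [Real.sqrt_eq_rpow]; norm_num

theorem InD.isFiniteMeasure_derivMeasure (h₀ : InD u₀ μ₀) :
    IsFiniteMeasure (derivMeasure (zbar μ₀)) := (h₀.chart 0).isFiniteMeasure_derivMeasure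

theorem continuous_charY : Continuous fun p : ℝ × ℝ => charY u₀ μ₀ p.1 p.2 := by
  have h1 := (lipschitzWith_xbar μ₀).continuous
  have h2 := (lipschitzWith_zbar μ₀).continuous
  have h3 := u₀.continuous
  simp only [charY_eq]
  fun_prop

theorem continuous_lagVel : Continuous fun p : ℝ × ℝ => lagVel u₀ μ₀ p.1 p.2 := by
  have h1 := (lipschitzWith_xbar μ₀).continuous
  have h2 := (lipschitzWith_zbar μ₀).continuous
  have h3 := u₀.continuous
  simp only [lagVel]
  fun_prop

theorem InD.integral_energy (h₀ : InD u₀ μ₀) (t : ℝ) {φ : ℝ → ℝ} (hφ : Continuous φ) :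
    ∫ x, φ x ∂(h₀.energy t : Measure ℝ) = ∫ α, φ (charY u₀ μ₀ t α) ∂(derivMeasure (zbar μ₀)) := by
  rw [h₀.coe_energy, eulEnergy, integral_map (h₀.chart t).measurable_y.aemeasurable
    hφ.aestronglyMeasurable]

theorem InD.continuous_energy (h₀ : InD u₀ μ₀) : Continuous h₀.energy := by
  have := h₀.isFiniteMeasure_derivMeasure
  refine continuous_iff_continuousAt.2 fun s => ?_
  rw [ContinuousAt, FiniteMeasure.tendsto_iff_forall_integral_tendsto]
  intro φ
  have hc : Continuous fun t => ∫ α, φ (charY u₀ μ₀ t α) ∂(derivMeasure (zbar μ₀)) := by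
    refine continuous_of_dominated (bound := fun _ => ‖φ‖) (fun t => ?_) (fun t => ?_) ?_ ?_
    · exact (φ.continuous.comp (h₀.chart t).continuous_y).aestronglyMeasurable
    · exact ae_of_all _ fun α => φ.norm_coe_le_norm _
    · exact integrable_const _
    · exact ae_of_all _ fun α => φ.continuous.comp
        (continuous_charY.comp (continuous_id.prodMk continuous_const))
  simp only [h₀.integral_energy _ φ.continuous]
  exact hc.tendsto s

theorem InD.isWeakDeriv_vel (h₀ : InD u₀ μ₀) (t : ℝ) :
    IsWeakDeriv (h₀.vel t) (deriv (h₀.vel t)) := (h₀.chart t).globallyAC_eulVel.isWeakDeriv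

theorem InD.acPart_energy (h₀ : InD u₀ μ₀) (t : ℝ) :
    acPart (h₀.energy t : Measure ℝ) = sqMeasure (deriv (h₀.vel t)) :=
  (h₀.chart t).acPart_eulEnergy

theorem InD.memLp_deriv_vel (h₀ : InD u₀ μ₀) (t : ℝ) : MemLp (deriv (h₀.vel t)) 2 volume :=
  memLp_two_of_acPart_eq (measurable_deriv _).aestronglyMeasurable (h₀.acPart_energy t)

theorem InD.tendsto_vel_atBot (h₀ : InD u₀ μ₀) {l : ℝ} (hl : Tendsto u₀ atBot (𝓝 l)) (t : ℝ) :
    Tendsto (h₀.vel t) atBot (𝓝 l) := by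
  have h1 : Tendsto (lagVel u₀ μ₀ t) atBot (𝓝 (l + t / 2 * 0)) :=
    (hl.comp (tendsto_xbar_atBot μ₀)).add ((tendsto_zbar_atBot μ₀).const_mul _)
  rw [mul_zero, add_zero] at h1
  have hm := (h₀.chart t).mono_y
  rw [Metric.tendsto_nhds] at h1 ⊢
  intro ε hε
  obtain ⟨a, ha⟩ := eventually_atBot.1 (h1 ε hε)
  filter_upwards [eventually_lt_atBot (charY u₀ μ₀ t a)] with x hx
  obtain ⟨α, rfl⟩ := (h₀.chart t).surj_y x
  rw [h₀.vel_charY]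
  refine ha α ?_
  by_contra! hcon
  exact absurd (hm hcon.le) (not_le.2 hx)

theorem InD.tendsto_vel_atTop (h₀ : InD u₀ μ₀) {l : ℝ} (hl : Tendsto u₀ atTop (𝓝 l)) (t : ℝ) :
    Tendsto (h₀.vel t) atTop (𝓝 (l + 1 / 2 * (μ₀ : Measure ℝ).real univ * t)) := by
  have h1 : Tendsto (lagVel u₀ μ₀ t) atTop (𝓝 (l + t / 2 * (μ₀ : Measure ℝ).real univ)) :=
    (hl.comp (tendsto_xbar_atTop μ₀)).add ((tendsto_zbar_atTop μ₀).const_mul _)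
  rw [show l + t / 2 * (μ₀ : Measure ℝ).real univ = l + 1 / 2 * (μ₀ : Measure ℝ).real univ * t
    by ring] at h1
  have hm := (h₀.chart t).mono_y
  rw [Metric.tendsto_nhds] at h1 ⊢
  intro ε hε
  obtain ⟨a, ha⟩ := eventually_atTop.1 (h1 ε hε)
  filter_upwards [eventually_gt_atTop (charY u₀ μ₀ t a)] with x hx
  obtain ⟨α, rfl⟩ := (h₀.chart t).surj_y x
  rw [h₀.vel_charY]
  refine ha α ?_
  by_contra! hcon
  exact absurd (hm hcon.le) (not_le.2 hx)

end HunterSaxton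

namespace HunterSaxton

/-! ### Test functions of two variables -/

namespace IsTestFun

variable {φ : ℝ × ℝ → ℝ} (hφ : IsTestFun φ)
include hφ

theorem continuous : Continuous φ := hφ.1.continuous

theorem differentiable : Differentiable ℝ φ := hφ.1.differentiable (by simp)

theorem hasDerivAt_fst (x t : ℝ) : HasDerivAt (fun z => φ (z, t)) (fderiv ℝ φ (x, t) (1, 0)) x :=
  (hφ.differentiable (x, t)).hasFDerivAt.comp_hasDerivAt x
    ((hasDerivAt_id x).prodMk (hasDerivAt_const x t))

theorem hasDerivAt_snd (x t : ℝ) : HasDerivAt (fun s => φ (x, s)) (fderiv ℝ φ (x, t) (0, 1)) t :=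
  (hφ.differentiable (x, t)).hasFDerivAt.comp_hasDerivAt t
    ((hasDerivAt_const t x).prodMk (hasDerivAt_id t))

theorem dX_eq (x t : ℝ) : dX φ x t = fderiv ℝ φ (x, t) (1, 0) := (hφ.hasDerivAt_fst x t).deriv

theorem dT_eq (x t : ℝ) : dT φ x t = fderiv ℝ φ (x, t) (0, 1) := (hφ.hasDerivAt_snd x t).deriv

theorem hasDerivAt_dX (x t : ℝ) : HasDerivAt (fun z => φ (z, t)) (dX φ x t) x := by
  rw [hφ.dX_eq]; exact hφ.hasDerivAt_fst x t

theorem hasDerivAt_curve {q : ℝ → ℝ} {q' t : ℝ} (hq : HasDerivAt q q' t) :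
    HasDerivAt (fun s => φ (q s, s)) (dX φ (q t) t * q' + dT φ (q t) t) t := by
  have h := HasFDerivAt.comp_hasDerivAt (f := fun s => (q s, s)) t
    (hφ.differentiable (q t, t)).hasFDerivAt (hq.prodMk (hasDerivAt_id t))
  have e : ((q', (1:ℝ)) : ℝ × ℝ) = q' • ((1:ℝ), (0:ℝ)) + ((0:ℝ), (1:ℝ)) := by simp
  rw [e, map_add, map_smul, ← hφ.dX_eq, ← hφ.dT_eq, smul_eq_mul, mul_comm] at h
  exact h

theorem continuous_dX : Continuous fun p : ℝ × ℝ => dX φ p.1 p.2 := by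
  simp only [hφ.dX_eq]
  exact (hφ.1.continuous_fderiv (by simp)).clm_apply continuous_const

theorem continuous_dT : Continuous fun p : ℝ × ℝ => dT φ p.1 p.2 := by
  simp only [hφ.dT_eq]
  exact (hφ.1.continuous_fderiv (by simp)).clm_apply continuous_const

theorem exists_bound : ∃ R > 0, ∃ C, 0 ≤ C ∧
    (∀ x t, |φ (x, t)| ≤ C ∧ |dX φ x t| ≤ C ∧ |dT φ x t| ≤ C) ∧
    (∀ x t, ¬ (|x| ≤ R ∧ |t| ≤ R) → φ (x, t) = 0 ∧ dX φ x t = 0 ∧ dT φ x t = 0) := by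
  have hs := hφ.2
  obtain ⟨R, hR, hsub⟩ := hs.isCompact.isBounded.subset_closedBall_lt 0 0
  obtain ⟨C₁, hC₁⟩ := hs.exists_bound_of_continuous hφ.continuous
  obtain ⟨C₂, hC₂⟩ := (hs.fderiv (𝕜 := ℝ)).exists_bound_of_continuous
    (hφ.1.continuous_fderiv (by simp))
  have n1 : ‖((1:ℝ), (0:ℝ))‖ = 1 := by simp [Prod.norm_def]
  have n2 : ‖((0:ℝ), (1:ℝ))‖ = 1 := by simp [Prod.norm_def]
  refine ⟨R, hR, max C₁ C₂, ?_, fun x t => ⟨?_, ?_, ?_⟩, fun x t h => ?_⟩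
  · exact (norm_nonneg _).trans ((hC₁ (0, 0)).trans (le_max_left _ _))
  · exact (hC₁ (x, t)).trans (le_max_left _ _)
  · rw [hφ.dX_eq]
    have := (fderiv ℝ φ (x, t)).le_opNorm (1, 0)
    rw [n1, mul_one] at this
    exact this.trans ((hC₂ (x, t)).trans (le_max_right _ _))
  · rw [hφ.dT_eq]
    have := (fderiv ℝ φ (x, t)).le_opNorm (0, 1)
    rw [n2, mul_one] at this
    exact this.trans ((hC₂ (x, t)).trans (le_max_right _ _))
  · have hout : (x, t) ∉ tsupport φ := fun hm => h <| by
      have := hsub hm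
      rw [Metric.mem_closedBall, dist_zero_right] at this
      exact ⟨(norm_fst_le (x, t)).trans this, (norm_snd_le (x, t)).trans this⟩
    have hf : fderiv ℝ φ (x, t) = 0 := by
      by_contra hne
      exact hout (support_fderiv_subset ℝ hne)
    rw [hφ.dX_eq, hφ.dT_eq, hf]
    exact ⟨image_eq_zero_of_notMem_tsupport hout, rfl, rfl⟩

theorem slice (t : ℝ) : ContDiff ℝ ∞ (fun x => φ (x, t)) ∧ HasCompactSupport (fun x => φ (x, t)) := by
  obtain ⟨R, hR, C, hC, h1, h2⟩ := hφ.exists_bound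
  refine ⟨hφ.1.comp (contDiff_id.prodMk contDiff_const), ?_⟩
  refine HasCompactSupport.of_support_subset_isCompact (isCompact_Icc (a := -R) (b := R)) ?_
  intro x hx
  by_contra hcon
  exact hx (h2 x t fun h3 => hcon (abs_le.1 h3.1)).1

end IsTestFun

theorem integrable_of_bounded_of_support {m : Measure (ℝ × ℝ)} {f : ℝ × ℝ → ℝ}
    (hf : AEStronglyMeasurable f m) {C : ℝ} (hC : ∀ p, |f p| ≤ C) {s : Set (ℝ × ℝ)}
    (hs : m s ≠ ⊤) (h0 : ∀ p, p ∉ s → f p = 0) : Integrable f m := by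
  have h1 : IntegrableOn f s m :=
    Measure.integrableOn_of_bounded hs hf (ae_of_all _ hC)
  exact (integrableOn_iff_integrable_of_support_subset fun p hp => by
    by_contra hcon; exact hp (h0 p hcon)).1 h1

/-! ### The energy equation in labels -/

variable {u₀ : ℝ →ᵇ ℝ} {μ₀ : FiniteMeasure ℝ}

theorem hasDerivAt_charY_time (t α : ℝ) :
    HasDerivAt (fun s => charY u₀ μ₀ s α) (lagVel u₀ μ₀ t α) t := by
  simp only [charY_eq]
  have h := (((hasDerivAt_id t).const_mul (u₀ (xbar μ₀ α))).const_add (xbar μ₀ α)).add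
    (((hasDerivAt_pow 2 t).div_const 4).mul_const (zbar μ₀ α))
  refine h.congr_deriv ?_
  unfold lagVel
  rw [show (2 : ℕ) - 1 = 1 from rfl]
  push_cast
  ring

theorem hasDerivAt_lagVel_time (t α : ℝ) :
    HasDerivAt (fun s => lagVel u₀ μ₀ s α) (1 / 2 * zbar μ₀ α) t := by
  unfold lagVel
  have h := (((hasDerivAt_id t).div_const 2).mul_const (zbar μ₀ α)).const_add (u₀ (xbar μ₀ α))
  exact h

theorem integral_eq_zero_of_hasDerivAt_of_support {f f' : ℝ → ℝ} (hd : ∀ t, HasDerivAt f (f' t) t)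
    (hc : Continuous f') {R : ℝ} (h0 : ∀ t, ¬ |t| ≤ R → f t = 0) : ∫ t, f' t = 0 := by
  have hs : HasCompactSupport f :=
    HasCompactSupport.of_support_subset_isCompact (isCompact_Icc (a := -R) (b := R)) fun x hx => by
      by_contra hcon; exact hx (h0 x fun h => hcon (abs_le.1 h))
  have e : f' = deriv f := funext fun t => (hd t).deriv.symm
  have hs' : HasCompactSupport f' := e ▸ hs.deriv
  exact integral_eq_zero_of_hasDerivAt_of_integrable hd
    (hc.integrable_of_hasCompactSupport hs')
    ((continuous_iff_continuousAt.2 fun t => (hd t).continuousAt).integrable_of_hasCompactSupport hs)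

/-- Pulled back to labels, the integrand is d/dt of φ(y(α, t), t), and the energy Z_α dα is
independent of t. Fubini reduces the claim to ∫ d/dt = 0 for each α. -/
theorem InD.energy_equation (h₀ : InD u₀ μ₀) {φ : ℝ × ℝ → ℝ} (hφ : IsTestFun φ) :
    ∫ t, ∫ x, (dT φ x t + h₀.vel t x * dX φ x t) ∂(h₀.energy t : Measure ℝ) = 0 := by
  have := h₀.isFiniteMeasure_derivMeasure
  obtain ⟨R, hR, C, hC, hb, hs⟩ := hφ.exists_bound
  set k : ℝ → ℝ → ℝ := fun t α => dX φ (charY u₀ μ₀ t α) t * lagVel u₀ μ₀ t α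
    + dT φ (charY u₀ μ₀ t α) t with hk
  have hkc : Continuous (Function.uncurry k) := by
    have h1 := hφ.continuous_dX.comp ((continuous_charY (u₀ := u₀) (μ₀ := μ₀)).prodMk continuous_fst)
    have h2 := hφ.continuous_dT.comp ((continuous_charY (u₀ := u₀) (μ₀ := μ₀)).prodMk continuous_fst)
    exact (h1.mul continuous_lagVel).add h2
  have e1 : ∀ t, ∫ x, (dT φ x t + h₀.vel t x * dX φ x t) ∂(h₀.energy t : Measure ℝ) =
      ∫ α, k t α ∂(derivMeasure (zbar μ₀)) := fun t => by
    rw [h₀.integral_energy t]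
    · congr 1; funext α
      rw [h₀.vel_charY]; simp only [hk]; ring
    · exact (hφ.continuous_dT.comp (continuous_id.prodMk continuous_const)).add
        ((h₀.vel t).continuous.mul (hφ.continuous_dX.comp (continuous_id.prodMk continuous_const)))
  simp only [e1]
  have hbound : ∀ p : ℝ × ℝ, |Function.uncurry k p| ≤
      C * (‖u₀‖ + R / 2 * (μ₀ : Measure ℝ).real univ) + C := by
    rintro ⟨t, α⟩
    simp only [Function.uncurry, hk]
    have hM : 0 ≤ (μ₀ : Measure ℝ).real univ := measureReal_nonneg
    by_cases ht : |t| ≤ R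
    · refine (abs_add_le _ _).trans (add_le_add ?_ (hb _ _).2.2)
      rw [abs_mul]
      refine mul_le_mul (hb _ _).2.1 ((abs_lagVel_le t α).trans ?_) (abs_nonneg _) hC
      gcongr
    · obtain ⟨-, h1, h2⟩ := hs (charY u₀ μ₀ t α) t (fun h => ht h.2)
      rw [h1, h2]; simp; positivity
  rw [integral_integral_swap (f := k)]
  · have : ∀ α, ∫ t, k t α = 0 := fun α => by
      refine integral_eq_zero_of_hasDerivAt_of_support
        (fun t => hφ.hasDerivAt_curve (hasDerivAt_charY_time t α)) ?_ (R := R) ?_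
      · exact hkc.comp (continuous_id.prodMk continuous_const)
      · intro t ht
        exact (hs _ _ fun h => ht h.2).1
    simp [this]
  · refine integrable_of_bounded_of_support hkc.aestronglyMeasurable hbound
      (m := volume.prod (derivMeasure (zbar μ₀))) (s := Icc (-R) R ×ˢ univ) ?_ ?_
    · rw [Measure.prod_prod]
      exact ENNReal.mul_ne_top (by simp) (measure_ne_top _ _)
    · rintro ⟨t, α⟩ hp
      have ht : ¬ |t| ≤ R := fun h => hp ⟨abs_le.1 h, mem_univ _⟩
      obtain ⟨-, h1, h2⟩ := hs (charY u₀ μ₀ t α) t (fun h => ht h.2)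
      simp only [Function.uncurry, hk, h1, h2]; ring

end HunterSaxton

namespace HunterSaxton

variable {u₀ : ℝ →ᵇ ℝ} {μ₀ : FiniteMeasure ℝ}

/-! ### The momentum equation -/

theorem measurable_real_Iic (m : Measure ℝ) [IsFiniteMeasure m] :
    Measurable fun x => m.real (Iic x) :=
  Monotone.measurable fun _ _ h => measureReal_mono (Iic_subset_Iic.2 h)

/-- The derivative with respect to the label of the characteristics. -/
noncomputable def charJac (u₀ : ℝ →ᵇ ℝ) (μ₀ : FiniteMeasure ℝ) (t α : ℝ) : ℝ :=
  deriv (xbar μ₀) α + deriv (fun α => u₀ (xbar μ₀ α)) α * t + t ^ 2 / 4 * deriv (zbar μ₀) α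

/-- The derivative with respect to the label of the velocity. -/
noncomputable def velJac (u₀ : ℝ →ᵇ ℝ) (μ₀ : FiniteMeasure ℝ) (t α : ℝ) : ℝ :=
  deriv (fun α => u₀ (xbar μ₀ α)) α + t / 2 * deriv (zbar μ₀) α

theorem InD.ae_hasDerivAt_charY (h₀ : InD u₀ μ₀) : ∀ᵐ α, ∀ t,
    HasDerivAt (charY u₀ μ₀ t) (charJac u₀ μ₀ t α) α ∧
    HasDerivAt (lagVel u₀ μ₀ t) (velJac u₀ μ₀ t α) α := by
  filter_upwards [(lipschitzWith_xbar μ₀).ae_differentiableAt,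
    (lipschitzWith_zbar μ₀).ae_differentiableAt, h₀.lagChart.ae_differentiableAt_V] with α h1 h2 h3 t
  exact ⟨(h1.hasDerivAt.add (h3.hasDerivAt.mul_const t)).add (h2.hasDerivAt.const_mul _),
    h3.hasDerivAt.add (h2.hasDerivAt.const_mul _)⟩

theorem measurable_charJac : Measurable fun p : ℝ × ℝ => charJac u₀ μ₀ p.1 p.2 := by
  have h1 := measurable_deriv (xbar μ₀)
  have h2 := measurable_deriv (zbar μ₀)
  have h3 := measurable_deriv (fun α => u₀ (xbar μ₀ α))
  unfold charJac
  fun_prop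

theorem measurable_velJac : Measurable fun p : ℝ × ℝ => velJac u₀ μ₀ p.1 p.2 := by
  have h2 := measurable_deriv (zbar μ₀)
  have h3 := measurable_deriv (fun α => u₀ (xbar μ₀ α))
  unfold velJac
  fun_prop

theorem InD.exists_bound_jac (h₀ : InD u₀ μ₀) (R : ℝ) : ∃ C, 0 ≤ C ∧ ∀ t α, |t| ≤ R →
    |charJac u₀ μ₀ t α| ≤ C ∧ |velJac u₀ μ₀ t α| ≤ C := by
  obtain ⟨K, hK⟩ := h₀.lagChart.lip_V
  have h1 : ∀ α, |deriv (xbar μ₀) α| ≤ 1 := fun α => by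
    simpa using norm_deriv_le_of_lipschitz (lipschitzWith_xbar μ₀) (x₀ := α)
  have h2 : ∀ α, |deriv (zbar μ₀) α| ≤ 1 := fun α => by
    simpa using norm_deriv_le_of_lipschitz (lipschitzWith_zbar μ₀) (x₀ := α)
  have h3 : ∀ α, |deriv (fun α => u₀ (xbar μ₀ α)) α| ≤ K := fun α =>
    norm_deriv_le_of_lipschitz hK (x₀ := α)
  by_cases hR : 0 ≤ R
  swap
  · exact ⟨0, le_rfl, fun t α ht => absurd ((abs_nonneg t).trans ht) hR⟩
  refine ⟨1 + K * R + R ^ 2 / 4 + K + R / 2, by positivity, fun t α ht => ⟨?_, ?_⟩⟩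
  · unfold charJac
    have e1 : |deriv (fun α => u₀ (xbar μ₀ α)) α * t| ≤ K * R := by
      rw [abs_mul]; exact mul_le_mul (h3 α) ht (abs_nonneg _) K.2
    have e2 : |t ^ 2 / 4 * deriv (zbar μ₀) α| ≤ R ^ 2 / 4 * 1 := by
      rw [abs_mul, abs_div, abs_pow, abs_of_pos (show (0:ℝ) < 4 by norm_num)]
      exact mul_le_mul (by gcongr) (h2 α) (abs_nonneg _) (by positivity)
    refine (abs_add_le _ _).trans ((add_le_add ((abs_add_le _ _).trans
      (add_le_add (h1 α) e1)) e2).trans ?_)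
    have : (0:ℝ) ≤ K := K.2
    linarith
  · unfold velJac
    have e2 : |t / 2 * deriv (zbar μ₀) α| ≤ R / 2 * 1 := by
      rw [abs_mul, abs_div, abs_two]
      exact mul_le_mul (by gcongr) (h2 α) (abs_nonneg _) (by positivity)
    refine (abs_add_le _ _).trans ((add_le_add (h3 α) e2).trans ?_)
    have : 0 ≤ (K:ℝ) * R := mul_nonneg K.2 hR
    nlinarith [sq_nonneg R]

/-- The time derivative of the Lagrangian momentum `φ V y_α`. -/
noncomputable def momRate (u₀ : ℝ →ᵇ ℝ) (μ₀ : FiniteMeasure ℝ) (φ : ℝ × ℝ → ℝ) (t α : ℝ) : ℝ :=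
  1 / 2 * zbar μ₀ α * φ (charY u₀ μ₀ t α, t) * charJac u₀ μ₀ t α +
  lagVel u₀ μ₀ t α * (dX φ (charY u₀ μ₀ t α) t * lagVel u₀ μ₀ t α + dT φ (charY u₀ μ₀ t α) t) *
    charJac u₀ μ₀ t α +
  lagVel u₀ μ₀ t α * φ (charY u₀ μ₀ t α, t) * velJac u₀ μ₀ t α

theorem IsTestFun.hasDerivAt_momentum {φ : ℝ × ℝ → ℝ} (hφ : IsTestFun φ) (t α : ℝ) :
    HasDerivAt (fun s => lagVel u₀ μ₀ s α * φ (charY u₀ μ₀ s α, s) * charJac u₀ μ₀ s α)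
      (momRate u₀ μ₀ φ t α) t := by
  have hj : HasDerivAt (fun s => charJac u₀ μ₀ s α) (velJac u₀ μ₀ t α) t := by
    unfold charJac
    have h := (((hasDerivAt_id t).const_mul (deriv (fun α => u₀ (xbar μ₀ α)) α)).const_add
      (deriv (xbar μ₀) α)).add
      (((hasDerivAt_pow 2 t).div_const 4).mul_const (deriv (zbar μ₀) α))
    refine h.congr_deriv ?_
    unfold velJac
    rw [show (2 : ℕ) - 1 = 1 from rfl]
    push_cast
    ring
  refine (((hasDerivAt_lagVel_time t α).mul (hφ.hasDerivAt_curve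
    (hasDerivAt_charY_time t α))).mul hj).congr_deriv ?_
  unfold momRate
  simp only [Pi.mul_apply]
  ring

theorem InD.integrable_momRate (h₀ : InD u₀ μ₀) {φ : ℝ × ℝ → ℝ} (hφ : IsTestFun φ) :
    Integrable (Function.uncurry (momRate u₀ μ₀ φ)) (volume.prod volume) := by
  obtain ⟨R, hR, C, hC, hb, hs⟩ := hφ.exists_bound
  obtain ⟨D, hD, hj⟩ := h₀.exists_bound_jac R
  set M := (μ₀ : Measure ℝ).real univ with hM
  have hM0 : 0 ≤ M := measureReal_nonneg
  have hy := (continuous_charY (u₀ := u₀) (μ₀ := μ₀))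
  have m1 : Measurable fun p : ℝ × ℝ => dX φ (charY u₀ μ₀ p.1 p.2) p.1 :=
    (hφ.continuous_dX.comp (hy.prodMk continuous_fst)).measurable
  have m2 : Measurable fun p : ℝ × ℝ => dT φ (charY u₀ μ₀ p.1 p.2) p.1 :=
    (hφ.continuous_dT.comp (hy.prodMk continuous_fst)).measurable
  have m3 : Measurable fun p : ℝ × ℝ => φ (charY u₀ μ₀ p.1 p.2, p.1) :=
    (hφ.continuous.comp (hy.prodMk continuous_fst)).measurable
  have m4 : Measurable fun p : ℝ × ℝ => lagVel u₀ μ₀ p.1 p.2 := continuous_lagVel.measurable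
  have m5 : Measurable fun p : ℝ × ℝ => zbar μ₀ p.2 :=
    (lipschitzWith_zbar μ₀).continuous.measurable.comp measurable_snd
  have m6 := measurable_charJac (u₀ := u₀) (μ₀ := μ₀)
  have m7 := measurable_velJac (u₀ := u₀) (μ₀ := μ₀)
  have hmeas : Measurable (Function.uncurry (momRate u₀ μ₀ φ)) := by
    change Measurable fun p : ℝ × ℝ => momRate u₀ μ₀ φ p.1 p.2
    exact ((((m5.const_mul _).mul m3).mul m6).add
      ((m4.mul ((m1.mul m4).add m2)).mul m6)).add ((m4.mul m3).mul m7)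
  set L := ‖u₀‖ + R / 2 * M with hL
  have hL0 : 0 ≤ L := by positivity
  have h0 : ∀ t α, ¬ (|charY u₀ μ₀ t α| ≤ R ∧ |t| ≤ R) → momRate u₀ μ₀ φ t α = 0 := by
    intro t α h
    obtain ⟨e1, e2, e3⟩ := hs _ _ h
    simp only [momRate, e1, e2, e3]; ring
  refine integrable_of_bounded_of_support hmeas.aestronglyMeasurable
    (C := 1 / 2 * M * C * D + L * (C * L + C) * D + L * C * D) ?_
    -- Since α = y - u₀(x̄) t - (t²/4) Z + Z, the bounds |y| ≤ R and |t| ≤ R confine the label to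
    -- this interval.
    (s := Icc (-R) R ×ˢ Icc (-(R + R * ‖u₀‖ + R ^ 2 / 4 * M + M)) (R + R * ‖u₀‖ + R ^ 2 / 4 * M + M))
    ?_ ?_
  · rintro ⟨t, α⟩
    simp only [Function.uncurry]
    by_cases ht : |charY u₀ μ₀ t α| ≤ R ∧ |t| ≤ R
    swap
    · rw [h0 t α ht, abs_zero]; positivity
    have hV : |lagVel u₀ μ₀ t α| ≤ L := (abs_lagVel_le t α).trans (by
      have := mul_le_mul_of_nonneg_right ht.2 hM0
      rw [hL]; simp only [← hM]; linarith)
    obtain ⟨b1, b2, b3⟩ := hb (charY u₀ μ₀ t α) t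
    obtain ⟨j1, j2⟩ := hj t α ht.2
    have hz := abs_zbar_le (μ₀ := μ₀) α
    unfold momRate
    refine (abs_add_le _ _).trans (add_le_add ((abs_add_le _ _).trans (add_le_add ?_ ?_)) ?_)
    · rw [abs_mul, abs_mul, abs_mul, abs_of_pos (show (0:ℝ) < 1 / 2 by norm_num)]
      gcongr
    · rw [abs_mul, abs_mul]
      have : |dX φ (charY u₀ μ₀ t α) t * lagVel u₀ μ₀ t α + dT φ (charY u₀ μ₀ t α) t| ≤ C * L + C := by
        refine (abs_add_le _ _).trans (add_le_add ?_ b3)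
        rw [abs_mul]; gcongr
      gcongr
    · rw [abs_mul, abs_mul]; gcongr
  · rw [Measure.prod_prod]
    exact ENNReal.mul_ne_top (by simp) (by simp)
  · rintro ⟨t, α⟩ hp
    refine h0 t α fun ht => hp ⟨abs_le.1 ht.2, abs_le.1 ?_⟩
    have e : α = charY u₀ μ₀ t α - u₀ (xbar μ₀ α) * t - t ^ 2 / 4 * zbar μ₀ α + zbar μ₀ α := by
      rw [charY_eq]; unfold zbar; ring
    have hz := abs_zbar_le (μ₀ := μ₀) α
    have e1 : |u₀ (xbar μ₀ α) * t| ≤ R * ‖u₀‖ := by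
      rw [abs_mul, mul_comm]
      exact mul_le_mul ht.2 (u₀.norm_coe_le_norm _) (abs_nonneg _) hR.le
    have e2 : |t ^ 2 / 4 * zbar μ₀ α| ≤ R ^ 2 / 4 * M := by
      rw [abs_mul, abs_div, abs_pow, abs_of_pos (show (0:ℝ) < 4 by norm_num)]
      have := ht.2
      gcongr
    change |α| ≤ _
    rw [e]
    refine (abs_add_le _ _).trans (add_le_add ((abs_sub _ _).trans (add_le_add
      ((abs_sub _ _).trans (add_le_add ht.1 e1)) e2)) hz)

theorem InD.integral_momRate (h₀ : InD u₀ μ₀) {φ : ℝ × ℝ → ℝ} (hφ : IsTestFun φ) :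
    ∫ t, ∫ α, momRate u₀ μ₀ φ t α = 0 := by
  rw [integral_integral_swap (h₀.integrable_momRate hφ)]
  obtain ⟨R, hR, C, hC, hb, hs⟩ := hφ.exists_bound
  have : ∀ α, ∫ t, momRate u₀ μ₀ φ t α = 0 := fun α => by
    refine integral_eq_zero_of_hasDerivAt_of_support (fun t => hφ.hasDerivAt_momentum t α) ?_
      (R := R) ?_
    · have hy : Continuous fun t => charY u₀ μ₀ t α :=
        continuous_charY.comp (continuous_id.prodMk continuous_const)
      have hV : Continuous fun t => lagVel u₀ μ₀ t α :=
        continuous_lagVel.comp (continuous_id.prodMk continuous_const)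
      have m1 : Continuous fun t => dX φ (charY u₀ μ₀ t α) t :=
        hφ.continuous_dX.comp (hy.prodMk continuous_id)
      have m2 : Continuous fun t => dT φ (charY u₀ μ₀ t α) t :=
        hφ.continuous_dT.comp (hy.prodMk continuous_id)
      have m3 : Continuous fun t => φ (charY u₀ μ₀ t α, t) :=
        hφ.continuous.comp (hy.prodMk continuous_id)
      have m6 : Continuous fun t => charJac u₀ μ₀ t α := by unfold charJac; fun_prop
      have m7 : Continuous fun t => velJac u₀ μ₀ t α := by unfold velJac; fun_prop
      exact (((continuous_const.mul m3).mul m6).add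
        ((hV.mul ((m1.mul hV).add m2)).mul m6)).add ((hV.mul m3).mul m7)
    · intro t ht
      rw [(hs (charY u₀ μ₀ t α) t fun h => ht h.2).1]; ring
  simp [this]

/-- The integrand of the momentum equation at a fixed time. -/
theorem InD.integral_momentum_slice (h₀ : InD u₀ μ₀) {φ : ℝ × ℝ → ℝ} (hφ : IsTestFun φ) (t : ℝ) :
    ∫ x, (h₀.vel t x * dT φ x t - φ (x, t) * (h₀.vel t x * deriv (h₀.vel t) x
      - (1 / 2) * (h₀.energy t : Measure ℝ).real (Iic x))) = ∫ α, momRate u₀ μ₀ φ t α := by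
  obtain ⟨R, hR, C, hC, hb, hs⟩ := hφ.exists_bound
  obtain ⟨hφt, hφs⟩ := hφ.slice t
  set u := h₀.vel t with hu
  have huc : Continuous u := u.continuous
  have hux := (h₀.isWeakDeriv_vel t).locInt_deriv
  have hXc : Continuous fun x => dX φ x t :=
    hφ.continuous_dX.comp (continuous_id.prodMk continuous_const)
  have hTc : Continuous fun x => dT φ x t :=
    hφ.continuous_dT.comp (continuous_id.prodMk continuous_const)
  have hsupp : ∀ {f : ℝ → ℝ}, (∀ x, ¬ |x| ≤ R → f x = 0) → HasCompactSupport f := fun {f} h =>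
    HasCompactSupport.of_support_subset_isCompact (isCompact_Icc (a := -R) (b := R)) fun x hx => by
      by_contra hcon; exact hx (h x fun h => hcon (abs_le.1 h))
  have sX : HasCompactSupport fun x => dX φ x t := hsupp fun x hx => (hs x t fun h => hx h.1).2.1
  have sT : HasCompactSupport fun x => dT φ x t := hsupp fun x hx => (hs x t fun h => hx h.1).2.2
  have i1 : Integrable fun x => u x * dT φ x t :=
    (huc.mul hTc).integrable_of_hasCompactSupport sT.mul_left
  have i2 : Integrable fun x => φ (x, t) * (u x * deriv u x) := by
    have := hux.integrable_smul_right_of_hasCompactSupport (hφt.continuous.mul huc) hφs.mul_right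
    refine this.congr (ae_of_all _ fun x => ?_)
    simp only [smul_eq_mul, Pi.mul_apply]; ring
  have i3 : Integrable fun x => φ (x, t) * ((1 / 2) * (h₀.energy t : Measure ℝ).real (Iic x)) := by
    refine (hφt.continuous.integrable_of_hasCompactSupport hφs).mul_bdd
      (c := 1 / 2 * (h₀.energy t : Measure ℝ).real univ)
      ((measurable_real_Iic _).const_mul _).aestronglyMeasurable (ae_of_all _ fun x => ?_)
    rw [Real.norm_eq_abs, abs_of_nonneg (by positivity)]
    exact mul_le_mul_of_nonneg_left (measureReal_mono (subset_univ _)) (by norm_num)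
  have i4 : Integrable fun x => u x * u x * dX φ x t :=
    ((huc.mul huc).mul hXc).integrable_of_hasCompactSupport sX.mul_left
  -- This is ∫ (u² φ)_x = 0. Added to the integrand, it turns -φ u u_x into φ u u_x + u² φ_x, the
  -- form which in labels is d/dt of V φ y_α.
  have hz : ∫ x, (2 * (φ (x, t) * (u x * deriv u x)) + u x * u x * dX φ x t) = 0 := by
    have hAC : ∀ a b, AbsolutelyContinuousOnInterval u a b :=
      (h₀.chart t).globallyAC_eulVel.absolutelyContinuousOnInterval
    have hφAC : AbsolutelyContinuousOnInterval (fun x => φ (x, t)) (-(R+1)) (R+1) :=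
      (hφt.of_le (by simp) : ContDiff ℝ 1 _).contDiffOn.absolutelyContinuousOnInterval
    have hW := ((hAC (-(R+1)) (R+1)).fun_mul (hAC (-(R+1)) (R+1))).fun_mul hφAC
    have h1 := hW.integral_deriv_eq_sub
    have z1 : φ (R+1, t) = 0 := (hs _ _ fun h => by
      have := le_abs_self (R+1); linarith [h.1]).1
    have z2 : φ (-(R+1), t) = 0 := (hs _ _ fun h => by
      have := neg_le_abs (-(R+1)); linarith [h.1]).1
    rw [z1, z2] at h1
    simp only [mul_zero, sub_zero] at h1
    rw [integral_eq_intervalIntegral_of_forall_ne (R := R + 1), ← h1]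
    · refine intervalIntegral.integral_congr_ae ?_
      filter_upwards [ae_differentiableAt_of_absolutelyContinuous hAC] with x hx _
      have hd := ((hx.hasDerivAt.mul hx.hasDerivAt).mul (hφ.hasDerivAt_dX x t)).deriv
      have e : deriv (fun x => u x * u x * φ (x, t)) x =
        deriv ((⇑u * ⇑u) * fun z => φ (z, t)) x := rfl
      rw [e, hd]
      simp only [Pi.mul_apply]
      ring
    · intro x hx
      by_contra hcon
      apply hx
      have h2 : ¬ |x| ≤ R := fun h => hcon ⟨by linarith [(abs_le.1 h).1], by linarith [(abs_le.1 h).2]⟩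
      obtain ⟨e1, e2, -⟩ := hs x t fun h => h2 h.1
      rw [e1, e2]; ring
  have hsum : ∫ x, (u x * dT φ x t - φ (x, t) * (u x * deriv u x
      - (1 / 2) * (h₀.energy t : Measure ℝ).real (Iic x))) =
      ∫ x, (u x * dT φ x t + φ (x, t) * (u x * deriv u x) + u x * u x * dX φ x t
        + φ (x, t) * ((1 / 2) * (h₀.energy t : Measure ℝ).real (Iic x))) := by
    have iA : Integrable fun x => u x * dT φ x t - φ (x, t) * (u x * deriv u x
      - (1 / 2) * (h₀.energy t : Measure ℝ).real (Iic x)) := by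
      refine ((i1.sub i2).add i3).congr (ae_of_all _ fun x => ?_)
      simp only [Pi.add_apply, Pi.sub_apply]; ring
    have iB : Integrable fun x => 2 * (φ (x, t) * (u x * deriv u x)) + u x * u x * dX φ x t :=
      (i2.const_mul 2).add i4
    rw [← add_zero (∫ x, _ - _), ← hz, ← integral_add iA iB]
    congr 1; funext x; ring
  rw [hsum]
  obtain ⟨K, hK⟩ := (h₀.chart t).lip_y
  rw [integral_comp_mul_deriv' hK (h₀.chart t).mono_y (h₀.chart t).surj_y]
  · refine integral_congr_ae ?_
    filter_upwards [(h₀.chart t).ae_deriv_V_eq, h₀.ae_hasDerivAt_charY,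
      ae_mem_posSet_or_zeroSet hK (h₀.chart t).mono_y] with α h1 h2 h3
    obtain ⟨h2, h2'⟩ := h2 t
    rw [← h₀.coe_vel, ← hu, h2.deriv, h2'.deriv] at h1
    -- F(y(α)) = Z(α) may fail where y_α = 0, but F enters only multiplied by y_α.
    have hF : charJac u₀ μ₀ t α * (h₀.energy t : Measure ℝ).real (Iic (charY u₀ μ₀ t α)) =
        charJac u₀ μ₀ t α * zbar μ₀ α := by
      rcases h3 with h3 | h3
      · rw [measureReal_def, h₀.coe_energy, (h₀.chart t).eulEnergy_Iic h3,
          ENNReal.toReal_ofReal ((h₀.chart t).Z_nonneg α)]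
      · have h4 : deriv (charY u₀ μ₀ t) α = 0 := HasDerivAt.deriv h3
        rw [h2.deriv] at h4
        rw [h4]; ring
    rw [h2.deriv, hu, h₀.vel_charY, ← hu, momRate, h1]
    linear_combination (1 / 2 * φ (charY u₀ μ₀ t α, t)) * hF
  · refine AEStronglyMeasurable.add (AEStronglyMeasurable.add (AEStronglyMeasurable.add ?_ ?_) ?_) ?_
    · exact i1.aestronglyMeasurable
    · exact i2.aestronglyMeasurable
    · exact i4.aestronglyMeasurable
    · exact i3.aestronglyMeasurable

theorem InD.momentum_equation (h₀ : InD u₀ μ₀) {φ : ℝ × ℝ → ℝ} (hφ : IsTestFun φ) :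
    ∫ t, ∫ x, (h₀.vel t x * dT φ x t - φ (x, t) * (h₀.vel t x * deriv (h₀.vel t) x
      - (1 / 2) * (h₀.energy t : Measure ℝ).real (Iic x))) = 0 := by
  simp only [h₀.integral_momentum_slice hφ, h₀.integral_momRate hφ]

/-! ### The time derivative -/

/-- The weak time derivative of the velocity. -/
noncomputable def InD.velT (h₀ : InD u₀ μ₀) (p : ℝ × ℝ) : ℝ :=
  1 / 2 * (h₀.energy p.2 : Measure ℝ).real (Iic p.1) - h₀.vel p.2 p.1 * deriv (h₀.vel p.2) p.1

theorem InD.continuous_vel_uncurry (h₀ : InD u₀ μ₀) :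
    Continuous fun p : ℝ × ℝ => h₀.vel p.2 p.1 :=
  (h₀.continuous_vel.comp continuous_snd).eval continuous_fst

theorem InD.measurable_energy_Iic (h₀ : InD u₀ μ₀) :
    Measurable fun p : ℝ × ℝ => (h₀.energy p.2 : Measure ℝ).real (Iic p.1) := by
  have := h₀.isFiniteMeasure_derivMeasure
  have hS : MeasurableSet {q : (ℝ × ℝ) × ℝ | charY u₀ μ₀ q.1.2 q.2 ≤ q.1.1} := by
    refine (isClosed_le ?_ (continuous_fst.comp continuous_fst)).measurableSet
    exact continuous_charY.comp ((continuous_snd.comp continuous_fst).prodMk continuous_snd)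
  have h := (measurable_measure_prodMk_left (ν := derivMeasure (zbar μ₀)) hS).ennreal_toReal
  have e : (fun p : ℝ × ℝ => (h₀.energy p.2 : Measure ℝ).real (Iic p.1)) = fun p =>
      (derivMeasure (zbar μ₀)
        (Prod.mk p ⁻¹' {q : (ℝ × ℝ) × ℝ | charY u₀ μ₀ q.1.2 q.2 ≤ q.1.1})).toReal := by
    funext p
    rw [measureReal_def, h₀.coe_energy, eulEnergy,
      Measure.map_apply (h₀.chart p.2).measurable_y measurableSet_Iic]
    rfl
  rw [e]
  exact h

theorem measurable_deriv_of_continuous {f : ℝ → ℝ → ℝ} (hf : Continuous (Function.uncurry f)) :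
    Measurable fun p : ℝ × ℝ => deriv (f p.2) p.1 :=
  (measurable_deriv_with_param hf).comp (measurable_snd.prodMk measurable_fst)

theorem InD.measurable_deriv_vel (h₀ : InD u₀ μ₀) :
    Measurable fun p : ℝ × ℝ => deriv (h₀.vel p.2) p.1 :=
  measurable_deriv_of_continuous (f := fun t x => h₀.vel t x)
    (h₀.continuous_vel_uncurry.comp (continuous_snd.prodMk continuous_fst))

theorem InD.lintegral_sq_deriv_le (h₀ : InD u₀ μ₀) (t : ℝ) :
    ∫⁻ x, ENNReal.ofReal (deriv (h₀.vel t) x ^ 2) ≤ (μ₀ : Measure ℝ) univ := by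
  rw [← h₀.energy_univ t, ← setLIntegral_univ, ← withDensity_apply _ MeasurableSet.univ]
  change sqMeasure (deriv (h₀.vel t)) univ ≤ _
  rw [← h₀.acPart_energy]
  exact acPart_le _ _

/-- F and u are bounded on compact sets, and by Tonelli u_x is square integrable on a time strip
because each slice contributes at most the total energy. -/
theorem InD.memLp_velT (h₀ : InD u₀ μ₀) {K : Set (ℝ × ℝ)} (hK : IsCompact K) :
    MemLp h₀.velT 2 (volume.restrict K) := by
  have hKf : IsFiniteMeasure ((volume : Measure (ℝ × ℝ)).restrict K) :=
    isFiniteMeasure_restrict.2 hK.measure_lt_top.ne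
  obtain ⟨R, hR, hsub⟩ := hK.isBounded.subset_closedBall_lt 0 0
  have hKsub : K ⊆ univ ×ˢ Icc (-R) R := fun p hp => by
    have := hsub hp
    rw [Metric.mem_closedBall, dist_zero_right] at this
    exact ⟨mem_univ _, abs_le.1 ((norm_snd_le p).trans this)⟩
  have h1 : MemLp (fun p : ℝ × ℝ => 1 / 2 * (h₀.energy p.2 : Measure ℝ).real (Iic p.1)) 2
      (volume.restrict K) := by
    refine MemLp.of_bound (h₀.measurable_energy_Iic.const_mul _).aestronglyMeasurable
      (1 / 2 * (μ₀ : Measure ℝ).real univ) (ae_of_all _ fun p => ?_)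
    rw [Real.norm_eq_abs, abs_of_nonneg (by positivity), ← h₀.energy_real_univ p.2]
    exact mul_le_mul_of_nonneg_left (measureReal_mono (subset_univ _)) (by norm_num)
  have h2 : MemLp (fun p : ℝ × ℝ => deriv (h₀.vel p.2) p.1) 2 (volume.restrict K) := by
    rw [memLp_two_iff_integrable_sq h₀.measurable_deriv_vel.aestronglyMeasurable]
    refine ⟨(h₀.measurable_deriv_vel.pow_const 2).aestronglyMeasurable, ?_⟩
    rw [hasFiniteIntegral_iff_ofReal (ae_of_all _ fun p => sq_nonneg _)]
    refine (lintegral_mono_set hKsub).trans_lt ?_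
    rw [Measure.volume_eq_prod, ← Measure.prod_restrict, Measure.restrict_univ,
      lintegral_prod_symm _ (h₀.measurable_deriv_vel.pow_const 2).ennreal_ofReal.aemeasurable]
    calc ∫⁻ t in Icc (-R) R, ∫⁻ x, ENNReal.ofReal (deriv (h₀.vel t) x ^ 2)
        ≤ ∫⁻ _ in Icc (-R) R, (μ₀ : Measure ℝ) univ :=
          lintegral_mono fun t => h₀.lintegral_sq_deriv_le t
      _ < ⊤ := by
          rw [setLIntegral_const]
          exact ENNReal.mul_lt_top (measure_lt_top _ _) measure_Icc_lt_top
  refine h1.sub ?_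
  refine h2.of_le_mul (c := ‖u₀‖ + R / 2 * (μ₀ : Measure ℝ).real univ)
    (h₀.continuous_vel_uncurry.measurable.mul h₀.measurable_deriv_vel).aestronglyMeasurable ?_
  filter_upwards [ae_restrict_mem hK.measurableSet] with p hp
  rw [norm_mul]
  refine mul_le_mul_of_nonneg_right ?_ (norm_nonneg _)
  obtain ⟨α, hα⟩ := (h₀.chart p.2).surj_y p.1
  rw [← hα, h₀.vel_charY, Real.norm_eq_abs]
  refine (abs_lagVel_le _ _).trans ?_
  have := abs_le.2 (hKsub hp).2
  gcongr

/-- The momentum equation already says u_t = F/2 - u u_x. Local integrability of the right-hand side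
permits passing from iterated to double integrals. -/
theorem InD.isL2locTimeDeriv (h₀ : InD u₀ μ₀) : IsL2locTimeDeriv h₀.vel h₀.velT := by
  refine ⟨fun K hK => h₀.memLp_velT hK, fun φ hφ => ?_⟩
  obtain ⟨R, hR, C, hC, hb, hs⟩ := hφ.exists_bound
  have hloc : LocallyIntegrable h₀.velT volume := by
    rw [locallyIntegrable_iff]
    intro K hK
    have hKf : IsFiniteMeasure ((volume : Measure (ℝ × ℝ)).restrict K) :=
      isFiniteMeasure_restrict.2 hK.measure_lt_top.ne
    exact (h₀.memLp_velT hK).integrable (by norm_num)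
  have i1 : Integrable fun p : ℝ × ℝ => h₀.velT p * φ p := by
    simpa using! hloc.integrable_smul_right_of_hasCompactSupport hφ.continuous hφ.2
  have sT : HasCompactSupport fun p : ℝ × ℝ => dT φ p.1 p.2 := by
    refine HasCompactSupport.of_support_subset_isCompact
      ((isCompact_Icc (a := -R) (b := R)).prod (isCompact_Icc (a := -R) (b := R))) ?_
    intro p hp
    by_contra hcon
    exact hp (hs p.1 p.2 fun h => hcon ⟨abs_le.1 h.1, abs_le.1 h.2⟩).2.2
  have i2 : Integrable fun p : ℝ × ℝ => h₀.vel p.2 p.1 * dT φ p.1 p.2 :=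
    (h₀.continuous_vel_uncurry.mul hφ.continuous_dT).integrable_of_hasCompactSupport sT.mul_left
  have h := h₀.momentum_equation hφ
  have e : ∫ p : ℝ × ℝ, (h₀.vel p.2 p.1 * dT φ p.1 p.2 + h₀.velT p * φ p) = 0 := by
    rw [← h, Measure.volume_eq_prod, integral_prod_symm _ (by exact i2.add i1)]
    congr 1; funext t; congr 1; funext x
    simp only [InD.velT]; ring
  rw [integral_add i2 i1] at e
  linarith

end HunterSaxton

namespace HunterSaxton

variable {u₀ : ℝ →ᵇ ℝ} {μ₀ : FiniteMeasure ℝ}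

/-! ### Singular parts of the energy -/

theorem lagPP_eq (t : ℝ) : lagPP u₀ μ₀ t =
    zeroSet (charY u₀ μ₀ t) ∩ charY u₀ μ₀ t ⁻¹' multSet (charY u₀ μ₀ t) := by
  rw [LagChart.preimage_multSet_eq]; rfl

theorem lagSC_eq (t : ℝ) : lagSC u₀ μ₀ t =
    zeroSet (charY u₀ μ₀ t) \ charY u₀ μ₀ t ⁻¹' multSet (charY u₀ μ₀ t) := by
  rw [LagChart.preimage_multSet_eq]
  ext α
  refine and_congr_right fun _ => ⟨fun h ⟨β, h1, h2⟩ => h1 (h β h2), fun h β h2 => ?_⟩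
  by_contra h1
  exact h ⟨β, h1, h2⟩

theorem lagPP_union_lagSC (t : ℝ) : lagPP u₀ μ₀ t ∪ lagSC u₀ μ₀ t = zeroSet (charY u₀ μ₀ t) := by
  rw [lagPP_eq, lagSC_eq, inter_union_sdiff]

theorem InD.ppPart_energy (h₀ : InD u₀ μ₀) (t : ℝ) : ppPart (h₀.energy t : Measure ℝ) =
    ((derivMeasure (zbar μ₀)).restrict (lagPP u₀ μ₀ t)).map (charY u₀ μ₀ t) := by
  rw [lagPP_eq]; exact (h₀.chart t).ppPart_eulEnergy

theorem InD.scPart_energy (h₀ : InD u₀ μ₀) (t : ℝ) : scPart (h₀.energy t : Measure ℝ) =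
    ((derivMeasure (zbar μ₀)).restrict (lagSC u₀ μ₀ t)).map (charY u₀ μ₀ t) := by
  rw [lagSC_eq]; exact (h₀.chart t).scPart_eulEnergy

theorem InD.acPart_energy_eq_map (h₀ : InD u₀ μ₀) (t : ℝ) : acPart (h₀.energy t : Measure ℝ) =
    ((derivMeasure (zbar μ₀)).restrict (lagAC u₀ μ₀ t)).map (charY u₀ μ₀ t) := by
  rw [h₀.acPart_energy]; exact (h₀.chart t).map_restrict_posSet.symm

theorem InD.ppPart_add_scPart_energy (h₀ : InD u₀ μ₀) (t : ℝ) :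
    ppPart (h₀.energy t : Measure ℝ) + scPart (h₀.energy t : Measure ℝ) =
    ((derivMeasure (zbar μ₀)).restrict (zeroSet (charY u₀ μ₀ t))).map (charY u₀ μ₀ t) :=
  (h₀.chart t).ppPart_add_scPart

/-- With V' = x̄' g and Z' = x̄' g², the Jacobian x̄' + t V' + (t²/4) Z' is a complete square. -/
theorem InD.ae_charJac_of_posSet (h₀ : InD u₀ μ₀) {g : ℝ → ℝ} (hg : IsWeakDeriv u₀ g) :
    ∀ᵐ α, α ∈ posSet (xbar μ₀) → 0 < deriv (xbar μ₀) α ∧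
      deriv (zbar μ₀) α = deriv (xbar μ₀) α * g (xbar μ₀ α) ^ 2 ∧
      ∀ t, charJac u₀ μ₀ t α = deriv (xbar μ₀) α * (1 + t / 2 * g (xbar μ₀ α)) ^ 2 := by
  have hL := lipschitzWith_xbar μ₀
  filter_upwards [h₀.ae_deriv_zbar_eq, h₀.ae_hasDerivAt_comp,
    null_preimage_inter_posSet hL (monotone_xbar μ₀) (surjective_xbar μ₀)
      (hg.ae_eq h₀.isWeakDeriv)] with α h1 h2 h3 hα
  have h4 := h3 hα
  have h1 := h1 hα
  have h2 := (h2 hα).deriv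
  rw [← h4] at h1 h2
  refine ⟨?_, h1, fun t => ?_⟩
  · obtain ⟨d, hd, h⟩ := hα
    rwa [h.deriv]
  · rw [charJac, h1, h2]; ring

/-- These labels carry the singular part of the datum: here V' = 0 and Z' = 1, so singular energy is
spread out at every t ≠ 0. -/
theorem InD.ae_charJac_of_zeroSet (h₀ : InD u₀ μ₀) :
    ∀ᵐ α, α ∈ zeroSet (xbar μ₀) → deriv (zbar μ₀) α = 1 ∧
      ∀ t, charJac u₀ μ₀ t α = t ^ 2 / 4 := by
  filter_upwards [ae_deriv_zbar μ₀, h₀.lagChart.ae_eq] with α h1 h2 hα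
  have h3 : deriv (xbar μ₀) α = 0 := HasDerivAt.deriv hα
  rw [h3, zero_mul] at h2
  have h4 := pow_eq_zero_iff two_ne_zero |>.1 h2
  rw [h3, sub_zero] at h1
  refine ⟨h1, fun t => ?_⟩
  rw [charJac, h3, h4, h1]; ring

theorem InD.zeroSet_ae_eq (h₀ : InD u₀ μ₀) {g : ℝ → ℝ} (hg : IsWeakDeriv u₀ g) {t : ℝ}
    (ht : t ≠ 0) : (zeroSet (charY u₀ μ₀ t) : Set ℝ) =ᵐ[volume]
      (posSet (xbar μ₀) ∩ xbar μ₀ ⁻¹' singSet g t : Set ℝ) := by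
  filter_upwards [h₀.ae_charJac_of_posSet hg, h₀.ae_charJac_of_zeroSet, h₀.ae_hasDerivAt_charY,
    ae_mem_posSet_or_zeroSet (lipschitzWith_xbar μ₀) (monotone_xbar μ₀)] with α h1 h2 h3 h4
  apply propext
  change α ∈ zeroSet (charY u₀ μ₀ t) ↔ (α ∈ posSet (xbar μ₀) ∧ g (xbar μ₀ α) = -2 / t)
  have hd := (h3 t).1
  have e : α ∈ zeroSet (charY u₀ μ₀ t) ↔ charJac u₀ μ₀ t α = 0 :=
    ⟨fun h => hd.unique h, fun h => by rw [h] at hd; exact hd⟩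
  rw [e]
  rcases h4 with h4 | h4
  · obtain ⟨hpos, -, h5⟩ := h1 h4
    rw [h5 t]
    constructor
    · intro h
      refine ⟨h4, ?_⟩
      have := (mul_eq_zero.1 h).resolve_left hpos.ne'
      have := pow_eq_zero_iff two_ne_zero |>.1 this
      field_simp
      linarith
    · rintro ⟨-, h⟩
      rw [h]; field_simp; ring
  · obtain ⟨-, h5⟩ := h2 h4
    rw [h5 t]
    constructor
    · intro h
      exfalso
      have : 0 < t ^ 2 / 4 := by positivity
      exact this.ne' h
    · rintro ⟨h, -⟩
      exact ((disjoint_posSet_zeroSet _).le_bot ⟨h, h4⟩).elim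

theorem nullMeasurableSet_singSet {v g : ℝ → ℝ} (hg : IsWeakDeriv v g) (t : ℝ) :
    NullMeasurableSet (singSet g t) volume :=
  hg.locInt_deriv.aestronglyMeasurable.aemeasurable.nullMeasurable
    (measurableSet_singleton (-2 / t))

/-- On the zero set Z' = x̄' (2/t)² > 0 almost everywhere, so energy and Lebesgue measure have the
same null subsets there. -/
theorem InD.volume_zeroSet_of_derivMeasure (h₀ : InD u₀ μ₀) {t : ℝ} (ht : t ≠ 0)
    (h : derivMeasure (zbar μ₀) (zeroSet (charY u₀ μ₀ t)) = 0) :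
    volume (zeroSet (charY u₀ μ₀ t)) = 0 := by
  have hg := h₀.isWeakDeriv
  rw [measure_eq_zero_iff_ae_notMem, derivMeasure,
    ae_withDensity_iff (by fun_prop)] at h
  rw [measure_eq_zero_iff_ae_notMem]
  filter_upwards [h, h₀.zeroSet_ae_eq hg ht, h₀.ae_charJac_of_posSet hg] with α h1 h2 h3 hα
  have h4 : α ∈ posSet (xbar μ₀) ∩ xbar μ₀ ⁻¹' singSet (deriv u₀) t := (iff_of_eq h2).1 hα
  refine h1 ?_ hα
  obtain ⟨h5, h6, -⟩ := h3 h4.1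
  have h7 : deriv u₀ (xbar μ₀ α) = -2 / t := h4.2
  rw [h6, h7]
  have : 0 < deriv (xbar μ₀) α * (-2 / t) ^ 2 := by
    have : (-2 / t) ≠ 0 := div_ne_zero (by norm_num) ht
    positivity
  simpa using this

theorem InD.ppPart_add_scPart_ne_zero (h₀ : InD u₀ μ₀) {g : ℝ → ℝ} (hg : IsWeakDeriv u₀ g) {t : ℝ}
    (ht : t ≠ 0) (hA : volume (singSet g t) ≠ 0) :
    ppPart (h₀.energy t : Measure ℝ) + scPart (h₀.energy t : Measure ℝ) ≠ 0 := by
  intro h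
  rw [h₀.ppPart_add_scPart_energy, Measure.map_eq_zero_iff (h₀.chart t).measurable_y.aemeasurable,
    Measure.restrict_eq_zero] at h
  have h1 := h₀.volume_zeroSet_of_derivMeasure ht h
  rw [measure_congr (h₀.zeroSet_ae_eq hg ht)] at h1
  have hL := lipschitzWith_xbar μ₀
  have h2 := volume_image_eq_zero_of_lipschitz hL h1
  have h3 := ae_mem_image_posSet hL (monotone_xbar μ₀) (surjective_xbar μ₀)
  refine hA (measure_mono_null ?_ (measure_union_null h2 h3))
  intro x hx
  by_cases hx' : x ∈ xbar μ₀ '' posSet (xbar μ₀)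
  · obtain ⟨α, hα, rfl⟩ := hx'
    exact Or.inl ⟨α, ⟨hα, hx⟩, rfl⟩
  · exact Or.inr hx'

/-- The level set of x̄ through α is a point, so α must be the label x + μ₀((-∞, x)) with x = x̄(α).
-/
theorem zbar_eq_of_posSet {α : ℝ} (hα : α ∈ posSet (xbar μ₀)) :
    zbar μ₀ α = (μ₀ : Measure ℝ).real (Iio (xbar μ₀ α)) := by
  have h1 : xbar μ₀ (xbar μ₀ α + (μ₀ : Measure ℝ).real (Iio (xbar μ₀ α))) = xbar μ₀ α :=
    xbar_eq μ₀ le_rfl (by have := real_Iio_le_Iic (μ₀ : Measure ℝ) (xbar μ₀ α); linarith)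
  have h2 := eq_of_mem_posSet (monotone_xbar μ₀) hα h1
  unfold zbar
  linarith

theorem charY_eq_flowMap (t : ℝ) {α : ℝ} (hα : α ∈ posSet (xbar μ₀)) :
    charY u₀ μ₀ t α = flowMap u₀ μ₀ t (xbar μ₀ α) := by
  rw [charY_eq, zbar_eq_of_posSet hα]; rfl

/-- The image of T need not be measurable. Inner regularity gives compact subsets of T that exhaust
m, and the union of their compact images is a measurable set of full measure inside y(T). -/
theorem map_compl_image_eq_zero {m : Measure ℝ} [IsFiniteMeasure m] {y : ℝ → ℝ} (hy : Continuous y)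
    {T : Set ℝ} (hT : ∀ᵐ α ∂m, α ∈ T) : m.map y (y '' T)ᶜ = 0 := by
  set T' := (toMeasurable m Tᶜ)ᶜ with hT'
  have hm : MeasurableSet T' := (measurableSet_toMeasurable _ _).compl
  have hsub : T' ⊆ T := by
    rw [hT', compl_subset_comm]; exact subset_toMeasurable _ _
  have hnull : m T'ᶜ = 0 := by
    rw [hT', compl_compl, measure_toMeasurable]; exact hT
  have hK : ∀ n : ℕ, ∃ K ⊆ T', IsCompact K ∧ m (T' \ K) < ((n : ℝ≥0∞) + 1)⁻¹ := fun n =>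
    hm.exists_isCompact_sdiff_lt (measure_ne_top _ _) (by simp)
  choose K hKs hKc hKm using hK
  have hSm : MeasurableSet (⋃ n, y '' K n) :=
    MeasurableSet.iUnion fun n => ((hKc n).image hy).isClosed.measurableSet
  have hsub2 : (y '' T)ᶜ ⊆ (⋃ n, y '' K n)ᶜ := by
    rw [compl_subset_compl]
    exact iUnion_subset fun n => image_mono ((hKs n).trans hsub)
  refine measure_mono_null hsub2 ?_
  rw [Measure.map_apply hy.measurable hSm.compl]
  have hle : ∀ n : ℕ, m (y ⁻¹' (⋃ n, y '' K n)ᶜ) ≤ ((n : ℝ≥0∞) + 1)⁻¹ := fun n => by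
    have hs : y ⁻¹' (⋃ n, y '' K n)ᶜ ⊆ T'ᶜ ∪ (T' \ K n) := by
      intro α hα
      by_cases h1 : α ∈ T'
      · refine Or.inr ⟨h1, fun h2 => hα ?_⟩
        exact mem_iUnion.2 ⟨n, α, h2, rfl⟩
      · exact Or.inl h1
    calc _ ≤ m T'ᶜ + m (T' \ K n) := (measure_mono hs).trans (measure_union_le _ _)
      _ ≤ _ := by rw [hnull, zero_add]; exact (hKm n).le
  have hlim : Tendsto (fun n : ℕ => ((n : ℝ≥0∞) + 1)⁻¹) atTop (𝓝 0) := by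
    have := (tendsto_add_atTop_iff_nat 1).2 ENNReal.tendsto_inv_nat_nhds_zero
    simpa using! this
  exact le_antisymm (ge_of_tendsto' hlim hle) bot_le

theorem InD.singular_compl_image (h₀ : InD u₀ μ₀) {g : ℝ → ℝ} (hg : IsWeakDeriv u₀ g) {t : ℝ}
    (ht : t ≠ 0) : (ppPart (h₀.energy t : Measure ℝ) + scPart (h₀.energy t : Measure ℝ))
      (flowMap u₀ μ₀ t '' singSet g t)ᶜ = 0 := by
  have := h₀.isFiniteMeasure_derivMeasure
  rw [h₀.ppPart_add_scPart_energy]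
  have hT : ∀ᵐ α ∂((derivMeasure (zbar μ₀)).restrict (zeroSet (charY u₀ μ₀ t))),
      α ∈ (posSet (xbar μ₀) ∩ xbar μ₀ ⁻¹' singSet g t : Set ℝ) := by
    rw [ae_restrict_iff' (measurableSet_zeroSet _)]
    refine (derivMeasure_absolutelyContinuous _).ae_le ?_
    filter_upwards [h₀.zeroSet_ae_eq hg ht] with α h1 h2
    exact (iff_of_eq h1).1 h2
  refine measure_mono_null ?_ (map_compl_image_eq_zero (h₀.chart t).continuous_y hT)
  rw [compl_subset_compl]
  rintro _ ⟨α, ⟨h1, h2⟩, rfl⟩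
  exact ⟨xbar μ₀ α, h2, (charY_eq_flowMap t h1).symm⟩

theorem support_subset_closure_of_compl {m : Measure ℝ} {S : Set ℝ} (h : m Sᶜ = 0) :
    m.support ⊆ closure S := by
  intro x hx
  by_contra hcon
  refine Measure.notMem_support_iff_exists.2 ⟨(closure S)ᶜ,
    isClosed_closure.isOpen_compl.mem_nhds hcon, measure_mono_null ?_ h⟩ hx
  rw [compl_subset_compl]; exact subset_closure

theorem measurable_flowMap (t : ℝ) : Measurable (flowMap u₀ μ₀ t) := by
  have h1 : Measurable fun x => (μ₀ : Measure ℝ).real (Iio x) :=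
    Monotone.measurable fun _ _ h => measureReal_mono (Iio_subset_Iio h)
  have h2 := u₀.continuous.measurable
  unfold flowMap
  fun_prop

/-- On `posSet (xbar μ₀)` the characteristic map factors through x̄, and μ₀,ac is the image of the
energy there. Replacing A by a Borel set is harmless because null sets have null preimages within
`posSet (xbar μ₀)`. -/
theorem map_flowMap_restrict (t : ℝ) {A : Set ℝ} (hA : NullMeasurableSet A volume) :
    ((acPart (μ₀ : Measure ℝ)).restrict A).map (flowMap u₀ μ₀ t) =
      ((derivMeasure (zbar μ₀)).restrict (posSet (xbar μ₀) ∩ xbar μ₀ ⁻¹' A)).map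
        (charY u₀ μ₀ t) := by
  have hL := lipschitzWith_xbar μ₀
  have hmeas : Measurable (xbar μ₀) := hL.continuous.measurable
  obtain ⟨A', hA', hAA'⟩ := hA
  have hac : acPart (μ₀ : Measure ℝ) ≪ volume := withDensity_absolutelyContinuous _ _
  rw [Measure.restrict_congr_set (hac.ae_eq hAA'), acPart_eq_map_posSet,
    Measure.restrict_map hmeas hA', Measure.restrict_restrict (hmeas hA'),
    Measure.map_map (measurable_flowMap t) hmeas]
  have e : (xbar μ₀ ⁻¹' A' ∩ posSet (xbar μ₀) : Set ℝ) =ᵐ[derivMeasure (zbar μ₀)]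
      (posSet (xbar μ₀) ∩ xbar μ₀ ⁻¹' A : Set ℝ) := by
    refine (derivMeasure_absolutelyContinuous _).ae_eq ?_
    filter_upwards [null_preimage_inter_posSet hL (monotone_xbar μ₀) (surjective_xbar μ₀) hAA']
      with α h1
    apply propext
    change (xbar μ₀ α ∈ A' ∧ α ∈ posSet (xbar μ₀)) ↔ (α ∈ posSet (xbar μ₀) ∧ xbar μ₀ α ∈ A)
    rw [and_comm]
    exact and_congr_right fun h => (iff_of_eq (h1 h)).symm
  rw [← Measure.restrict_congr_set e]
  refine Measure.map_congr ?_
  filter_upwards [ae_restrict_mem ((hmeas hA').inter (measurableSet_posSet _))] with α hα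
  exact (charY_eq_flowMap t hα.2).symm

theorem isOpen_intervalPart (A : Set ℝ) : IsOpen (intervalPart μ₀ A) := by
  rw [isOpen_iff_forall_mem_open]
  rintro x ⟨a, b, hx, h⟩
  exact ⟨Ioo a b, fun z hz => ⟨a, b, hz, h⟩, isOpen_Ioo, hx⟩

theorem InD.singularPart_eq (h₀ : InD u₀ μ₀) : (μ₀ : Measure ℝ).singularPart volume =
    ((derivMeasure (zbar μ₀)).restrict (posSet (xbar μ₀))ᶜ).map (xbar μ₀) := by
  have h := h₀.lagChart.singularPart_eulEnergy
  rw [eulEnergy, map_xbar] at h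
  exact h

/-- Outside `posSet (xbar μ₀)` the energy density in labels is 1, so absence of singular energy
means that such labels form a Lebesgue null set. -/
theorem InD.ae_mem_posSet_of_singularPart (h₀ : InD u₀ μ₀) {a b : ℝ}
    (h : (μ₀ : Measure ℝ).singularPart volume (Ioo a b) = 0) :
    ∀ᵐ α, xbar μ₀ α ∈ Ioo a b → α ∈ posSet (xbar μ₀) := by
  have hmeas : Measurable (xbar μ₀) := (lipschitzWith_xbar μ₀).continuous.measurable
  rw [h₀.singularPart_eq, Measure.map_apply hmeas measurableSet_Ioo,
    Measure.restrict_apply (hmeas measurableSet_Ioo), measure_eq_zero_iff_ae_notMem, derivMeasure,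
    ae_withDensity_iff (by fun_prop)] at h
  filter_upwards [h, h₀.ae_charJac_of_zeroSet,
    ae_mem_posSet_or_zeroSet (lipschitzWith_xbar μ₀) (monotone_xbar μ₀)] with α h1 h2 h3 h4
  by_contra hcon
  have h5 := (h2 (h3.resolve_left hcon)).1
  exact h1 (by rw [h5]; simp) ⟨h4, hcon⟩

/-- The exceptional α are the least or greatest points of non-trivial level sets: at most two for
each of countably many values. -/
theorem ae_exists_lt_of_mem_multSet {y : ℝ → ℝ} (hm : Monotone y) :
    ∀ᵐ α, y α ∈ multSet y → ∃ p q, p < α ∧ α < q ∧ y p = y α ∧ y q = y α := by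
  have hc := countable_multSet hm
  have c1 : {α | y α ∈ multSet y ∧ ∀ β, y β = y α → α ≤ β}.Countable :=
    MapsTo.countable_of_injOn (f := y) (fun α h => h.1)
      (fun α hα β hβ h => le_antisymm (hα.2 β h.symm) (hβ.2 α h)) hc
  have c2 : {α | y α ∈ multSet y ∧ ∀ β, y β = y α → β ≤ α}.Countable :=
    MapsTo.countable_of_injOn (f := y) (fun α h => h.1)
      (fun α hα β hβ h => le_antisymm (hβ.2 α h) (hα.2 β h.symm)) hc
  filter_upwards [c1.ae_notMem volume, c2.ae_notMem volume] with α h1 h2 h3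
  simp only [not_and, not_forall, not_le] at h1 h2
  obtain ⟨p, hp, hp'⟩ := h1 h3
  obtain ⟨q, hq, hq'⟩ := h2 h3
  exact ⟨p, q, hp', hq', hp, hq⟩

theorem hasDerivAt_zero_of_const_Ioo {y : ℝ → ℝ} (hm : Monotone y) {p q : ℝ} (h : y p = y q) {α : ℝ}
    (hα : α ∈ Ioo p q) : HasDerivAt y 0 α := by
  refine (hasDerivAt_const α (y p)).congr_of_eventuallyEq ?_
  filter_upwards [Ioo_mem_nhds hα.1 hα.2] with β hβ
  exact le_antisymm (h ▸ hm hβ.2.le) (hm hβ.1.le)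

/-- On the preimage of the interval y_α = 0 almost everywhere, so y is constant there. The absence
of singular energy is needed because the labels with x̄' = 0 have y_α = t²/4 > 0. -/
theorem InD.mem_multSet_of_mem_intervalPart (h₀ : InD u₀ μ₀) {g : ℝ → ℝ} (hg : IsWeakDeriv u₀ g)
    {t : ℝ} (ht : t ≠ 0) {α : ℝ} (hα : xbar μ₀ α ∈ intervalPart μ₀ (singSet g t)) :
    charY u₀ μ₀ t α ∈ multSet (charY u₀ μ₀ t) := by
  have hL := lipschitzWith_xbar μ₀
  obtain ⟨a, b, hx, h1, h2⟩ := hα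
  obtain ⟨p, q, hpq, -, -, hpre⟩ := exists_preimage_Ioo hL.continuous (monotone_xbar μ₀)
    (surjective_xbar μ₀) (hx.1.trans hx.2)
  have h3 : ∀ᵐ x, x ∈ Ioo a b → x ∈ singSet g t := by
    filter_upwards [measure_eq_zero_iff_ae_notMem.1 h1] with x hx hx'
    by_contra hcon
    exact hx ⟨hx', hcon⟩
  obtain ⟨K, hK⟩ := (h₀.chart t).lip_y
  have hmem : α ∈ Ioo p q := by rw [← hpre]; exact hx
  have h4 : ∀ᵐ β, β ∈ Ioo p q → HasDerivAt (charY u₀ μ₀ t) 0 β := by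
    filter_upwards [h₀.ae_mem_posSet_of_singularPart h2,
      null_preimage_inter_posSet hL (monotone_xbar μ₀) (surjective_xbar μ₀) h3,
      h₀.zeroSet_ae_eq hg ht] with β k1 k2 k3 hβ
    rw [← hpre] at hβ
    have k4 := k1 hβ
    exact (iff_of_eq k3).2 ⟨k4, k2 k4 hβ⟩
  have h5 := hK.eq_of_ae_hasDerivAt_zero h4 (c := α) (d := q) ⟨hmem.1.le, hmem.2.le⟩
    ⟨hpq.le, le_rfl⟩
  exact ⟨α, q, hmem.2, rfl, h5.symm⟩

/-- For almost every such α the level set extends to labels p < α < q. Between them y_α = 0, so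
almost all labels there lie in `posSet (xbar μ₀)` over the singular set. The interval (x̄(p), x̄(q))
is then admissible, and it contains x̄(α) strictly since x̄ is injective at α. -/
theorem InD.ae_mem_intervalPart (h₀ : InD u₀ μ₀) {g : ℝ → ℝ} (hg : IsWeakDeriv u₀ g)
    {t : ℝ} (ht : t ≠ 0) : ∀ᵐ α, charY u₀ μ₀ t α ∈ multSet (charY u₀ μ₀ t) →
      α ∈ posSet (xbar μ₀) → xbar μ₀ α ∈ intervalPart μ₀ (singSet g t) := by
  have hL := lipschitzWith_xbar μ₀
  have hm := monotone_xbar μ₀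
  have hmeas : Measurable (xbar μ₀) := hL.continuous.measurable
  filter_upwards [ae_exists_lt_of_mem_multSet (h₀.chart t).mono_y] with α h1 h2 h3
  obtain ⟨p, q, hp, hq, ep, eq⟩ := h1 h2
  have hz : ∀ β ∈ Ioo p q, β ∈ zeroSet (charY u₀ μ₀ t) := fun β hβ =>
    hasDerivAt_zero_of_const_Ioo (h₀.chart t).mono_y (ep.trans eq.symm) hβ
  have hgood : ∀ᵐ β, β ∈ Ioo p q → β ∈ posSet (xbar μ₀) ∩ xbar μ₀ ⁻¹' singSet g t := by
    filter_upwards [h₀.zeroSet_ae_eq hg ht] with β k1 k2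
    exact (iff_of_eq k1).1 (hz β k2)
  have hpre : ∀ β, xbar μ₀ β ∈ Ioo (xbar μ₀ p) (xbar μ₀ q) → β ∈ Ioo p q := fun β hβ =>
    ⟨not_le.1 fun h => absurd (hm h) (not_le.2 hβ.1), not_le.1 fun h => absurd (hm h) (not_le.2 hβ.2)⟩
  have hbad : volume {β | ¬ (β ∈ Ioo p q → β ∈ posSet (xbar μ₀) ∩ xbar μ₀ ⁻¹' singSet g t)} = 0 :=
    hgood
  refine ⟨xbar μ₀ p, xbar μ₀ q, ⟨?_, ?_⟩, ?_, ?_⟩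
  · refine lt_of_le_of_ne (hm hp.le) fun h => ?_
    exact hp.ne (eq_of_mem_posSet hm h3 h)
  · refine lt_of_le_of_ne (hm hq.le) fun h => ?_
    exact hq.ne' (eq_of_mem_posSet hm h3 h.symm)
  · refine measure_mono_null ?_ (volume_image_eq_zero_of_lipschitz hL hbad)
    rintro x ⟨hx1, hx2⟩
    obtain ⟨β, rfl⟩ := surjective_xbar μ₀ x
    refine ⟨β, fun h => hx2 ?_, rfl⟩
    exact (h (hpre β hx1)).2
  · rw [h₀.singularPart_eq, Measure.map_apply hmeas measurableSet_Ioo,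
      Measure.restrict_apply (hmeas measurableSet_Ioo)]
    refine derivMeasure_absolutelyContinuous _ (measure_mono_null ?_ hbad)
    rintro β ⟨hβ1, hβ2⟩ h
    exact hβ2 (h (hpre β hβ1)).1

theorem InD.zeroSet_inter_ae_eq (h₀ : InD u₀ μ₀) {g : ℝ → ℝ} (hg : IsWeakDeriv u₀ g)
    {t : ℝ} (ht : t ≠ 0) : ∀ᵐ α, α ∈ zeroSet (charY u₀ μ₀ t) ↔
      (α ∈ posSet (xbar μ₀) ∧ xbar μ₀ α ∈ singSet g t) := by
  filter_upwards [h₀.zeroSet_ae_eq hg ht] with α h using iff_of_eq h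

theorem InD.ppPart_eq_flowMap (h₀ : InD u₀ μ₀) {g : ℝ → ℝ} (hg : IsWeakDeriv u₀ g)
    {t : ℝ} (ht : t ≠ 0) : ppPart (h₀.energy t : Measure ℝ) = ((acPart (μ₀ : Measure ℝ)).restrict
      (singSet g t ∩ intervalPart μ₀ (singSet g t))).map (flowMap u₀ μ₀ t) := by
  rw [h₀.ppPart_energy, map_flowMap_restrict t ((nullMeasurableSet_singSet hg t).inter
    (isOpen_intervalPart _).measurableSet.nullMeasurableSet), lagPP_eq]
  congr 1
  refine Measure.restrict_congr_set ((derivMeasure_absolutelyContinuous _).ae_eq ?_)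
  filter_upwards [h₀.zeroSet_inter_ae_eq hg ht, h₀.ae_mem_intervalPart hg ht] with α h1 h2
  apply propext
  change (α ∈ zeroSet (charY u₀ μ₀ t) ∧ charY u₀ μ₀ t α ∈ multSet (charY u₀ μ₀ t)) ↔
    (α ∈ posSet (xbar μ₀) ∧ xbar μ₀ α ∈ singSet g t ∧
      xbar μ₀ α ∈ intervalPart μ₀ (singSet g t))
  rw [h1]
  constructor
  · rintro ⟨⟨k1, k2⟩, k3⟩
    exact ⟨k1, k2, h2 k3 k1⟩
  · rintro ⟨k1, k2, k3⟩
    exact ⟨⟨k1, k2⟩, h₀.mem_multSet_of_mem_intervalPart hg ht k3⟩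

theorem InD.scPart_eq_flowMap (h₀ : InD u₀ μ₀) {g : ℝ → ℝ} (hg : IsWeakDeriv u₀ g)
    {t : ℝ} (ht : t ≠ 0) : scPart (h₀.energy t : Measure ℝ) = ((acPart (μ₀ : Measure ℝ)).restrict
      (singSet g t \ intervalPart μ₀ (singSet g t))).map (flowMap u₀ μ₀ t) := by
  rw [h₀.scPart_energy, map_flowMap_restrict t ((nullMeasurableSet_singSet hg t).diff
    (isOpen_intervalPart _).measurableSet.nullMeasurableSet), lagSC_eq]
  congr 1
  refine Measure.restrict_congr_set ((derivMeasure_absolutelyContinuous _).ae_eq ?_)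
  filter_upwards [h₀.zeroSet_inter_ae_eq hg ht, h₀.ae_mem_intervalPart hg ht] with α h1 h2
  apply propext
  change (α ∈ zeroSet (charY u₀ μ₀ t) ∧ ¬ charY u₀ μ₀ t α ∈ multSet (charY u₀ μ₀ t)) ↔
    (α ∈ posSet (xbar μ₀) ∧ xbar μ₀ α ∈ singSet g t ∧
      ¬ xbar μ₀ α ∈ intervalPart μ₀ (singSet g t))
  rw [h1]
  constructor
  · rintro ⟨⟨k1, k2⟩, k3⟩
    exact ⟨k1, k2, fun k4 => k3 (h₀.mem_multSet_of_mem_intervalPart hg ht k4)⟩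
  · rintro ⟨k1, k2, k3⟩
    exact ⟨⟨k1, k2⟩, fun k4 => k3 (h2 k4 k1)⟩

/-! ### Singular times -/

/-- Disjoint measurable sets: a σ-finite measure charges at most countably many of them. -/
theorem countable_singular :
    {t : ℝ | volume (posSet (xbar μ₀) ∩ xbar μ₀ ⁻¹' singSet (deriv u₀) t) ≠ 0}.Countable := by
  have hmeas : Measurable (xbar μ₀) := (lipschitzWith_xbar μ₀).continuous.measurable
  have h := Measure.countable_meas_pos_of_disjoint_iUnion (μ := (volume : Measure ℝ))
    (As := fun t : ℝ => posSet (xbar μ₀) ∩ xbar μ₀ ⁻¹' singSet (deriv u₀) t)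
    (fun t => (measurableSet_posSet _).inter
      (hmeas (measurableSet_eq_fun (measurable_deriv _) measurable_const)))
    (fun s t hst => by
      rw [Function.onFun, Set.disjoint_left]
      rintro α ⟨-, h1⟩ ⟨-, h2⟩
      -- With the convention -2 / 0 = 0, the map t ↦ -2 / t is injective on all of ℝ, so t = 0 needs
      -- no separate case here.
      have e : -2 / s = -2 / t := Eq.trans (Eq.symm h1) h2
      rw [div_eq_mul_inv, div_eq_mul_inv] at e
      exact hst (inv_injective (mul_left_cancel₀ (by norm_num) e)))
  exact h.mono fun t ht => pos_iff_ne_zero.2 ht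

theorem InD.derivMeasure_zeroSet_of_volume (h₀ : InD u₀ μ₀) {t : ℝ} (ht : t ≠ 0)
    (h : volume (posSet (xbar μ₀) ∩ xbar μ₀ ⁻¹' singSet (deriv u₀) t) = 0) :
    derivMeasure (zbar μ₀) (zeroSet (charY u₀ μ₀ t)) = 0 := by
  refine derivMeasure_absolutelyContinuous _ ?_
  rw [measure_congr (h₀.zeroSet_ae_eq h₀.isWeakDeriv ht), h]

theorem InD.countable_singular_times (h₀ : InD u₀ μ₀) :
    {t : ℝ | derivMeasure (zbar μ₀) (zeroSet (charY u₀ μ₀ t)) ≠ 0}.Countable := by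
  refine ((countable_singular (u₀ := u₀) (μ₀ := μ₀)).union (countable_singleton 0)).mono fun t ht => ?_
  by_cases h0 : t = 0
  · exact Or.inr h0
  · exact Or.inl fun h => ht (h₀.derivMeasure_zeroSet_of_volume h0 h)

theorem InD.countable_ppPart (h₀ : InD u₀ μ₀) :
    {t : ℝ | ppPart (h₀.energy t : Measure ℝ) ≠ 0}.Countable := by
  refine Set.Countable.mono (fun t ht => ?_) h₀.countable_singular_times
  intro h
  refine ht ?_
  have := measure_mono_null (subset_union_left.trans (lagPP_union_lagSC t).subset) h
  rw [h₀.ppPart_energy, Measure.restrict_eq_zero.2 this, Measure.map_zero]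

theorem InD.countable_scPart (h₀ : InD u₀ μ₀) :
    {t : ℝ | scPart (h₀.energy t : Measure ℝ) ≠ 0}.Countable := by
  refine Set.Countable.mono (fun t ht => ?_) h₀.countable_singular_times
  intro h
  refine ht ?_
  have := measure_mono_null (subset_union_right.trans (lagPP_union_lagSC t).subset) h
  rw [h₀.scPart_energy, Measure.restrict_eq_zero.2 this, Measure.map_zero]

theorem InD.energy_ae_eq (h₀ : InD u₀ μ₀) :
    ∀ᵐ t : ℝ, (h₀.energy t : Measure ℝ) = sqMeasure (deriv (h₀.vel t)) := by
  filter_upwards [h₀.countable_singular_times.ae_notMem volume] with t ht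
  simp only [not_not] at ht
  obtain ⟨K, hK⟩ := (h₀.chart t).lip_y
  have h1 : derivMeasure (zbar μ₀) (posSet (charY u₀ μ₀ t))ᶜ = 0 := by
    rw [measure_congr ((derivMeasure_absolutelyContinuous _).ae_eq
      (compl_posSet_ae_eq hK (h₀.chart t).mono_y)), ht]
  rw [h₀.coe_energy, (h₀.chart t).eulEnergy_eq_add, Measure.restrict_eq_zero.2 h1,
    Measure.map_zero, zero_add]
  rfl

theorem InD.isConservativeSolution (h₀ : InD u₀ μ₀) :
    IsConservativeSolution u₀ μ₀ h₀.vel h₀.energy :=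
  ⟨fun t => deriv (h₀.vel t), h₀.continuous_vel, h₀.locHolderHalf, ⟨_, h₀.isL2locTimeDeriv⟩,
    h₀.isWeakDeriv_vel, h₀.memLp_deriv_vel, h₀.continuous_energy, h₀.vel_zero, h₀.energy_zero,
    h₀.energy_ae_eq, fun _ hφ => h₀.momentum_equation hφ, fun _ hφ => h₀.energy_equation hφ,
    h₀.acPart_energy⟩

/-! ### The space derivative as a curve in `L²` -/

/-- In a second countable metric space every open set is a countable union of balls, so
measurability of all the distances suffices. For `derivLp` these distances are parametric integrals
of a jointly measurable function. -/
theorem stronglyMeasurable_of_measurable_edist {E : Type*} [MetricSpace E]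
    [SecondCountableTopology E] {U : ℝ → E} (h : ∀ c, Measurable fun t => edist (U t) c) :
    StronglyMeasurable U := by
  borelize E
  refine Measurable.stronglyMeasurable (measurable_of_isOpen fun s hs => ?_)
  have hε : ∀ x : s, ∃ ε : ℝ≥0∞, 0 < ε ∧ Metric.eball (x : E) ε ⊆ s := fun x =>
    EMetric.isOpen_iff.1 hs x x.2
  choose ε hε0 hεs using hε
  obtain ⟨T, hT, hTs⟩ := TopologicalSpace.isOpen_iUnion_countable
    (fun x : s => Metric.eball (x : E) (ε x)) (fun x => Metric.isOpen_eball)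
  have e : s = ⋃ x ∈ T, Metric.eball (x : E) (ε x) := by
    rw [hTs]
    refine Subset.antisymm (fun x hx => ?_) (iUnion_subset hεs)
    exact mem_iUnion.2 ⟨⟨x, hx⟩, Metric.mem_eball_self (hε0 _)⟩
  rw [e, preimage_iUnion₂]
  exact MeasurableSet.biUnion hT fun x _ => measurableSet_lt (h x) measurable_const

/-- The space derivative of the explicit solution, as an element of `L²`. -/
noncomputable def InD.derivLp (h₀ : InD u₀ μ₀) (t : ℝ) : Lp ℝ 2 (volume : Measure ℝ) :=
  (h₀.memLp_deriv_vel t).toLp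

theorem InD.stronglyMeasurable_derivLp (h₀ : InD u₀ μ₀) : StronglyMeasurable h₀.derivLp := by
  have : Fact ((2 : ℝ≥0∞) ≠ ⊤) := ⟨by norm_num⟩
  refine stronglyMeasurable_of_measurable_edist fun c => ?_
  have e : ∀ t, edist (h₀.derivLp t) c =
      (∫⁻ x, ‖deriv (h₀.vel t) x - c x‖ₑ ^ (2 : ℝ)) ^ (1 / (2 : ℝ)) := fun t => by
    conv_lhs => rw [← Lp.toLp_coeFn c (Lp.memLp c)]
    rw [InD.derivLp, Lp.edist_toLp_toLp,
      eLpNorm_eq_lintegral_rpow_enorm_toReal (by norm_num) (by norm_num)]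
    simp
  simp only [e]
  refine Measurable.pow_const ?_ _
  refine Measurable.lintegral_prod_right' (f := fun p : ℝ × ℝ =>
    ‖deriv (h₀.vel p.1) p.2 - c p.2‖ₑ ^ (2 : ℝ)) ?_
  have h1 : Measurable fun p : ℝ × ℝ => deriv (h₀.vel p.1) p.2 := by
    have := h₀.measurable_deriv_vel.comp (measurable_swap (α := ℝ) (β := ℝ))
    exact this
  have h2 : Measurable fun p : ℝ × ℝ => c p.2 :=
    (Lp.stronglyMeasurable c).measurable.comp measurable_snd
  exact (h1.sub h2).enorm.pow_const _

theorem InD.norm_derivLp_le (h₀ : InD u₀ μ₀) (t : ℝ) :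
    ‖h₀.derivLp t‖ ≤ √((μ₀ : Measure ℝ).real univ) := by
  refine Real.le_sqrt_of_sq_le ?_
  rw [← real_inner_self_eq_norm_sq, L2.inner_def]
  have e : ∫ x, inner ℝ (h₀.derivLp t x) (h₀.derivLp t x) = ∫ x, deriv (h₀.vel t) x ^ 2 := by
    refine integral_congr_ae ?_
    filter_upwards [(h₀.memLp_deriv_vel t).coeFn_toLp] with x hx
    rw [InD.derivLp, hx]
    simp [sq]
  rw [e, ← setIntegral_univ, setIntegral_sq_eq (h₀.memLp_deriv_vel t) MeasurableSet.univ,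
    ← h₀.acPart_energy, ← h₀.energy_real_univ t]
  exact ENNReal.toReal_mono (measure_ne_top _ _) (acPart_le _ _)

theorem InD.exists_derivLp (h₀ : InD u₀ μ₀) : ∃ U : ℝ → Lp ℝ 2 (volume : Measure ℝ),
    (∀ t, IsWeakDeriv (h₀.vel t) (U t)) ∧ MemLp U ⊤ (volume : Measure ℝ) :=
  ⟨h₀.derivLp, fun t => (h₀.isWeakDeriv_vel t).congr_deriv (h₀.memLp_deriv_vel t).coeFn_toLp.symm,
    memLp_top_of_bound h₀.stronglyMeasurable_derivLp.aestronglyMeasurable _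
      (ae_of_all _ h₀.norm_derivLp_le)⟩

end HunterSaxton

namespace HunterSaxton

/-! ### Transport of the energy by an arbitrary conservative solution -/

/-- The pairing of a norm-continuous function with a weakly continuous measure: the masses converge,
so the error ‖G p - G p₀‖ · mass tends to zero. -/
theorem continuous_integral_boundedContinuous {X : Type*} [TopologicalSpace X] {G : X → ℝ →ᵇ ℝ}
    (hG : Continuous G) {m : X → FiniteMeasure ℝ} (hm : Continuous m) :
    Continuous fun p => ∫ x, G p x ∂(m p : Measure ℝ) := by
  rw [continuous_iff_continuousAt]
  intro p₀
  have h1 : Tendsto (fun p => ∫ x, G p₀ x ∂(m p : Measure ℝ)) (𝓝 p₀)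
      (𝓝 (∫ x, G p₀ x ∂(m p₀ : Measure ℝ))) :=
    FiniteMeasure.tendsto_iff_forall_integral_tendsto.1 (hm.tendsto p₀) (G p₀)
  have h2 : Tendsto (fun p => ‖G p - G p₀‖ * (m p : Measure ℝ).real univ) (𝓝 p₀) (𝓝 0) := by
    have a := ((hG.tendsto p₀).sub_const (G p₀)).norm
    rw [sub_self, norm_zero] at a
    have b : Tendsto (fun p => (m p : Measure ℝ).real univ) (𝓝 p₀)
        (𝓝 ((m p₀ : Measure ℝ).real univ)) := by
      have := FiniteMeasure.tendsto_iff_forall_integral_tendsto.1 (hm.tendsto p₀)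
        (BoundedContinuousFunction.const ℝ (1 : ℝ))
      simpa using this
    simpa using a.mul b
  have h3 : Tendsto (fun p => ∫ x, (G p - G p₀) x ∂(m p : Measure ℝ)) (𝓝 p₀) (𝓝 0) := by
    refine squeeze_zero_norm (fun p => ?_) h2
    exact norm_integral_le_of_norm_le_const (ae_of_all _ fun x => (G p - G p₀).norm_coe_le_norm x)
  have h4 := h3.add h1
  rw [zero_add] at h4
  refine h4.congr fun p => ?_
  rw [← integral_add ((G p - G p₀).integrable _) ((G p₀).integrable _)]
  simp

theorem exists_boundedContinuous_translate {f : ℝ → ℝ} (hf : Continuous f)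
    (hs : HasCompactSupport f) :
    ∃ Ψ : ℝ → ℝ →ᵇ ℝ, Continuous Ψ ∧ ∀ s x, Ψ s x = f (x - s) := by
  obtain ⟨C, hC⟩ := hs.exists_bound_of_continuous hf
  refine ⟨fun s => BoundedContinuousFunction.ofNormedAddCommGroup (fun x => f (x - s))
    (hf.comp (continuous_id.sub continuous_const)) C fun x => hC _, ?_, fun s x => rfl⟩
  have hu := hs.uniformContinuous_of_continuous hf
  rw [Metric.uniformContinuous_iff] at hu
  rw [Metric.continuous_iff]
  intro s ε hε
  obtain ⟨δ, hδ, H⟩ := hu (ε / 2) (half_pos hε)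
  refine ⟨δ, hδ, fun r hr => ?_⟩
  refine lt_of_le_of_lt ((BoundedContinuousFunction.dist_le (half_pos hε).le).2 fun x => ?_)
    (half_lt_self hε)
  refine (H ?_).le
  rw [Real.dist_eq] at hr ⊢
  rw [show x - r - (x - s) = -(r - s) by ring, abs_neg]
  exact hr

/-- A continuous function whose distributional derivative is continuous is C¹: A minus a primitive
of h is constant. This upgrades both weak equations to statements at every time. -/
theorem hasDerivAt_of_integral_deriv_mul_add {A h : ℝ → ℝ} (hA : Continuous A) (hh : Continuous h)
    (H : ∀ χ : ℝ → ℝ, ContDiff ℝ ∞ χ → HasCompactSupport χ →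
      ∫ t, (deriv χ t * A t + χ t * h t) = 0) (t : ℝ) : HasDerivAt A (h t) t := by
  set P : ℝ → ℝ := fun t => ∫ s in (0:ℝ)..t, h s with hP
  have hPd : ∀ t, HasDerivAt P (h t) t := fun t => hh.integral_hasStrictDerivAt 0 t |>.hasDerivAt
  have hPc : Continuous P := continuous_iff_continuousAt.2 fun t => (hPd t).continuousAt
  obtain ⟨c, hc⟩ := ae_eq_const_of_integral_mul_deriv_eq_zero (w := fun t => A t - P t)
    (hA.sub hPc).locallyIntegrable fun χ hχ hs => by
      have hd : ∀ t, HasDerivAt χ (deriv χ t) t := fun t =>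
        (hχ.differentiable (by simp) t).hasDerivAt
      have hdc : Continuous (deriv χ) := hχ.continuous_deriv (by simp)
      obtain ⟨R, hR, hsup⟩ := exists_support_subset_Ioc hs
      have h0 : ∫ t, (deriv χ t * P t + χ t * h t) = 0 :=
        integral_eq_zero_of_hasDerivAt_of_support (f := fun t => χ t * P t)
          (fun t => (hd t).mul (hPd t)) ((hdc.mul hPc).add (hχ.continuous.mul hh)) (R := R)
          fun t ht => by
            by_contra hne
            have := hsup t (left_ne_zero_of_mul hne)
            exact ht (abs_le.2 ⟨this.1.le, this.2.le⟩)
      have i1 : Integrable fun t => deriv χ t * A t + χ t * h t :=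
        ((hdc.mul hA).integrable_of_hasCompactSupport hs.deriv.mul_right).add
          ((hχ.continuous.mul hh).integrable_of_hasCompactSupport hs.mul_right)
      have i2 : Integrable fun t => deriv χ t * P t + χ t * h t :=
        ((hdc.mul hPc).integrable_of_hasCompactSupport hs.deriv.mul_right).add
          ((hχ.continuous.mul hh).integrable_of_hasCompactSupport hs.mul_right)
      have e := integral_sub i1 i2
      rw [H χ hχ hs, h0, sub_zero] at e
      rw [← e]
      congr 1; funext t; ring
  have e : (fun t => A t - P t) = fun _ => c :=
    (Continuous.ae_eq_iff_eq volume (hA.sub hPc) continuous_const).1 hc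
  have e' : A = fun t => P t + c := funext fun t => by
    have := congrFun e t
    linarith
  rw [e']
  exact (hPd t).add_const c

theorem isTestFun_mul_translate {χ ψ : ℝ → ℝ} (hχ : ContDiff ℝ ∞ χ) (hχs : HasCompactSupport χ)
    (hψ : ContDiff ℝ ∞ ψ) (hψs : HasCompactSupport ψ) (c : ℝ) :
    IsTestFun fun p => χ p.2 * ψ (p.1 - c * p.2) := by
  refine ⟨(hχ.comp contDiff_snd).mul (hψ.comp (contDiff_fst.sub (contDiff_const.mul contDiff_snd))),
    ?_⟩
  have hK : IsCompact ((fun q : ℝ × ℝ => (q.1 + c * q.2, q.2)) '' (tsupport ψ ×ˢ tsupport χ)) :=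
    (hψs.isCompact.prod hχs.isCompact).image (by fun_prop)
  refine HasCompactSupport.intro hK fun p hp => ?_
  by_contra hne
  refine hp ⟨(p.1 - c * p.2, p.2), ⟨subset_tsupport _ (right_ne_zero_of_mul hne),
    subset_tsupport _ (left_ne_zero_of_mul hne)⟩, ?_⟩
  simp

theorem dX_mul_translate {χ ψ : ℝ → ℝ} (hψ : ContDiff ℝ ∞ ψ) (c x t : ℝ) :
    dX (fun p => χ p.2 * ψ (p.1 - c * p.2)) x t = χ t * deriv ψ (x - c * t) := by
  have h := ((hψ.differentiable (by simp) (x - c * t)).hasDerivAt.comp x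
    ((hasDerivAt_id x).sub_const (c * t))).const_mul (χ t)
  rw [mul_one] at h
  exact h.deriv

theorem dT_mul_translate {χ ψ : ℝ → ℝ} (hχ : ContDiff ℝ ∞ χ) (hψ : ContDiff ℝ ∞ ψ) (c x t : ℝ) :
    dT (fun p => χ p.2 * ψ (p.1 - c * p.2)) x t =
      deriv χ t * ψ (x - c * t) - χ t * (c * deriv ψ (x - c * t)) := by
  have h := (hχ.differentiable (by simp) t).hasDerivAt.mul
    ((hψ.differentiable (by simp) (x - c * t)).hasDerivAt.comp t
      (((hasDerivAt_id t).const_mul c).const_sub x))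
  refine h.deriv.trans ?_
  simp only [Function.comp, id]; ring

variable {u₀ : ℝ →ᵇ ℝ} {μ₀ : FiniteMeasure ℝ} {v : ℝ → ℝ →ᵇ ℝ} {ν : ℝ → FiniteMeasure ℝ}
  {vx : ℝ → ℝ → ℝ}

namespace IsConservativeSolutionWith

theorem energyBound (h : IsConservativeSolutionWith u₀ μ₀ v ν vx) (t : ℝ) :
    EnergyBound (v t) (ν t : Measure ℝ) :=
  energyBound_of_acPart_eq (h.space_deriv t) (v t).continuous (h.ac_part t)

/-- Test functions χ(t) ψ(x - c t) put the energy equation in a frame moving at speed c. Both sides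
are continuous in time, so the identity holds classically. -/
theorem hasDerivAt_integral_translate (h : IsConservativeSolutionWith u₀ μ₀ v ν vx) {ψ : ℝ → ℝ}
    (hψ : ContDiff ℝ ∞ ψ) (hs : HasCompactSupport ψ) (c t : ℝ) :
    HasDerivAt (fun t => ∫ x, ψ (x - c * t) ∂(ν t : Measure ℝ))
      (∫ x, (v t x - c) * deriv ψ (x - c * t) ∂(ν t : Measure ℝ)) t := by
  obtain ⟨Ψ, hΨ, eΨ⟩ := exists_boundedContinuous_translate hψ.continuous hs
  obtain ⟨Ψ', hΨ', eΨ'⟩ := exists_boundedContinuous_translate (hψ.continuous_deriv (by simp))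
    hs.deriv
  have hct : Continuous fun t : ℝ => c * t := continuous_const.mul continuous_id
  have cA := continuous_integral_boundedContinuous (hΨ.comp hct) h.continuous_μ
  have ch := continuous_integral_boundedContinuous
    ((h.continuous_u.sub (continuous_const (y := BoundedContinuousFunction.const ℝ c))).mul
      (hΨ'.comp hct)) h.continuous_μ
  have eA : ∀ t x, (Ψ ∘ fun t => c * t) t x = ψ (x - c * t) := fun t x => eΨ _ _
  have eh : ∀ t x, ((v t - BoundedContinuousFunction.const ℝ c) * (Ψ' ∘ fun t => c * t) t) x =
      (v t x - c) * deriv ψ (x - c * t) := fun t x => by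
    simp [eΨ']
  have iA : ∀ t, Integrable (fun x => ψ (x - c * t)) (ν t : Measure ℝ) := fun t => by
    simp only [← eA]; exact BoundedContinuousFunction.integrable _ _
  have ih : ∀ t, Integrable (fun x => (v t x - c) * deriv ψ (x - c * t)) (ν t : Measure ℝ) :=
    fun t => by simp only [← eh]; exact BoundedContinuousFunction.integrable _ _
  simp only [eA] at cA
  replace ch : Continuous fun t => ∫ x, (v t x - c) * deriv ψ (x - c * t) ∂(ν t : Measure ℝ) := by
    refine ch.congr fun t => integral_congr_ae (ae_of_all _ fun x => eh t x)
  refine hasDerivAt_of_integral_deriv_mul_add cA ch (fun χ hχ hχs => ?_) t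
  rw [← h.energy _ (isTestFun_mul_translate hχ hχs hψ hs c)]
  congr 1; funext t
  rw [← integral_const_mul, ← integral_const_mul,
    ← integral_add ((iA t).const_mul _) ((ih t).const_mul _)]
  congr 1; funext x
  rw [dX_mul_translate hψ, dT_mul_translate hχ hψ]
  ring

/-- Comparison along a line of slope `c`. -/
theorem integral_translate_le (h : IsConservativeSolutionWith u₀ μ₀ v ν vx) {ψ : ℝ → ℝ}
    (hψ : ContDiff ℝ ∞ ψ) (h1 : ∀ x, |ψ x| ≤ 1) {c s t : ℝ}
    (hsign : ∀ r ∈ uIcc s t, ∀ x, 0 ≤ (v r x - c) * deriv ψ (x - c * r) * (t - s)) :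
    ∫ x, ψ (x - c * s) ∂(ν s : Measure ℝ) ≤ ∫ x, ψ (x - c * t) ∂(ν t : Measure ℝ) := by
  let b : ContDiffBump (0 : ℝ) := ⟨1, 2, by norm_num, by norm_num⟩
  have hb : ContDiff ℝ ∞ b := b.contDiff
  obtain ⟨C, hC⟩ := b.hasCompactSupport.deriv.exists_bound_of_continuous
    (hb.continuous_deriv (by simp))
  have hC0 : 0 ≤ C := (norm_nonneg _).trans (hC 0)
  have hcB : Continuous fun r => (‖v r‖ + |c|) * (ν r : Measure ℝ).real univ := by
    have := continuous_integral_boundedContinuous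
      (continuous_const (y := BoundedContinuousFunction.const ℝ (1 : ℝ))) h.continuous_μ
    simp only [BoundedContinuousFunction.const_apply, integral_const, smul_eq_mul, mul_one] at this
    exact (h.continuous_u.norm.add continuous_const).mul this
  obtain ⟨B, hB⟩ := (isCompact_uIcc (a := s) (b := t)).bddAbove_image hcB.continuousOn
  replace hB : ∀ r ∈ uIcc s t, (‖v r‖ + |c|) * (ν r : Measure ℝ).real univ ≤ B := fun r hr =>
    hB (mem_image_of_mem _ hr)
  -- ψ is not compactly supported, so it is cut off at scale n + 1. The derivative of the cutoff
  -- costs O(1/(n + 1)), which disappears in the limit.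
  set η : ℕ → ℝ → ℝ := fun n x => ψ x * b ((1 / ((n : ℝ) + 1)) * x) with hη
  have hηd : ∀ n x, HasDerivAt (η n) (deriv ψ x * b ((1 / ((n : ℝ) + 1)) * x) +
      ψ x * (deriv b ((1 / ((n : ℝ) + 1)) * x) * (1 / ((n : ℝ) + 1)))) x := fun n x => by
    have k := (hb.differentiable (by simp) ((1 / ((n : ℝ) + 1)) * x)).hasDerivAt.comp x
      ((hasDerivAt_id x).const_mul (1 / ((n : ℝ) + 1)))
    rw [mul_one] at k
    exact (hψ.differentiable (by simp) x).hasDerivAt.mul k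
  have hηc : ∀ n, ContDiff ℝ ∞ (η n) := fun n =>
    hψ.mul (hb.comp (contDiff_const.mul contDiff_id))
  have hηs : ∀ n, HasCompactSupport (η n) := fun n => by
    have : HasCompactSupport fun x : ℝ => b ((1 / ((n : ℝ) + 1)) * x) :=
      b.hasCompactSupport.comp_smul (c := 1 / ((n : ℝ) + 1)) (by positivity)
    exact this.mul_left
  have hlim : ∀ r, Tendsto (fun n => ∫ x, η n (x - c * r) ∂(ν r : Measure ℝ)) atTop
      (𝓝 (∫ x, ψ (x - c * r) ∂(ν r : Measure ℝ))) := fun r => by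
    refine tendsto_integral_of_dominated_convergence (fun _ => 1)
      (fun n => ((hηc n).continuous.comp (by fun_prop)).aestronglyMeasurable)
      (integrable_const _) (fun n => ae_of_all _ fun x => ?_) (ae_of_all _ fun x => ?_)
    · rw [hη, Real.norm_eq_abs, abs_mul, abs_of_nonneg (b.nonneg)]
      exact mul_le_one₀ (h1 _) b.nonneg b.le_one
    · have k : Tendsto (fun n : ℕ => (1 / ((n : ℝ) + 1)) * (x - c * r)) atTop (𝓝 0) := by
        simpa using (tendsto_one_div_add_atTop_nhds_zero_nat (𝕜 := ℝ)).mul_const (x - c * r)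
      have k2 := ((hb.continuous.tendsto 0).comp k).const_mul (ψ (x - c * r))
      rw [b.one_of_mem_closedBall (by simp [b]), mul_one] at k2
      exact k2
  have hstep : ∀ n : ℕ, ∫ x, η n (x - c * s) ∂(ν s : Measure ℝ) - |t - s| * (C * B) *
      (1 / ((n : ℝ) + 1)) ≤ ∫ x, η n (x - c * t) ∂(ν t : Measure ℝ) := fun n => by
    have hd := fun r => h.hasDerivAt_integral_translate (hηc n) (hηs n) c r
    set A : ℝ → ℝ := fun r => ∫ x, η n (x - c * r) ∂(ν r : Measure ℝ) with hA
    set D : ℝ → ℝ := fun r => ∫ x, (v r x - c) * deriv (η n) (x - c * r) ∂(ν r : Measure ℝ) with hD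
    -- The mean value theorem, written with the factor t - s so that it covers both time directions.
    obtain ⟨r, hr, e⟩ : ∃ r ∈ uIcc s t, A t - A s = D r * (t - s) := by
      rcases lt_trichotomy s t with hst | rfl | hst
      · obtain ⟨r, hr, e⟩ := exists_hasDerivAt_eq_slope A D hst
          (fun r _ => (hd r).continuousAt.continuousWithinAt) fun r _ => hd r
        refine ⟨r, by rw [uIcc_of_le hst.le]; exact Ioo_subset_Icc_self hr, ?_⟩
        have : t - s ≠ 0 := (sub_pos.2 hst).ne'
        rw [e]; field_simp
      · exact ⟨s, left_mem_uIcc, by simp⟩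
      · obtain ⟨r, hr, e⟩ := exists_hasDerivAt_eq_slope A D hst
          (fun r _ => (hd r).continuousAt.continuousWithinAt) fun r _ => hd r
        refine ⟨r, by rw [uIcc_of_ge hst.le]; exact Ioo_subset_Icc_self hr, ?_⟩
        have : s - t ≠ 0 := (sub_pos.2 hst).ne'
        rw [e]; field_simp; ring
    have key : ∀ x, -(|t - s| * (C * (‖v r‖ + |c|)) * (1 / ((n : ℝ) + 1))) ≤
        (v r x - c) * deriv (η n) (x - c * r) * (t - s) := fun x => by
      rw [(hηd n _).deriv]
      have k1 := mul_nonneg (hsign r hr x) (b.nonneg (x := (1 / ((n : ℝ) + 1)) * (x - c * r)))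
      have k2 : |(v r x - c) * (ψ (x - c * r) * (deriv b ((1 / ((n : ℝ) + 1)) * (x - c * r)) *
          (1 / ((n : ℝ) + 1)))) * (t - s)| ≤
          (‖v r‖ + |c|) * (1 * (C * (1 / ((n : ℝ) + 1)))) * |t - s| := by
        rw [abs_mul, abs_mul, abs_mul, abs_mul]
        have j1 : |v r x - c| ≤ ‖v r‖ + |c| :=
          (abs_sub _ _).trans (add_le_add ((v r).norm_coe_le_norm x) le_rfl)
        have j2 : |(1 / ((n : ℝ) + 1))| = 1 / ((n : ℝ) + 1) := abs_of_pos (by positivity)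
        rw [j2]
        have j3 := hC ((1 / ((n : ℝ) + 1)) * (x - c * r))
        rw [Real.norm_eq_abs] at j3
        have j4 := h1 (x - c * r)
        gcongr
      have k3 := (abs_le.1 k2).1
      linarith
    have hi : Integrable (fun x => (v r x - c) * deriv (η n) (x - c * r) * (t - s))
        (ν r : Measure ℝ) := by
      have k : Continuous fun x => (v r x - c) * deriv (η n) (x - c * r) * (t - s) :=
        ((((v r).continuous.sub continuous_const)).mul
          (((hηc n).continuous_deriv (by simp)).comp (by fun_prop))).mul continuous_const
      obtain ⟨C', hC'⟩ := (hηs n).deriv.exists_bound_of_continuous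
        ((hηc n).continuous_deriv (by simp))
      refine Integrable.of_bound k.aestronglyMeasurable ((‖v r‖ + |c|) * C' * |t - s|)
        (ae_of_all _ fun x => ?_)
      rw [norm_mul, norm_mul]
      have j1 : ‖v r x - c‖ ≤ ‖v r‖ + |c| :=
        (norm_sub_le _ _).trans (add_le_add ((v r).norm_coe_le_norm x) le_rfl)
      have j3 := hC' (x - c * r)
      rw [Real.norm_eq_abs (t - s)]
      gcongr
    have k := integral_mono (integrable_const _) hi key
    rw [integral_const, integral_mul_const, smul_eq_mul] at k
    have k4 : |t - s| * (C * (‖v r‖ + |c|)) * (1 / ((n : ℝ) + 1)) * (ν r : Measure ℝ).real univ ≤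
        |t - s| * (C * B) * (1 / ((n : ℝ) + 1)) := by
      have := mul_le_mul_of_nonneg_left (hB r hr)
        (show 0 ≤ |t - s| * C * (1 / ((n : ℝ) + 1)) by positivity)
      linarith
    have e' : A t = A s + D r * (t - s) := by linarith
    change A s - _ ≤ A t
    rw [e']
    linarith
  have hl := (hlim s).sub ((tendsto_one_div_add_atTop_nhds_zero_nat (𝕜 := ℝ)).const_mul
    (|t - s| * (C * B)))
  rw [mul_zero, sub_zero] at hl
  exact le_of_tendsto_of_tendsto' hl (hlim t) hstep

end IsConservativeSolutionWith

end HunterSaxton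

namespace HunterSaxton

/-! ### Quantiles of the energy -/

/-- The smallest `x` with `m((-∞, x]) ≥ β`. -/
noncomputable def quantile (m : Measure ℝ) (β : ℝ) : ℝ := sInf {x | β ≤ m.real (Iic x)}

/-- The Galois connection between quantiles and the distribution function; right continuity of the
latter makes the infimum attained. -/
theorem quantile_le_iff {m : Measure ℝ} [IsFiniteMeasure m] {β x : ℝ} (h0 : 0 < β)
    (h1 : β < m.real univ) : quantile m β ≤ x ↔ β ≤ m.real (Iic x) := by
  have hne : {x | β ≤ m.real (Iic x)}.Nonempty :=
    (((tendsto_real_Iic_atTop m).eventually_const_lt h1).exists).imp fun _ h => h.le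
  have hbdd : BddBelow {x | β ≤ m.real (Iic x)} := by
    obtain ⟨y, hy⟩ := ((tendsto_real_Iic_atBot m).eventually_lt_const h0).exists
    refine ⟨y, fun z hz => not_lt.1 fun hzy => ?_⟩
    have : m.real (Iic z) ≤ m.real (Iic y) := measureReal_mono (Iic_subset_Iic.2 hzy.le)
    have hz : β ≤ m.real (Iic z) := hz
    linarith
  refine ⟨fun h => ?_, fun h => csInf_le hbdd h⟩
  have hq : β ≤ m.real (Iic (quantile m β)) := by
    refine ge_of_tendsto' (tendsto_real_Iio_Iic m _) fun n => ?_
    obtain ⟨z, hz, hzq⟩ := exists_lt_of_csInf_lt hne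
      (lt_add_of_pos_right (quantile m β) (show 0 < 1 / ((n : ℝ) + 1) by positivity))
    have hz : β ≤ m.real (Iic z) := hz
    exact hz.trans (real_Iic_le_Iio m hzq)
  exact hq.trans (measureReal_mono (Iic_subset_Iic.2 h))

theorem measure_eq_of_quantile_eq {m m' : Measure ℝ} [IsFiniteMeasure m] [IsFiniteMeasure m']
    (hM : m.real univ = m'.real univ)
    (hq : ∀ β, 0 < β → β < m.real univ → quantile m β = quantile m' β) : m = m' := by
  have key : ∀ (n n' : Measure ℝ) [IsFiniteMeasure n] [IsFiniteMeasure n'],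
      n.real univ = n'.real univ →
      (∀ β, 0 < β → β < n.real univ → quantile n β = quantile n' β) →
      ∀ x, n.real (Iic x) ≤ n'.real (Iic x) := by
    intro n n' _ _ hn hnq x
    refine le_of_forall_lt fun β hβ => ?_
    obtain ⟨γ, hγ1, hγ2⟩ := exists_between hβ
    rcases le_or_gt γ 0 with h0 | h0
    · exact (hγ1.trans_le h0).trans_le measureReal_nonneg
    · have h1 : γ < n.real univ := hγ2.trans_le (measureReal_mono (subset_univ _))
      refine hγ1.trans_le ?_
      rw [← quantile_le_iff h0 (hn ▸ h1), ← hnq γ h0 h1, quantile_le_iff h0 h1]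
      exact hγ2.le
  refine Measure.ext_of_Iic _ _ fun x => ?_
  rw [← measureReal_eq_measureReal_iff]
  exact le_antisymm (key m m' hM hq x)
    (key m' m hM.symm (fun β h0 h1 => (hq β h0 (hM ▸ h1)).symm) x)

/-- Without atoms the distribution function has no jump, so at the quantile it cannot overshoot β.
-/
theorem real_Iic_quantile {m : Measure ℝ} [IsFiniteMeasure m] [NullSingletonClass m] {β : ℝ} (h0 : 0 < β)
    (h1 : β < m.real univ) : m.real (Iic (quantile m β)) = β := by
  refine le_antisymm ?_ ((quantile_le_iff h0 h1).1 le_rfl)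
  have e : m.real (Iic (quantile m β)) = m.real (Iio (quantile m β)) :=
    congrArg ENNReal.toReal (measure_congr Iio_ae_eq_Iic.symm)
  rw [e]
  refine le_of_tendsto' (tendsto_real_Iic_Iio m _) fun n => ?_
  refine (not_le.1 fun h => ?_).le
  have := (quantile_le_iff h0 h1).2 h
  have h2 : 0 < 1 / ((n : ℝ) + 1) := by positivity
  linarith

/-- Moved at constant speed, this step serves as a smooth substitute for the indicator of a
half-line; its derivative sees only a narrow layer ahead of the front. -/
theorem exists_smooth_step {a ε : ℝ} (hε : 0 < ε) : ∃ ψ : ℝ → ℝ, ContDiff ℝ ∞ ψ ∧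
    (∀ x, 0 ≤ ψ x ∧ ψ x ≤ 1) ∧ (∀ x ≤ a, ψ x = 1) ∧ (∀ x, a + ε ≤ x → ψ x = 0) ∧
    (∀ x, deriv ψ x ≤ 0) ∧ ∀ x, x ∉ Icc a (a + ε) → deriv ψ x = 0 := by
  set ψ : ℝ → ℝ := fun x => Real.smoothTransition (1 - (x - a) / ε) with hψ
  have h1 : ∀ x ≤ a, ψ x = 1 := fun x hx => Real.smoothTransition.one_of_one_le (by
    have : (x - a) / ε ≤ 0 := div_nonpos_of_nonpos_of_nonneg (by linarith) hε.le
    linarith)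
  have h0 : ∀ x, a + ε ≤ x → ψ x = 0 := fun x hx => Real.smoothTransition.zero_of_nonpos (by
    have : 1 ≤ (x - a) / ε := by rw [le_div_iff₀ hε]; linarith
    linarith)
  have hanti : Antitone ψ := fun x y hxy => Real.smoothTransition.monotone (by gcongr)
  refine ⟨ψ, Real.smoothTransition.contDiff.comp (by fun_prop), fun x =>
    ⟨Real.smoothTransition.nonneg _, Real.smoothTransition.le_one _⟩, h1, h0,
    fun x => hanti.deriv_nonpos, fun x hx => ?_⟩
  by_cases hxa : a ≤ x
  · refine IsLocalMin.deriv_eq_zero (Eventually.of_forall fun y => ?_)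
    rw [h0 x (not_le.1 fun h => hx ⟨hxa, h⟩).le]
    exact Real.smoothTransition.nonneg _
  · refine IsLocalMax.deriv_eq_zero (Eventually.of_forall fun y => ?_)
    rw [h1 x (not_le.1 hxa).le]
    exact Real.smoothTransition.le_one _

/-! ### Conservation of mass and motion of the quantiles -/

variable {u₀ : ℝ →ᵇ ℝ} {μ₀ : FiniteMeasure ℝ} {v : ℝ → ℝ →ᵇ ℝ} {ν : ℝ → FiniteMeasure ℝ}
  {vx : ℝ → ℝ → ℝ}

namespace IsConservativeSolutionWith

/-- For ψ = 1 the sign condition of `integral_translate_le` is trivial in both time directions. -/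
theorem real_univ (h : IsConservativeSolutionWith u₀ μ₀ v ν vx) (t : ℝ) :
    (ν t : Measure ℝ).real univ = (μ₀ : Measure ℝ).real univ := by
  have key : ∀ s t, (ν s : Measure ℝ).real univ ≤ (ν t : Measure ℝ).real univ := fun s t => by
    simpa using h.integral_translate_le (ψ := fun _ => 1) contDiff_const (by simp) (c := 0)
      (s := s) (t := t) (by simp)
  rw [← h.initial_μ]
  exact le_antisymm (key _ _) (key _ _)

/-- A front moving at speed c at least as fast as the matter in a layer of width ρ ahead of it loses
no mass behind it. Writing the condition with the factor t - s also covers motion backwards in time.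
-/
theorem real_Iic_le (h : IsConservativeSolutionWith u₀ μ₀ v ν vx) {c s t x ρ : ℝ} (hρ : 0 < ρ)
    (hsign : ∀ r ∈ uIcc s t, ∀ z ∈ Icc (x + c * (r - s)) (x + c * (r - s) + ρ),
      (v r z - c) * (t - s) ≤ 0) :
    (ν s : Measure ℝ).real (Iic x) ≤ (ν t : Measure ℝ).real (Iic (x + c * (t - s))) := by
  have key : ∀ ε > 0, ε ≤ ρ → (ν s : Measure ℝ).real (Iic x) ≤
      (ν t : Measure ℝ).real (Iio (x + c * (t - s) + ε)) := fun ε hε hερ => by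
    obtain ⟨ψ, hψ, hb, h1, h0, hd, hd0⟩ := exists_smooth_step (a := x - c * s) hε
    have hi : ∀ r, Integrable (fun z => ψ (z - c * r)) (ν r : Measure ℝ) := fun r =>
      Integrable.of_bound (hψ.continuous.comp (by fun_prop)).aestronglyMeasurable 1
        (ae_of_all _ fun z => by
          rw [Real.norm_eq_abs, abs_of_nonneg (hb _).1]; exact (hb _).2)
    have k := h.integral_translate_le hψ (fun z => by rw [abs_of_nonneg (hb _).1]; exact (hb _).2)
      (c := c) (s := s) (t := t) fun r hr z => by
        by_cases hz : z - c * r ∈ Icc (x - c * s) (x - c * s + ε)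
        · have := hsign r hr z ⟨by linarith [hz.1], by linarith [hz.2]⟩
          have := mul_nonneg_of_nonpos_of_nonpos this (hd (z - c * r))
          linarith
        · rw [hd0 _ hz]; simp
    refine le_trans ?_ (k.trans ?_)
    · rw [← integral_indicator_one measurableSet_Iic]
      refine integral_mono ((integrable_const (1 : ℝ)).indicator measurableSet_Iic) (hi s)
        fun z => ?_
      by_cases hz : z ∈ Iic x
      · rw [indicator_of_mem hz, h1 _ (by have : z ≤ x := hz; linarith)]; rfl
      · rw [indicator_of_notMem hz]; exact (hb _).1
    · rw [← integral_indicator_one measurableSet_Iio]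
      refine integral_mono (hi t) ((integrable_const (1 : ℝ)).indicator measurableSet_Iio)
        fun z => ?_
      by_cases hz : z ∈ Iio (x + c * (t - s) + ε)
      · rw [indicator_of_mem hz]; exact (hb _).2
      · rw [indicator_of_notMem hz, h0 _ (by
          have : x + c * (t - s) + ε ≤ z := not_lt.1 hz
          linarith)]
  refine ge_of_tendsto (tendsto_real_Iio_Iic _ _) ?_
  filter_upwards [(tendsto_one_div_add_atTop_nhds_zero_nat (𝕜 := ℝ)).eventually_lt_const hρ]
    with n hn
  exact key _ (by positivity) hn.le

theorem continuous_uncurry (h : IsConservativeSolutionWith u₀ μ₀ v ν vx) :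
    Continuous fun p : ℝ × ℝ => v p.1 p.2 :=
  (h.continuous_u.comp continuous_fst).eval continuous_snd

/-- The quantiles of the energy move with the velocity field. -/
theorem hasDerivAt_quantile (h : IsConservativeSolutionWith u₀ μ₀ v ν vx) {β : ℝ} (h0 : 0 < β)
    (h1 : β < (μ₀ : Measure ℝ).real univ) (t : ℝ) :
    HasDerivAt (fun t => quantile (ν t) β) (v t (quantile (ν t) β)) t := by
  have h1' : ∀ t, β < (ν t : Measure ℝ).real univ := fun t => by rwa [h.real_univ]
  rw [hasDerivAt_iff_isLittleO, Asymptotics.isLittleO_iff]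
  intro ε hε
  set q := quantile (ν t) β with hq
  set w := v t q with hw
  obtain ⟨δ, hδ, hv⟩ : ∃ δ > 0, ∀ r z, |r - t| < δ → |z - q| < δ → |v r z - w| ≤ ε := by
    have := Metric.continuousAt_iff.1 (h.continuous_uncurry.continuousAt (x := (t, q))) ε hε
    obtain ⟨δ, hδ, H⟩ := this
    refine ⟨δ, hδ, fun r z hr hz => ?_⟩
    exact (H (x := (r, z)) (max_lt hr hz)).le
  -- Within time κ, lines of slope at most |w| + ε drift by at most δ/4. The layer adds δ/4, and the
  -- starting point below a further δ/4, so everything stays where v is ε-close to w.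
  set κ := δ / (4 * (|w| + ε + 1)) with hκ
  have hκ0 : 0 < κ := by positivity
  filter_upwards [Metric.ball_mem_nhds t (lt_min hδ hκ0)] with r hr
  rw [Metric.mem_ball, Real.dist_eq, lt_min_iff] at hr
  -- σ is the sign of r - t; the slopes w ± εσ then treat past and future together.
  obtain ⟨σ, hσ, hσr⟩ : ∃ σ : ℝ, |σ| = 1 ∧ σ * (r - t) = |r - t| := by
    rcases le_total t r with hr | hr
    · exact ⟨1, by simp, by rw [one_mul, abs_of_nonneg (sub_nonneg.2 hr)]⟩
    · exact ⟨-1, by simp, by rw [abs_of_nonpos (sub_nonpos.2 hr)]; ring⟩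
  have hline : ∀ c τ, |c| ≤ |w| + ε → τ ∈ uIcc t r → |τ - t| < δ ∧ |c * (τ - t)| ≤ δ / 4 := by
    intro c τ hc hτ
    have hτ' : |τ - t| ≤ |r - t| := by
      exact abs_sub_left_of_mem_uIcc hτ
    refine ⟨hτ'.trans_lt hr.1, ?_⟩
    rw [abs_mul]
    have k : |τ - t| ≤ κ := hτ'.trans hr.2.le
    calc |c| * |τ - t| ≤ (|w| + ε + 1) * κ := by gcongr; linarith
      _ = δ / 4 := by rw [hκ]; field_simp
  have hprod : ∀ a b : ℝ, |a| ≤ ε → a * b ≤ ε * |b| := fun a b ha =>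
    (le_abs_self _).trans (by rw [abs_mul]; gcongr)
  have hcw : ∀ s : ℝ, |s| = 1 → |w + ε * s| ≤ |w| + ε := fun s hs => by
    refine (abs_add_le _ _).trans ?_
    rw [abs_mul, hs, abs_of_pos hε, mul_one]
  have hup : quantile (ν r) β ≤ q + (w + ε * σ) * (r - t) := by
    rw [quantile_le_iff h0 (h1' r)]
    refine ((quantile_le_iff h0 (h1' t)).1 le_rfl).trans
      (h.real_Iic_le (ρ := δ / 4) (by positivity) fun τ hτ z hz => ?_)
    obtain ⟨k1, k2⟩ := hline _ τ (hcw σ hσ) hτ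
    have k3 := abs_le.1 k2
    have k4 := hprod _ (r - t) (hv τ z k1 (abs_lt.2 ⟨by linarith [hz.1], by linarith [hz.2]⟩))
    have e : ε * |r - t| = ε * σ * (r - t) := by rw [← hσr]; ring
    linarith
  -- The comparison is run from r back to t: too small a quantile at time r would put mass β to the
  -- left of some x < q at time t.
  have hlow : q + (w + ε * -σ) * (r - t) ≤ quantile (ν r) β := by
    by_contra! hcon
    obtain ⟨x, hx1, hx2⟩ := exists_between (max_lt (show q - δ / 4 < q by linarith)
      (show quantile (ν r) β - (w + ε * -σ) * (r - t) < q by linarith))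
    rw [max_lt_iff] at hx1
    have k0 := h.real_Iic_le (s := r) (t := t) (x := x + (w + ε * -σ) * (r - t))
      (c := w + ε * -σ) (ρ := δ / 4) (by positivity) fun τ hτ z hz => by
        rw [uIcc_comm] at hτ
        obtain ⟨k1, k2⟩ := hline _ τ (hcw (-σ) (by rwa [abs_neg])) hτ
        have k3 := abs_le.1 k2
        have k4 := hprod _ (t - r) (hv τ z k1 (abs_lt.2 ⟨by linarith [hz.1], by linarith [hz.2]⟩))
        have e : ε * |t - r| = ε * σ * (r - t) := by rw [abs_sub_comm, ← hσr]; ring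
        linarith
    rw [show x + (w + ε * -σ) * (r - t) + (w + ε * -σ) * (t - r) = x by ring] at k0
    have k1 : (ν t : Measure ℝ).real (Iic x) < β := by
      rw [← not_le, ← quantile_le_iff h0 (h1' t)]; exact not_le.2 hx2
    have k2 : β ≤ (ν r : Measure ℝ).real (Iic (x + (w + ε * -σ) * (r - t))) := by
      rw [← quantile_le_iff h0 (h1' r)]; linarith [hx1.2]
    linarith
  rw [Real.norm_eq_abs, Real.norm_eq_abs, smul_eq_mul, ← hσr, abs_le]
  constructor <;> linarith

end IsConservativeSolutionWith

end HunterSaxton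

namespace HunterSaxton

/-! ### Primitives of distribution functions -/

theorem max_sub_bounds {a b y : ℝ} (hab : a ≤ b) :
    (Iic a).indicator (fun _ => b - a) y ≤ max (b - y) 0 - max (a - y) 0 ∧
      max (b - y) 0 - max (a - y) 0 ≤ (Iio b).indicator (fun _ => b - a) y := by
  constructor
  · by_cases hy : y ∈ Iic a
    · have hy' : y ≤ a := hy
      rw [indicator_of_mem hy, max_eq_left (by linarith), max_eq_left (by linarith)]; linarith
    · rw [indicator_of_notMem hy, sub_nonneg]
      exact max_le_max_right _ (by linarith)
  · by_cases hy : y ∈ Iio b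
    · have hy' : y < b := hy
      rw [indicator_of_mem hy, max_eq_left (a := b - y) (by linarith)]
      linarith [le_max_left (a - y) 0]
    · have hy' : b ≤ y := not_lt.1 hy
      rw [indicator_of_notMem hy, max_eq_right (by linarith), max_eq_right (by linarith), sub_zero]

theorem abs_max_sub_le (a b y : ℝ) : |max (b - y) 0 - max (a - y) 0| ≤ |b - a| := by
  refine (abs_max_sub_max_le_abs _ _ _).trans_eq ?_
  rw [sub_sub_sub_cancel_right]

/-- The kernel of the primitive of a distribution function. -/
noncomputable def potKernel (x : ℝ) : ℝ →ᵇ ℝ :=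
  BoundedContinuousFunction.ofNormedAddCommGroup (fun y => max (x - y) 0 - max (0 - y) 0)
    (by fun_prop) |x - 0| fun y => abs_max_sub_le 0 x y

theorem potKernel_apply (x y : ℝ) : potKernel x y = max (x - y) 0 - max (0 - y) 0 := rfl

theorem continuous_potKernel : Continuous potKernel := by
  refine (LipschitzWith.of_dist_le_mul (K := 1) fun a b => ?_).continuous
  rw [NNReal.coe_one, one_mul]
  refine (BoundedContinuousFunction.dist_le dist_nonneg).2 fun y => ?_
  rw [Real.dist_eq, Real.dist_eq, potKernel_apply, potKernel_apply, sub_sub_sub_cancel_right]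
  exact abs_max_sub_le b a y

/-- The primitive, vanishing at the origin, of the distribution function of `m`. -/
noncomputable def potential (m : Measure ℝ) (x : ℝ) : ℝ := ∫ y, potKernel x y ∂m

section potential

variable (m : Measure ℝ) [IsFiniteMeasure m]

theorem potential_sub (a b : ℝ) :
    potential m b - potential m a = ∫ y, (max (b - y) 0 - max (a - y) 0) ∂m := by
  rw [potential, potential,
    ← integral_sub ((potKernel b).integrable _) ((potKernel a).integrable _)]
  simp only [potKernel_apply, sub_sub_sub_cancel_right]

theorem integrable_max_sub (a b : ℝ) : Integrable (fun y => max (b - y) 0 - max (a - y) 0) m := by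
  refine (((potKernel b).integrable m).sub ((potKernel a).integrable m)).congr
    (ae_of_all _ fun y => ?_)
  simp only [Pi.sub_apply, potKernel_apply, sub_sub_sub_cancel_right]

theorem le_potential_sub {a b : ℝ} (hab : a ≤ b) :
    (b - a) * m.real (Iic a) ≤ potential m b - potential m a := by
  rw [potential_sub, mul_comm, ← smul_eq_mul, ← setIntegral_const, ← integral_indicator
    measurableSet_Iic]
  exact integral_mono ((integrable_const _).indicator measurableSet_Iic) (integrable_max_sub m a b)
    fun y => (max_sub_bounds hab).1

theorem potential_sub_le {a b : ℝ} (hab : a ≤ b) :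
    potential m b - potential m a ≤ (b - a) * m.real (Iio b) := by
  rw [potential_sub, mul_comm, ← smul_eq_mul, ← setIntegral_const, ← integral_indicator
    measurableSet_Iio]
  exact integral_mono (integrable_max_sub m a b) ((integrable_const _).indicator measurableSet_Iio)
    fun y => (max_sub_bounds hab).2

theorem lipschitzWith_potential :
    LipschitzWith ⟨m.real univ, measureReal_nonneg⟩ (potential m) := by
  refine LipschitzWith.of_dist_le_mul fun b a => ?_
  rw [Real.dist_eq, Real.dist_eq, potential_sub, mul_comm]
  exact (Real.norm_eq_abs _).symm.trans_le (norm_integral_le_of_norm_le_const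
    (ae_of_all _ fun y => (Real.norm_eq_abs _).trans_le (abs_max_sub_le a b y)))

/-- The difference quotients lie between values of the distribution function, so they converge at
its continuity points, that is, off a countable set. -/
theorem ae_hasDerivAt_potential : ∀ᵐ x, HasDerivAt (potential m) (m.real (Iic x)) x := by
  have hm : Monotone fun x => m.real (Iic x) := fun a b h => measureReal_mono (Iic_subset_Iic.2 h)
  filter_upwards [hm.countable_not_continuousAt.ae_notMem volume] with x hx
  have hx : ContinuousAt (fun x => m.real (Iic x)) x := not_not.1 hx
  rw [hasDerivAt_iff_isLittleO, Asymptotics.isLittleO_iff]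
  intro ε hε
  filter_upwards [Metric.continuousAt_iff'.1 hx ε hε] with z hz
  rw [Real.dist_eq, abs_lt] at hz
  rw [Real.norm_eq_abs, Real.norm_eq_abs, smul_eq_mul]
  rcases le_total x z with h | h
  · rw [abs_of_nonneg (a := z - x) (by linarith), abs_le]
    have h1 := le_potential_sub m h
    have h2 := potential_sub_le m h
    have h3 := mul_le_mul_of_nonneg_left (real_Iio_le_Iic m z) (sub_nonneg.2 h)
    constructor <;> nlinarith
  · rw [abs_of_nonpos (a := z - x) (by linarith), abs_le]
    have h1 := le_potential_sub m h
    have h2 := potential_sub_le m h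
    have h3 := mul_le_mul_of_nonneg_left (real_Iio_le_Iic m x) (sub_nonneg.2 h)
    constructor <;> nlinarith

end potential

/-! ### The momentum equation along curves -/

theorem continuous_integral_mul_of_hasCompactSupport {f : ℝ → ℝ → ℝ}
    (hf : Continuous (Function.uncurry f)) {ψ : ℝ → ℝ} (hψ : Continuous ψ)
    (hs : HasCompactSupport ψ) : Continuous fun t => ∫ x, f t x * ψ x := by
  rw [← continuousOn_univ]
  refine continuousOn_integral_of_compact_support hs.isCompact ?_ fun t x _ hx => ?_
  · exact (hf.mul (hψ.comp continuous_snd)).continuousOn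
  · rw [image_eq_zero_of_notMem_tsupport hx, mul_zero]

variable {u₀ : ℝ →ᵇ ℝ} {μ₀ : FiniteMeasure ℝ} {v : ℝ → ℝ →ᵇ ℝ} {ν : ℝ → FiniteMeasure ℝ}
  {vx : ℝ → ℝ → ℝ}

/-- The momentum flux `(v² - ∫ F) / 2`. -/
noncomputable def flux (v : ℝ → ℝ →ᵇ ℝ) (ν : ℝ → FiniteMeasure ℝ) (t x : ℝ) : ℝ :=
  1 / 2 * (v t x * v t x) - 1 / 2 * potential (ν t) x

namespace IsConservativeSolutionWith

theorem isWeakDeriv_flux (h : IsConservativeSolutionWith u₀ μ₀ v ν vx) (t : ℝ) :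
    IsWeakDeriv (flux v ν t)
      (fun x => v t x * vx t x - (1 / 2) * (ν t : Measure ℝ).real (Iic x)) := by
  have hAC : ∀ a b, AbsolutelyContinuousOnInterval (v t) a b :=
    (h.energyBound t).globallyAC.absolutelyContinuousOnInterval
  have hP : ∀ a b, AbsolutelyContinuousOnInterval (potential (ν t)) a b := fun a b =>
    (lipschitzWith_potential (ν t : Measure ℝ)).lipschitzOnWith.absolutelyContinuousOnInterval
  have hw : ∀ a b, AbsolutelyContinuousOnInterval (flux v ν t) a b := fun a b =>
    (((hAC a b).fun_mul (hAC a b)).const_mul (1 / 2)).fun_sub ((hP a b).const_mul (1 / 2))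
  refine (isWeakDeriv_deriv_of_absolutelyContinuous hw).congr_deriv ?_
  filter_upwards [ae_differentiableAt_of_absolutelyContinuous hAC,
    ae_hasDerivAt_potential (ν t : Measure ℝ),
    (h.space_deriv t).ae_eq (h.energyBound t).globallyAC.isWeakDeriv] with x h1 h2 h3
  have h4 := ((h1.hasDerivAt.mul h1.hasDerivAt).const_mul (1 / 2)).sub (h2.const_mul (1 / 2))
  refine h4.deriv.trans ?_
  rw [h3]; ring

/-- F itself may jump, but its primitive integrates a bounded continuous kernel that depends
continuously on x. This is the reason for writing the momentum equation in flux form. -/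
theorem continuous_flux (h : IsConservativeSolutionWith u₀ μ₀ v ν vx) :
    Continuous (Function.uncurry (flux v ν)) := by
  have h1 : Continuous fun p : ℝ × ℝ => potential (ν p.1) p.2 :=
    continuous_integral_boundedContinuous (continuous_potKernel.comp continuous_snd)
      (h.continuous_μ.comp continuous_fst)
  have h2 := h.continuous_uncurry
  exact ((h2.mul h2).const_mul _).sub (h1.const_mul _)

/-- The momentum equation tested with χ(t) ψ(x), after one integration by parts in x, says that v_t
+ flux_x = 0. -/
theorem hasDerivAt_integral_mul (h : IsConservativeSolutionWith u₀ μ₀ v ν vx) {ψ : ℝ → ℝ}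
    (hψ : ContDiff ℝ ∞ ψ) (hs : HasCompactSupport ψ) (t : ℝ) :
    HasDerivAt (fun t => ∫ x, v t x * ψ x) (∫ x, flux v ν t x * deriv ψ x) t := by
  refine hasDerivAt_of_integral_deriv_mul_add
    (continuous_integral_mul_of_hasCompactSupport (f := fun t x => v t x) h.continuous_uncurry
      hψ.continuous hs)
    (continuous_integral_mul_of_hasCompactSupport h.continuous_flux
      (hψ.continuous_deriv (by simp)) hs.deriv) (fun χ hχ hχs => ?_) t
  rw [← h.momentum _ (isTestFun_mul_translate hχ hχs hψ hs 0)]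
  congr 1; funext t
  have hw := h.isWeakDeriv_flux t
  rw [hw.byParts ψ hψ hs, mul_neg, ← sub_eq_add_neg, ← integral_const_mul, ← integral_const_mul]
  have i1 : Integrable fun x => deriv χ t * (v t x * ψ x) :=
    (((v t).continuous.mul hψ.continuous).integrable_of_hasCompactSupport hs.mul_left).const_mul _
  have i2 : Integrable fun x => χ t *
      ((v t x * vx t x - (1 / 2) * (ν t : Measure ℝ).real (Iic x)) * ψ x) := by
    simpa using! (hw.locInt_deriv.integrable_smul_right_of_hasCompactSupport hψ.continuous
      hs).const_mul (χ t)
  rw [← integral_sub i1 i2]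
  congr 1; funext x
  rw [dT_mul_translate hχ hψ]
  simp only [zero_mul, sub_zero, mul_zero]
  ring

/-- The increment in time of the primitive of the velocity. -/
theorem intervalIntegral_sub_eq (h : IsConservativeSolutionWith u₀ μ₀ v ν vx) (s t x : ℝ) :
    (∫ z in (0:ℝ)..x, v t z) - ∫ z in (0:ℝ)..x, v s z =
      ∫ r in s..t, (flux v ν r 0 - flux v ν r x) := by
  have hfc := h.continuous_flux
  have hfr : ∀ x, Continuous fun r => flux v ν r x := fun x =>
    hfc.comp (continuous_id.prodMk continuous_const)
  set P : ℝ → ℝ := fun x => ∫ z in (0:ℝ)..x, (v t z - v s z) with hP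
  set Q : ℝ → ℝ := fun x => ∫ r in s..t, flux v ν r x with hQ
  have hvc : Continuous fun z => v t z - v s z := (v t).continuous.sub (v s).continuous
  have hPd : ∀ x, HasDerivAt P (v t x - v s x) x := fun x =>
    hvc.integral_hasStrictDerivAt 0 x |>.hasDerivAt
  have hPc : Continuous P := continuous_iff_continuousAt.2 fun x => (hPd x).continuousAt
  have hQc : Continuous Q := intervalIntegral.continuous_parametric_intervalIntegral_of_continuous'
    (f := fun x r => flux v ν r x) (hfc.comp continuous_swap) s t
  -- Integrating v_t + flux_x = 0 over [s, t] says that P + Q has zero weak derivative in x.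
  obtain ⟨c, hc⟩ := ae_eq_const_of_integral_mul_deriv_eq_zero (w := fun x => P x + Q x)
    (hPc.add hQc).locallyIntegrable fun ψ hψ hs => by
      have hdc : Continuous (deriv ψ) := hψ.continuous_deriv (by simp)
      obtain ⟨R, hR, hsup⟩ := exists_support_subset_Ioc hs
      have e1 : ∫ x, (P x * deriv ψ x + (v t x - v s x) * ψ x) = 0 :=
        integral_eq_zero_of_hasDerivAt_of_support (f := fun x => P x * ψ x) (R := R)
          (fun x => by
            have := (hPd x).mul (hψ.differentiable (by simp) x).hasDerivAt
            rw [add_comm] at this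
            exact this)
          ((hPc.mul hdc).add (hvc.mul hψ.continuous)) fun x hx => by
            by_contra hne
            have := hsup x (right_ne_zero_of_mul hne)
            exact hx (abs_le.2 ⟨this.1.le, this.2.le⟩)
      have e2 : ∫ x, Q x * deriv ψ x = ∫ x, (v t x - v s x) * ψ x := by
        have iv : ∀ r, Integrable fun x => v r x * ψ x := fun r =>
          ((v r).continuous.mul hψ.continuous).integrable_of_hasCompactSupport hs.mul_left
        have k := intervalIntegral.integral_eq_sub_of_hasDerivAt (a := s) (b := t)
          (fun r _ => h.hasDerivAt_integral_mul hψ hs r)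
          (continuous_integral_mul_of_hasCompactSupport hfc hdc hs.deriv |>.intervalIntegrable _ _)
        rw [← integral_sub (iv t) (iv s)] at k
        simp only [← sub_mul] at k
        rw [← k, intervalIntegral_integral_swap]
        · congr 1; funext x
          exact (intervalIntegral.integral_mul_const _ _).symm
        · have hK : IntegrableOn (Function.uncurry fun r x => flux v ν r x * deriv ψ x)
              (uIcc s t ×ˢ tsupport (deriv ψ)) (volume.prod volume) :=
            ((hfc.mul (hdc.comp continuous_snd)).continuousOn).integrableOn_compact
              (isCompact_uIcc.prod hs.deriv.isCompact)
          have hK' : IntegrableOn (Function.uncurry fun r x => flux v ν r x * deriv ψ x)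
              (uIoc s t ×ˢ univ) (volume.prod volume) :=
            hK.of_forall_sdiff_eq_zero (measurableSet_uIoc.prod MeasurableSet.univ) fun p hp => by
              have : p.2 ∉ tsupport (deriv ψ) := fun hp2 =>
                hp.2 ⟨uIoc_subset_uIcc hp.1.1, hp2⟩
              simp [Function.uncurry, image_eq_zero_of_notMem_tsupport this]
          rwa [IntegrableOn, ← Measure.prod_restrict, Measure.restrict_univ] at hK'
      have i1 : Integrable fun x => P x * deriv ψ x :=
        (hPc.mul hdc).integrable_of_hasCompactSupport hs.deriv.mul_left
      have i2 : Integrable fun x => Q x * deriv ψ x :=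
        (hQc.mul hdc).integrable_of_hasCompactSupport hs.deriv.mul_left
      have i3 : Integrable fun x => (v t x - v s x) * ψ x :=
        (hvc.mul hψ.continuous).integrable_of_hasCompactSupport hs.mul_left
      rw [integral_add i1 i3] at e1
      simp only [add_mul]
      rw [integral_add i1 i2, e2, e1]
  have e : (fun x => P x + Q x) = fun _ => c :=
    (Continuous.ae_eq_iff_eq volume (hPc.add hQc) continuous_const).1 hc
  have ex := congrFun e x
  have e0 := congrFun e 0
  simp only [hP, hQ, intervalIntegral.integral_same, zero_add] at ex e0
  rw [intervalIntegral.integral_sub ((v t).continuous.intervalIntegrable _ _)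
    ((v s).continuous.intervalIntegrable _ _)] at ex
  rw [intervalIntegral.integral_sub ((hfr 0).intervalIntegrable _ _)
    ((hfr x).intervalIntegrable _ _)]
  linarith

/-- (x, r) ↦ ∫₀ˣ v(r, z) dz has continuous partial derivatives v and flux(0) - flux(x), so it is C¹
and the chain rule applies, although v itself need not be differentiable. -/
theorem hasDerivAt_primitive_curve (h : IsConservativeSolutionWith u₀ μ₀ v ν vx) {q : ℝ → ℝ}
    {q' t : ℝ} (hq : HasDerivAt q q' t) :
    HasDerivAt (fun r => ∫ z in (0:ℝ)..q r, v r z)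
      (v t (q t) * q' + (flux v ν t 0 - flux v ν t (q t))) t := by
  have hfc := h.continuous_flux
  have hfr : ∀ x, Continuous fun r => flux v ν r x := fun x =>
    hfc.comp (continuous_id.prodMk continuous_const)
  have hJt : ∀ x r, HasDerivAt (fun r => ∫ z in (0:ℝ)..x, v r z)
      (flux v ν r 0 - flux v ν r x) r := fun x r => by
    have k := (((hfr 0).sub (hfr x)).integral_hasStrictDerivAt 0 r).hasDerivAt.add_const
      (∫ z in (0:ℝ)..x, v 0 z)
    refine k.congr_of_eventuallyEq (Eventually.of_forall fun r => ?_)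
    have := h.intervalIntegral_sub_eq 0 r x
    simp only [Pi.sub_apply]
    linarith
  have hJx : ∀ x r, HasDerivAt (fun x => ∫ z in (0:ℝ)..x, v r z) (v r x) x := fun x r =>
    ((v r).continuous.integral_hasStrictDerivAt 0 x).hasDerivAt
  have hspan : Continuous fun c : ℝ => ContinuousLinearMap.toSpanSingleton ℝ c :=
    (ContinuousLinearMap.toSpanSingletonCLE (𝕜 := ℝ) (E := ℝ)).continuous
  have c1 : Continuous fun p : ℝ × ℝ => v p.2 p.1 := h.continuous_uncurry.comp continuous_swap
  have c2 : Continuous fun p : ℝ × ℝ => flux v ν p.2 0 - flux v ν p.2 p.1 :=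
    (hfc.comp (continuous_snd.prodMk continuous_const)).sub (hfc.comp continuous_swap)
  have k := hasStrictFDerivAt_uncurry_coprod (𝕜 := ℝ) (u := (q t, t))
    (f := fun x r => ∫ z in (0:ℝ)..x, v r z)
    (f₁ := fun x r => ContinuousLinearMap.toSpanSingleton ℝ (v r x))
    (f₂ := fun x r => ContinuousLinearMap.toSpanSingleton ℝ (flux v ν r 0 - flux v ν r x))
    (Eventually.of_forall fun p => (hJx p.1 p.2).hasFDerivAt)
    (Eventually.of_forall fun p => (hJt p.1 p.2).hasFDerivAt)
    (hspan.comp c1).continuousAt (hspan.comp c2).continuousAt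
  have k2 := k.hasFDerivAt.comp_hasDerivAt (f := fun r => (q r, r)) t (hq.prodMk (hasDerivAt_id t))
  refine k2.congr_deriv ?_
  simp [Function.HasUncurry.uncurry]
  ring

/-- With P the primitive of F, the numerator is ½ ΔP - ½ (Δv)². The first term divided by ℓ lies
between ½ F(x) and ½ ν((-∞, x + ℓ)), and the second is at most half the energy of the open interval
by the energy bound. That energy tends to 0 with ℓ, even if x is an atom. -/
theorem abs_flux_slope_sub_le (h : IsConservativeSolutionWith u₀ μ₀ v ν vx) (t x : ℝ) {ℓ : ℝ}
    (hℓ : 0 < ℓ) :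
    |(v t (x + ℓ) * v t x - flux v ν t (x + ℓ) - (v t x * v t x - flux v ν t x)) / ℓ -
      1 / 2 * (ν t : Measure ℝ).real (Iic x)| ≤
      1 / 2 * ((ν t : Measure ℝ).real (Iio (x + ℓ)) - (ν t : Measure ℝ).real (Iic x)) := by
  have h1 := h.energyBound t x (x + ℓ) (by linarith)
  have h2 := le_potential_sub (ν t : Measure ℝ) (show x ≤ x + ℓ by linarith)
  have h3 := potential_sub_le (ν t : Measure ℝ) (show x ≤ x + ℓ by linarith)
  have h4 := real_Iio_eq_add (ν t : Measure ℝ) (show x < x + ℓ by linarith)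
  rw [add_sub_cancel_left] at h1 h2 h3
  have e : (v t (x + ℓ) * v t x - flux v ν t (x + ℓ) - (v t x * v t x - flux v ν t x)) =
      1 / 2 * (potential (ν t) (x + ℓ) - potential (ν t) x) -
      1 / 2 * (v t (x + ℓ) - v t x) ^ 2 := by
    simp only [flux]; ring
  have h5 := sq_nonneg (v t (x + ℓ) - v t x)
  rw [e, div_sub' hℓ.ne', abs_div, abs_of_pos hℓ, div_le_iff₀ hℓ, abs_le]
  constructor <;> nlinarith

/-- Along every integral curve of the velocity, the acceleration is `F / 2`. -/
theorem velocity_curve (h : IsConservativeSolutionWith u₀ μ₀ v ν vx) {q : ℝ → ℝ}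
    (hq : ∀ t, HasDerivAt q (v t (q t)) t) (s t : ℝ) :
    v t (q t) - v s (q s) = ∫ r in s..t, 1 / 2 * (ν r : Measure ℝ).real (Iic (q r)) := by
  have hqc : Continuous q := continuous_iff_continuousAt.2 fun t => (hq t).continuousAt
  set ℓ : ℕ → ℝ := fun n => 1 / ((n : ℝ) + 1) with hℓ
  have hℓ0 : ∀ n, 0 < ℓ n := fun n => by positivity
  have hℓt : Tendsto ℓ atTop (𝓝 0) := tendsto_one_div_add_atTop_nhds_zero_nat
  -- D n is the time derivative of the mean of v over [q, q + ℓ]; both ends move with speed v(q),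
  -- and the flux at 0 cancels.
  set D : ℕ → ℝ → ℝ := fun n r => (v r (q r + ℓ n) * v r (q r) - flux v ν r (q r + ℓ n) -
    (v r (q r) * v r (q r) - flux v ν r (q r))) / ℓ n with hD
  have hDc : ∀ n, Continuous (D n) := fun n => by
    have a1 : Continuous fun r => v r (q r) := h.continuous_uncurry.comp
      (continuous_id.prodMk hqc)
    have a2 : Continuous fun r => v r (q r + ℓ n) := h.continuous_uncurry.comp
      (continuous_id.prodMk (hqc.add continuous_const))
    have a3 : Continuous fun r => flux v ν r (q r) := h.continuous_flux.comp
      (continuous_id.prodMk hqc)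
    have a4 : Continuous fun r => flux v ν r (q r + ℓ n) := h.continuous_flux.comp
      (continuous_id.prodMk (hqc.add continuous_const))
    exact (((a2.mul a1).sub a4).sub ((a1.mul a1).sub a3)).div_const _
  have hId : ∀ n r, HasDerivAt (fun r => ((∫ z in (0:ℝ)..(q r + ℓ n), v r z) -
      ∫ z in (0:ℝ)..q r, v r z) / ℓ n) (D n r) r := fun n r => by
    have k := ((h.hasDerivAt_primitive_curve ((hq r).add_const (ℓ n))).sub
      (h.hasDerivAt_primitive_curve (hq r))).div_const (ℓ n)
    refine k.congr_deriv ?_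
    simp only [hD]; ring
  have hI : ∀ r, Tendsto (fun n => ((∫ z in (0:ℝ)..(q r + ℓ n), v r z) -
      ∫ z in (0:ℝ)..q r, v r z) / ℓ n) atTop (𝓝 (v r (q r))) := fun r => by
    have k := ((v r).continuous.integral_hasStrictDerivAt 0 (q r)).hasDerivAt
    rw [hasDerivAt_iff_tendsto_slope_zero] at k
    have k2 := k.comp (tendsto_nhdsWithin_iff.2
      ⟨hℓt, Eventually.of_forall fun n => (hℓ0 n).ne'⟩)
    refine k2.congr fun n => ?_
    simp only [Function.comp, smul_eq_mul]
    rw [inv_mul_eq_div]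
  have hlim : ∀ r, Tendsto (fun n => D n r) atTop
      (𝓝 (1 / 2 * (ν r : Measure ℝ).real (Iic (q r)))) := fun r => by
    rw [tendsto_iff_norm_sub_tendsto_zero]
    have k := ((tendsto_real_Iio_Iic (ν r : Measure ℝ) (q r)).sub_const
      ((ν r : Measure ℝ).real (Iic (q r)))).const_mul (1 / 2)
    rw [sub_self, mul_zero] at k
    exact squeeze_zero (fun n => norm_nonneg _)
      (fun n => h.abs_flux_slope_sub_le r (q r) (hℓ0 n)) k
  have k1 : Tendsto (fun n => ∫ r in s..t, D n r) atTop
      (𝓝 (∫ r in s..t, 1 / 2 * (ν r : Measure ℝ).real (Iic (q r)))) := by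
    refine intervalIntegral.tendsto_integral_filter_of_dominated_convergence
      (fun _ => (μ₀ : Measure ℝ).real univ) (Eventually.of_forall fun n =>
        (hDc n).aestronglyMeasurable) (Eventually.of_forall fun n => ae_of_all _ fun r _ => ?_)
      intervalIntegrable_const (ae_of_all _ fun r _ => hlim r)
    have k := abs_le.1 (h.abs_flux_slope_sub_le r (q r) (hℓ0 n))
    have k2 : (ν r : Measure ℝ).real (Iio (q r + ℓ n)) ≤ (μ₀ : Measure ℝ).real univ := by
      rw [← h.real_univ r]; exact measureReal_mono (subset_univ _)
    have k3 : 0 ≤ (ν r : Measure ℝ).real (Iic (q r)) := measureReal_nonneg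
    have k4 := real_Iic_le_Iio (ν r : Measure ℝ) (show q r < q r + ℓ n by linarith [hℓ0 n])
    have k5 : 0 ≤ (μ₀ : Measure ℝ).real univ := measureReal_nonneg
    rw [Real.norm_eq_abs, abs_le]
    constructor <;> linarith [k.1, k.2]
  have k2 : ∀ n, ∫ r in s..t, D n r = _ := fun n =>
    intervalIntegral.integral_eq_sub_of_hasDerivAt (fun r _ => hId n r)
      ((hDc n).intervalIntegrable _ _)
  simp only [k2] at k1
  exact tendsto_nhds_unique ((hI t).sub (hI s)) k1

end IsConservativeSolutionWith

end HunterSaxton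

namespace HunterSaxton

/-! ### Uniqueness of conservative solutions -/

/-- Two functions whose oscillation is controlled by `m` agree if they agree at the quantiles. -/
theorem eq_of_eq_quantile {m : Measure ℝ} [IsFiniteMeasure m] {v v' : ℝ → ℝ}
    (hv : EnergyBound v m) (hv' : EnergyBound v' m) (hm : 0 < m.real univ)
    (hq : ∀ β, 0 < β → β < m.real univ → v (quantile m β) = v' (quantile m β)) (x : ℝ) :
    v x = v' x := by
  -- If the functions agree at one end, their difference at the other is Δv - Δv' up to sign, and
  -- (Δv - Δv')² ≤ 2 (Δv)² + 2 (Δv')².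
  have hsq : ∀ a b, v a = v' a ∨ v b = v' b → a ≤ b →
      (v b - v' b) ^ 2 + (v a - v' a) ^ 2 ≤ 4 * ((b - a) * m.real (Ioo a b)) := by
    intro a b h hab
    have h1 := hv a b hab
    have h2 := hv' a b hab
    rcases h with h | h <;> rw [h] at h1 ⊢ <;>
      nlinarith [sq_nonneg ((v b - v a) + (v' b - v' a)), sq_nonneg (v b - v' a + (v' b - v' a)),
        sq_nonneg (v' b - v a + (v' b - v' a))]
  have h0 : (v x - v' x) ^ 2 ≤ 0 := by
    set M := m.real univ
    set F := m.real (Iic x) with hF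
    have hFM : F ≤ M := measureReal_mono (subset_univ _)
    -- If no energy lies in (-∞, x], the quantiles with β ↓ 0 are used; they stay between x and the
    -- fixed point r, and the energy between x and them is at most β.
    rcases (measureReal_nonneg : 0 ≤ F).eq_or_lt with hF0 | hF0
    · set γ := M / 2
      have hγ : 0 < γ ∧ γ < M := ⟨by positivity, half_lt_self hm⟩
      set r := quantile m γ
      have hle : ∀ β ∈ Ioo 0 γ, (v x - v' x) ^ 2 ≤ 4 * ((r - x) * β) := fun β hβ => by
        have hβM : β < M := hβ.2.trans hγ.2
        have hxq : x < quantile m β := by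
          rw [← not_le, quantile_le_iff hβ.1 hβM, not_le]; exact hF0 ▸ hβ.1
        have hqr : quantile m β ≤ r := by
          rw [quantile_le_iff hβ.1 hβM]
          exact hβ.2.le.trans ((quantile_le_iff hγ.1 hγ.2).1 le_rfl)
        have h1 := hsq x (quantile m β) (Or.inr (hq β hβ.1 hβM)) hxq.le
        have h2 : m.real (Ioo x (quantile m β)) ≤ β := by
          have h3 : m.real (Ioo x (quantile m β)) ≤ m.real (Iio (quantile m β)) :=
            measureReal_mono fun z hz => hz.2
          refine h3.trans (le_of_tendsto' (tendsto_real_Iic_Iio m _) fun n => ?_)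
          refine (not_le.1 fun h => ?_).le
          have h4 := (quantile_le_iff hβ.1 hβM).2 h
          have h5 : 0 < 1 / ((n : ℝ) + 1) := by positivity
          linarith
        have h6 : (quantile m β - x) * m.real (Ioo x (quantile m β)) ≤ (r - x) * β :=
          mul_le_mul (by linarith) h2 measureReal_nonneg (by linarith)
        have h7 := sq_nonneg (v (quantile m β) - v' (quantile m β))
        linarith
      have hl : Tendsto (fun β : ℝ => 4 * ((r - x) * β)) (𝓝[>] 0) (𝓝 (4 * ((r - x) * 0))) :=
        ((continuous_id.const_mul (r - x)).const_mul 4).continuousWithinAt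
      rw [mul_zero, mul_zero] at hl
      exact ge_of_tendsto hl (by
        filter_upwards [Ioo_mem_nhdsGT hγ.1] with β hβ using hle β hβ)
    -- Otherwise the quantiles with β ↑ F lie in [r, x], and the energy between them and x is at
    -- most F - β.
    · set γ := F / 2
      have hγ : 0 < γ ∧ γ < F := ⟨by positivity, half_lt_self hF0⟩
      set r := quantile m γ
      have hle : ∀ β ∈ Ioo γ F, (v x - v' x) ^ 2 ≤ 4 * ((x - r) * (F - β)) := fun β hβ => by
        have hβ0 : 0 < β := hγ.1.trans hβ.1
        have hβM : β < M := hβ.2.trans_le hFM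
        have hqx : quantile m β ≤ x := (quantile_le_iff hβ0 hβM).2 hβ.2.le
        have hβq : β ≤ m.real (Iic (quantile m β)) := (quantile_le_iff hβ0 hβM).1 le_rfl
        have hrq : r ≤ quantile m β := by
          rw [quantile_le_iff hγ.1 (hγ.2.trans_le hFM)]
          exact hβ.1.le.trans hβq
        have h1 := hsq (quantile m β) x (Or.inl (hq β hβ0 hβM)) hqx
        have h2 : m.real (Ioo (quantile m β) x) ≤ F - β := by
          rcases hqx.eq_or_lt with h | h
          · rw [h, Ioo_self, measureReal_empty]; linarith [hβ.2]
          · have := real_Iio_eq_add m h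
            have := real_Iio_le_Iic m x
            linarith
        have h6 : (x - quantile m β) * m.real (Ioo (quantile m β) x) ≤ (x - r) * (F - β) :=
          mul_le_mul (by linarith) h2 measureReal_nonneg (by linarith)
        have h7 := sq_nonneg (v (quantile m β) - v' (quantile m β))
        linarith
      have hl : Tendsto (fun β : ℝ => 4 * ((x - r) * (F - β))) (𝓝[<] F)
          (𝓝 (4 * ((x - r) * (F - F)))) :=
        (((continuous_const.sub continuous_id).const_mul (x - r)).const_mul 4).continuousWithinAt
      rw [sub_self, mul_zero, mul_zero] at hl
      exact ge_of_tendsto hl (by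
        filter_upwards [Ioo_mem_nhdsLT hγ.2] with β hβ using hle β hβ)
  have := pow_eq_zero_iff two_ne_zero |>.1 (le_antisymm h0 (sq_nonneg _))
  linarith

variable {u₀ : ℝ →ᵇ ℝ} {μ₀ : FiniteMeasure ℝ} {v : ℝ → ℝ →ᵇ ℝ} {ν : ℝ → FiniteMeasure ℝ}
  {vx : ℝ → ℝ → ℝ}

namespace IsConservativeSolutionWith

/-- For almost every r the energy is absolutely continuous, so F equals β on the β-quantile and the
acceleration is the constant β/2. The exceptional times do not affect the integral. -/
theorem velocity_quantile (h : IsConservativeSolutionWith u₀ μ₀ v ν vx) {β : ℝ} (h0 : 0 < β)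
    (h1 : β < (μ₀ : Measure ℝ).real univ) (t : ℝ) :
    v t (quantile (ν t) β) = u₀ (quantile μ₀ β) + t * (1 / 2 * β) := by
  have k := h.velocity_curve (q := fun t => quantile (ν t) β) (h.hasDerivAt_quantile h0 h1) 0 t
  rw [h.initial_u, h.initial_μ] at k
  have e : ∫ r in (0:ℝ)..t, 1 / 2 * (ν r : Measure ℝ).real (Iic (quantile (ν r) β)) =
      ∫ r in (0:ℝ)..t, 1 / 2 * β := by
    refine intervalIntegral.integral_congr_ae ?_
    filter_upwards [h.ac_ae] with r hr _
    have : NullSingletonClass (ν r : Measure ℝ) := by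
      rw [hr, sqMeasure]; infer_instance
    rw [real_Iic_quantile h0 (by rwa [h.real_univ])]
  rw [e, intervalIntegral.integral_const, smul_eq_mul, sub_zero] at k
  linarith

theorem quantile_eq (h : IsConservativeSolutionWith u₀ μ₀ v ν vx) {β : ℝ} (h0 : 0 < β)
    (h1 : β < (μ₀ : Measure ℝ).real univ) (t : ℝ) :
    quantile (ν t) β = quantile μ₀ β + t * u₀ (quantile μ₀ β) + t ^ 2 / 4 * β := by
  have hd : ∀ t, HasDerivAt (fun t => quantile (ν t) β)
      (u₀ (quantile μ₀ β) + t * (1 / 2 * β)) t := fun t => by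
    rw [← h.velocity_quantile h0 h1 t]
    exact h.hasDerivAt_quantile h0 h1 t
  have hd2 : ∀ t, HasDerivAt (fun t => t * u₀ (quantile μ₀ β) + t ^ 2 / 4 * β)
      (u₀ (quantile μ₀ β) + t * (1 / 2 * β)) t := fun t => by
    refine (((hasDerivAt_id t).mul_const _).add
      (((hasDerivAt_pow 2 t).div_const 4).mul_const β)).congr_deriv ?_
    push_cast; ring
  have k1 := intervalIntegral.integral_eq_sub_of_hasDerivAt (a := 0) (b := t) (fun r _ => hd r)
    (Continuous.intervalIntegrable (by fun_prop) _ _)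
  have k2 := intervalIntegral.integral_eq_sub_of_hasDerivAt (a := 0) (b := t) (fun r _ => hd2 r)
    (Continuous.intervalIntegrable (by fun_prop) _ _)
  rw [k1, h.initial_μ] at k2
  linarith

/-- Without energy there are no quantiles to follow; v is constant in space, an integral curve can
be written down explicitly, and its acceleration F/2 is zero. -/
theorem velocity_eq_of_real_univ_eq_zero (h : IsConservativeSolutionWith u₀ μ₀ v ν vx)
    (hM : (μ₀ : Measure ℝ).real univ = 0) (t x : ℝ) : v t x = u₀ 0 := by
  have hc : ∀ t a b, v t b = v t a := fun t a b => by
    have k := (h.energyBound t).sq_le a b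
    rw [h.real_univ, hM, mul_zero] at k
    have := pow_eq_zero_iff two_ne_zero |>.1 (le_antisymm k (sq_nonneg _))
    linarith
  have hv0 : Continuous fun t => v t 0 := h.continuous_uncurry.comp
    (continuous_id.prodMk continuous_const)
  have k := h.velocity_curve (q := fun t => ∫ r in (0:ℝ)..t, v r 0) (fun t => by
    rw [hc t 0 (∫ r in (0:ℝ)..t, v r 0)]
    exact (hv0.integral_hasStrictDerivAt 0 t).hasDerivAt) 0 t
  have hF : ∀ r z, (ν r : Measure ℝ).real (Iic z) = 0 := fun r z =>
    le_antisymm ((measureReal_mono (subset_univ _)).trans_eq ((h.real_univ r).trans hM))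
      measureReal_nonneg
  simp only [hF, mul_zero, intervalIntegral.integral_zero, h.initial_u,
    intervalIntegral.integral_same] at k
  rw [hc t (∫ r in (0:ℝ)..t, v r 0) x]
  linarith

end IsConservativeSolutionWith

theorem IsConservativeSolution.eq_of_isConservativeSolution {v' : ℝ → ℝ →ᵇ ℝ}
    {ν' : ℝ → FiniteMeasure ℝ} (h : IsConservativeSolution u₀ μ₀ v ν)
    (h' : IsConservativeSolution u₀ μ₀ v' ν') : v = v' ∧ ν = ν' := by
  obtain ⟨vx, h⟩ := h
  obtain ⟨vx', h'⟩ := h'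
  have hν : ∀ t, (ν t : Measure ℝ) = ν' t := fun t =>
    measure_eq_of_quantile_eq ((h.real_univ t).trans (h'.real_univ t).symm) fun β h0 h1 => by
      rw [h.real_univ] at h1
      rw [h.quantile_eq h0 h1, h'.quantile_eq h0 h1]
  refine ⟨funext fun t => BoundedContinuousFunction.ext fun x => ?_,
    funext fun t => Subtype.ext (hν t)⟩
  rcases (measureReal_nonneg : 0 ≤ (μ₀ : Measure ℝ).real univ).eq_or_lt with hM | hM
  · rw [h.velocity_eq_of_real_univ_eq_zero hM.symm, h'.velocity_eq_of_real_univ_eq_zero hM.symm]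
  · refine eq_of_eq_quantile (h.energyBound t) (hν t ▸ h'.energyBound t)
      (by rwa [h.real_univ]) (fun β h0 h1 => ?_) x
    rw [h.real_univ] at h1
    rw [h.velocity_quantile h0 h1, hν t, h'.velocity_quantile h0 h1]

end HunterSaxton

/-! ### Assembly of the theorem -/

theorem theorem1 (u₀ : ℝ →ᵇ ℝ) (μ₀ : FiniteMeasure ℝ) (h₀ : InD u₀ μ₀) :
    ∃ (u : ℝ → ℝ →ᵇ ℝ) (μ : ℝ → FiniteMeasure ℝ),
      -- existence and uniqueness
      IsConservativeSolution u₀ μ₀ u μ ∧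
      (∀ (v : ℝ → ℝ →ᵇ ℝ) (ν : ℝ → FiniteMeasure ℝ),
        IsConservativeSolution u₀ μ₀ v ν → v = u ∧ ν = μ) ∧
      -- representation by characteristics
      (∀ t α : ℝ, u t (charY u₀ μ₀ t α) = u₀ (xbar μ₀ α) + t / 2 * (α - xbar μ₀ α)) ∧
      (∀ t : ℝ, (μ t : Measure ℝ) = (lagEnergy μ₀).map (charY u₀ μ₀ t)) ∧
      -- (i) energy conservation
      Continuous μ ∧
      (∀ t : ℝ, (μ t : Measure ℝ) univ = (μ₀ : Measure ℝ) univ) ∧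
      -- (ii) structure of the singular parts, in the coordinate `α`
      (∀ t : ℝ,
        ppPart (μ t) = ((lagEnergy μ₀).restrict (lagPP u₀ μ₀ t)).map (charY u₀ μ₀ t) ∧
        scPart (μ t) = ((lagEnergy μ₀).restrict (lagSC u₀ μ₀ t)).map (charY u₀ μ₀ t) ∧
        acPart (μ t) = ((lagEnergy μ₀).restrict (lagAC u₀ μ₀ t)).map (charY u₀ μ₀ t)) ∧
      -- (ii) formation of singularities from `{u₀' = -2 / t}`, for any representative `g` of `u₀'`
      (∀ g : ℝ → ℝ, IsWeakDeriv u₀ g → ∀ t : ℝ, t ≠ 0 →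
        (lagPP u₀ μ₀ t ∪ lagSC u₀ μ₀ t : Set ℝ) =ᵐ[volume]
          ({α | (∃ d > 0, HasDerivAt (xbar μ₀) d α) ∧ xbar μ₀ α ∈ singSet g t} : Set ℝ) ∧
        (volume (singSet g t) ≠ 0 → ppPart (μ t) + scPart (μ t) ≠ 0) ∧
        (ppPart (μ t) + scPart (μ t)) (flowMap u₀ μ₀ t '' singSet g t)ᶜ = 0 ∧
        (ppPart (μ t) + scPart (μ t)).support ⊆ closure (flowMap u₀ μ₀ t '' singSet g t) ∧
        ppPart (μ t) = ((acPart μ₀).restrict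
          (singSet g t ∩ intervalPart μ₀ (singSet g t))).map (flowMap u₀ μ₀ t) ∧
        scPart (μ t) = ((acPart μ₀).restrict
          (singSet g t \ intervalPart μ₀ (singSet g t))).map (flowMap u₀ μ₀ t)) ∧
      -- (iii) countably many singular times
      {t : ℝ | ppPart (μ t) ≠ 0}.Countable ∧
      {t : ℝ | scPart (μ t) ≠ 0}.Countable ∧
      -- (iv) regularity
      (∀ t : ℝ, GloballyAC (u t)) ∧
      (∀ (t : ℝ) (g : ℝ → ℝ), IsWeakDeriv (u t) g → acPart (μ t) = sqMeasure g) ∧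
      Continuous u ∧ LocHolderHalf u ∧
      (∃ U : ℝ → Lp ℝ 2 (volume : Measure ℝ),
        (∀ t, IsWeakDeriv (u t) (U t)) ∧ MemLp U ∞ (volume : Measure ℝ)) ∧
      (∃ w, IsL2locTimeDeriv u w) ∧
      -- (v) asymptotic behaviour
      (∀ l : ℝ, Tendsto u₀ atBot (𝓝 l) → ∀ t : ℝ, Tendsto (u t) atBot (𝓝 l)) ∧
      (∀ l : ℝ, Tendsto u₀ atTop (𝓝 l) → ∀ t : ℝ,
        Tendsto (u t) atTop (𝓝 (l + 1 / 2 * (μ₀ : Measure ℝ).real univ * t))) := by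
  refine ⟨h₀.vel, h₀.energy, h₀.isConservativeSolution,
    fun v ν h => h.eq_of_isConservativeSolution h₀.isConservativeSolution,
    h₀.vel_charY, h₀.energy_eq_map, h₀.continuous_energy, h₀.energy_univ, ?_, ?_,
    h₀.countable_ppPart, h₀.countable_scPart, fun t => (h₀.chart t).globallyAC_eulVel, ?_,
    h₀.continuous_vel, h₀.locHolderHalf, h₀.exists_derivLp, ⟨_, h₀.isL2locTimeDeriv⟩,
    fun l hl => h₀.tendsto_vel_atBot hl, fun l hl => h₀.tendsto_vel_atTop hl⟩
  · rw [lagEnergy_eq]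
    exact fun t => ⟨h₀.ppPart_energy t, h₀.scPart_energy t, h₀.acPart_energy_eq_map t⟩
  · intro g hg t ht
    refine ⟨?_, h₀.ppPart_add_scPart_ne_zero hg ht, h₀.singular_compl_image hg ht,
      support_subset_closure_of_compl (h₀.singular_compl_image hg ht),
      h₀.ppPart_eq_flowMap hg ht, h₀.scPart_eq_flowMap hg ht⟩
    rw [lagPP_union_lagSC]
    exact h₀.zeroSet_ae_eq hg ht
  · intro t g hg
    rw [h₀.acPart_energy]
    exact sqMeasure_congr ((h₀.isWeakDeriv_vel t).ae_eq hg)
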